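/- Let $n\ge 1$, $d\ge 2$, and let $q\in\mathbb{C}^\times$ satisfy $q^k\neq 1$ for $1\le k\le n$. Let $\mathfrak{h}_{\rm reg}$ be the variety of all $(x_i,a_i^\alpha,b_i^\alpha)_{1\le i\le n}^{1\le\alpha\le d}\in(\mathbb{C}^\times)^n\times\mathbb{C}^{2nd}$ such that $x_i\ne x_j$ and $x_i\neq qx_j$ for $i\ne j$, $\sum_\alpha a_i^\alpha=1$ for all $i$, and $\det\mathcal{Z}_k\neq0$ for $0\le k\le d$, where $$f_{ij}=\sum_{\alpha}a_i^\alpha b_j^\alpha,\qquad Z_{ij}=\frac{q f_{ij}}{x_ix_j^{-1}-q},\qquad (\mathcal{Z}_k)_{ij}=Z_{ij}+\sum_{\beta\le k}a_i^\beta b_j^\beta .$$ The symmetric group $S_n$ acts on $\mathfrak{h}_{\rm reg}$ by simultaneous permutation of the lower indices, and $\mathfrak{h}_{\rm reg}/S_n$ is the local model of the spin Ruijsenaars–Schneider (RS) phase space. Let $o(\alpha,\beta)=1,-1,0$ if $\alpha<\beta$, $\alpha>\beta$, $\alpha=\beta$ respectively, and put $\rho_{ij}=\frac{x_i+x_j}{x_i-x_j}$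 for $i\neq j$, $\rho_{ii}=0$. Brackets on $\mathfrak{h}_{\rm reg}/S_n$ (antisymmetric biderivations of $\mathbb{C}[\mathfrak{h}_{\rm reg}]^{S_n}$) are specified by their values on the local coordinates $x_i,a_i^\alpha,b_i^\alpha$. (i) The Chalykh–Fairon bracket $\{-,-\}_0$ has $\{x_i,x_j\}_0=\{x_i,a_j^\alpha\}_0=0$, $\{x_i,b_j^\alpha\}_0=\delta_{ij}x_ib_j^\alpha$, $$\{a_i^\alpha,a_j^\beta\}_0=\tfrac12\rho_{ij}(a_i^\alpha a_j^\beta+a_j^\alpha a_i^\beta-a_j^\alpha a_j^\beta-a_i^\alpha a_i^\beta)+\tfrac12o(\beta,\alpha)(a_i^\alpha a_j^\beta+a_j^\alpha a_i^\beta)+\tfrac12\sum_\gamma o(\alpha,\gamma)a_j^\beta(a_i^\alpha a_j^\gamma+a_j^\alpha a_i^\gamma)-\tfrac12\sum_\gamma o(\beta,\gamma)a_i^\alpha(a_j^\beta a_i^\gamma+a_i^\beta a_j^\gamma),$$ $$\{a_i^\alpha,b_j^\beta\}_0=(a_i^\alpha-\delta_{\alpha\beta})Z_{ij}-\tfrac12\rho_{ij}(a_i^\alpha-a_j^\alpha)b_j^\beta+\delta_{(\alpha<\beta)}a_i^\alpha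 b_j^\beta+a_i^\alpha\sum_{\gamma<\beta}a_i^\gamma(b_j^\gamma-b_j^\beta)-\delta_{\alpha\beta}\sum_{\gamma<\beta}a_i^\gamma b_j^\gamma-\tfrac12\sum_\gamma o(\alpha,\gamma)b_j^\beta(a_i^\alpha a_j^\gamma+a_j^\alpha a_i^\gamma),$$ $$\{b_i^\alpha,b_j^\beta\}_0=\tfrac12\rho_{ij}(b_i^\alpha b_j^\beta+b_j^\alpha b_i^\beta)-b_i^\alpha Z_{ij}+b_j^\beta Z_{ji}+\tfrac12o(\beta,\alpha)(b_i^\alpha b_j^\beta-b_j^\alpha b_i^\beta)-b_i^\alpha\sum_{\gamma<\beta}a_i^\gamma(b_j^\gamma-b_j^\beta)+b_j^\beta\sum_{\gamma<\alpha}a_j^\gamma(b_i^\gamma-b_i^\alpha).$$ (ii) The minus bracket $\{-,-\}_-$ of Arutyunov–Olivucci has the same brackets of $x_i$ with the coordinates and, with $\Omega_{ij}=\sum_{\gamma,\epsilon}o(\epsilon,\gamma)a_i^\epsilon a_j^\gamma$, $$\{a_i^\alpha,a_j^\beta\}_-=\tfrac12\rho_{ij}(a_i^\alpha a_j^\beta+a_j^\alpha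 a_i^\beta-a_j^\alpha a_j^\beta-a_i^\alpha a_i^\beta)+\tfrac12o(\beta,\alpha)a_j^\alpha a_i^\beta+\tfrac12\sum_\gamma o(\alpha,\gamma)a_j^\beta a_j^\alpha a_i^\gamma-\tfrac12\sum_\gamma o(\beta,\gamma)a_i^\alpha a_i^\beta a_j^\gamma+\tfrac12\Omega_{ij}a_i^\alpha a_j^\beta,$$ $$\{a_i^\alpha,b_j^\beta\}_-=(a_i^\alpha-\delta_{\alpha\beta})\Big(Z_{ij}+\sum_{\gamma<\beta}a_i^\gamma b_j^\gamma\Big)-\tfrac12\rho_{ij}(a_i^\alpha-a_j^\alpha)b_j^\beta-\tfrac12\sum_\gamma o(\alpha,\gamma)b_j^\beta a_j^\alpha a_i^\gamma-\tfrac12\Omega_{ij}a_i^\alpha b_j^\beta+\tfrac12a_i^\alpha a_i^\beta b_j^\beta-\tfrac12\delta_{\alpha\beta}a_i^\alpha b_j^\beta,$$ $$\{b_i^\alpha,b_j^\beta\}_-=\tfrac12\rho_{ij}(b_i^\alpha b_j^\beta+b_j^\alpha b_i^\beta)-b_i^\alpha Z_{ij}+b_j^\beta Z_{ji}-\tfrac12o(\beta,\alpha)b_j^\alpha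 b_i^\beta-b_i^\alpha\sum_{\gamma<\beta}a_i^\gamma b_j^\gamma+b_j^\beta\sum_{\gamma<\alpha}a_j^\gamma b_i^\gamma+\tfrac12\Omega_{ij}b_i^\alpha b_j^\beta+\tfrac12(a_j^\alpha-a_i^\beta)b_i^\alpha b_j^\beta.$$ (iii) For $z=(z_{\alpha\beta})_{\alpha<\beta}\in\mathbb{C}^{d(d-1)/2}$, extended antisymmetrically, the bracket $\psi_z$ vanishes as soon as one argument is some $x_i$, and $\psi_z(a_i^\alpha,a_j^\beta)=G\,a_i^\alpha a_j^\beta$, $\psi_z(a_i^\alpha,b_j^\beta)=-G\,a_i^\alpha b_j^\beta$, $\psi_z(b_i^\alpha,b_j^\beta)=G\,b_i^\alpha b_j^\beta$ with $$G=G_z(i,j;\alpha,\beta)=z_{\alpha\beta}+\sum_\mu(z_{\mu\alpha}a_j^\mu-z_{\mu\beta}a_i^\mu)+\sum_{\mu,\nu}z_{\mu\nu}a_i^\mu a_j^\nu .$$ Then these formulas determine unique brackets on $\mathfrak{h}_{\rm reg}/S_n$, $\psi_z$ is linear in $z$, and: 1. $\{-,-\}_0$ and the $\psi_z$ span a Poisson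 pencil: every linear combination $z_0\{-,-\}_0+\psi_z$, $z_0\in\mathbb{C}$, is a Poisson bracket. Its order $r$ (the largest $r$ such that $r$ brackets among $\{-,-\}_0$ and the $\psi_z$ with $z$ a standard basis vector have linearly independent bivectors at some point) satisfies $\frac{(d-1)(d-2)}2+1\le r\le\frac{d(d-1)}2$. 2. $\{-,-\}_-=\{-,-\}_0+\psi_{z^-}$ with $z^-_{\alpha\beta}=\frac12$ for $\alpha<\beta$. So both brackets belong to this pencil, and they are compatible: all their linear combinations are Poisson brackets. 3. Let $h=2(q^{-1}-1)\operatorname{tr}Z=2\sum_if_{ii}$. For all $z_0\ne0$ and $z$, the derivation $\frac{d}{dt}=\{-,z_0^{-1}h\}$ of the bracket $\{-,-\}=z_0\{-,-\}_0+\psi_z$ gives the trigonometric spin RS equations $$\frac{dx_i}{dt}=2f_{ii}x_i,\qquad \frac{da_i^\alpha}{dt}=\sum_{k\ne i}V_{ik}f_{ik}(a_k^\alpha-a_i^\alpha),\qquad \frac{db_i^\alpha}{dt}=\sum_{k\neq i}\big(V_{ik}f_{ik}b_i^\alpha-V_{ki}f_{ki}b_k^\alpha\big),$$ with $V_{ik}=\frac{x_i+x_k}{x_i-x_k}-\frac{x_i+qx_k}{x_i-qx_k}$.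 In particular, for every non-degenerate bracket of the pencil there is $c\in\mathbb{C}^\times$ such that the Hamiltonian $c\,h$ gives these equations. -/

import Mathlib

namespace SpinRS

/-! ### Brackets on commutative algebras -/

/-- A `ℂ`-bilinear operation on a `ℂ`-algebra. -/
abbrev Bracket (A : Type*) [CommRing A] [Algebra ℂ A] : Type _ := A →ₗ[ℂ] A →ₗ[ℂ] A

/-- An antisymmetric biderivation, i.e. a bivector field in algebraic form. -/
def IsSkewBiderivation {A : Type*} [CommRing A] [Algebra ℂ A] (B : Bracket A) : Prop :=
  (∀ F G, B F G = -B G F) ∧ ∀ F G H, B F (G * H) = G * B F H + B F G * H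

/-- A Poisson bracket: an antisymmetric biderivation satisfying the Jacobi identity. -/
def IsPoisson {A : Type*} [CommRing A] [Algebra ℂ A] (B : Bracket A) : Prop :=
  IsSkewBiderivation B ∧ ∀ F G H, B F (B G H) + B G (B H F) + B H (B F G) = 0

/-- A family of brackets is a Poisson pencil if every finite linear combination is Poisson. -/
def IsPoissonPencil {A J : Type*} [CommRing A] [Algebra ℂ A] (P : J → Bracket A) : Prop :=
  ∀ c : J →₀ ℂ, IsPoisson (c.sum fun j z => z • P j)

/-- Evaluation at a point, on an algebra of functions. -/
def evalPt {M : Type*} (A : Subalgebra ℂ (M → ℂ)) (x : M) : A →ₗ[ℂ] ℂ :=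
  (LinearMap.proj x : (M → ℂ) →ₗ[ℂ] ℂ) ∘ₗ A.val.toLinearMap

/-- The value at a point `x` of a bivector field, as the bilinear form
`(F, G) ↦ {F, G}(x) = ⟨P_x, dF ⊗ dG⟩`. -/
def bivectorAt {M : Type*} {A : Subalgebra ℂ (M → ℂ)} (B : Bracket A) (x : M) :
    A →ₗ[ℂ] A →ₗ[ℂ] ℂ :=
  B.compr₂ (evalPt A x)

/-- The order of a pencil: the largest `r` such that some `r` members of the spanning family have
linearly independent values at some point. -/
def HasOrder {M J : Type*} {A : Subalgebra ℂ (M → ℂ)} (P : J → Bracket A) (r : ℕ) : Prop :=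
  IsGreatest {k : ℕ | ∃ (j : Fin k → J) (x : M),
    LinearIndependent ℂ fun i => bivectorAt (P (j i)) x} r

/-- Non-degeneracy: at each point `x`, every tangent vector (point derivation at `x`) is the value
at `x` of a Hamiltonian vector field, i.e. `P_x^♯ : T_x^* → T_x` is onto. -/
def IsNondegenerate {M : Type*} {A : Subalgebra ℂ (M → ℂ)} (B : Bracket A) : Prop :=
  ∀ (x : M) (v : A →ₗ[ℂ] ℂ), (∀ F G : A, v (F * G) = F.1 x * v G + v F * G.1 x) →
    ∃ F : A, ∀ G : A, v G = (B F G).1 x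

/-! ### The space `h_reg / S_n` -/

/-- Labels of the coordinates `x_i`, `a_i^α`, `b_i^α`. -/
inductive Coord (n d : ℕ) : Type
  | x (i : Fin n) : Coord n d
  | a (i : Fin n) (α : Fin d) : Coord n d
  | b (i : Fin n) (α : Fin d) : Coord n d

variable {n d : ℕ}

/-- Simultaneous permutation of the particle indices. -/
def Coord.perm (σ : Equiv.Perm (Fin n)) : Coord n d → Coord n d
  | .x i => .x (σ i)
  | .a i α => .a (σ i) α
  | .b i α => .b (σ i) α

/-- `f_{ij} = ∑_α a_i^α b_j^α`. -/
noncomputable def f (m : Coord n d → ℂ) (i j : Fin n) : ℂ :=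
  ∑ α : Fin d, m (.a i α) * m (.b j α)

/-- `Z_{ij} = q f_{ij} / (x_i x_j⁻¹ - q)`. -/
noncomputable def Z (q : ℂ) (m : Coord n d → ℂ) : Matrix (Fin n) (Fin n) ℂ :=
  Matrix.of fun i j => q * f m i j / (m (.x i) * (m (.x j))⁻¹ - q)

/-- `𝒵_k = Z + (sum of the first k rank one matrices a_i^β b_j^β)`, for `0 ≤ k ≤ d`. -/
noncomputable def calZ (q : ℂ) (m : Coord n d → ℂ) (k : ℕ) : Matrix (Fin n) (Fin n) ℂ :=
  Matrix.of fun i j => Z q m i j +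
    ∑ β ∈ Finset.univ.filter (fun β : Fin d => β.val < k), m (.a i β) * m (.b j β)

/-- The space `h_reg`. -/
def hReg (n d : ℕ) (q : ℂ) : Set (Coord n d → ℂ) :=
  {m | (∀ i, m (.x i) ≠ 0) ∧
    (∀ i j, i ≠ j → m (.x i) ≠ m (.x j) ∧ m (.x i) ≠ q * m (.x j)) ∧
    (∀ i, ∑ α : Fin d, m (.a i α) = 1) ∧
    ∀ k ≤ d, (calZ q m k).det ≠ 0}

/-- Two points of `h_reg` are equivalent if they differ by a permutation of `{1, …, n}`. -/
instance permSetoid (n d : ℕ) (q : ℂ) : Setoid (hReg n d q) where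
  r m m' := ∃ σ : Equiv.Perm (Fin n), ∀ c, m'.1 c = m.1 (c.perm σ)
  iseqv :=
    { refl := fun m => ⟨1, fun c => by cases c <;> rfl⟩
      symm := by
        rintro m m' ⟨σ, h⟩
        exact ⟨σ⁻¹, fun c => by cases c <;> simp [h, Coord.perm]⟩
      trans := by
        rintro m m' m'' ⟨σ, h⟩ ⟨τ, h'⟩
        exact ⟨σ * τ, fun c => by cases c <;> simp [h, h', Coord.perm]⟩ }

/-- The quotient `h_reg / S_n`. -/
abbrev Phase (n d : ℕ) (q : ℂ) : Type := Quotient (permSetoid n d q)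

/-- The algebra of regular functions on `h_reg`: quotients of two polynomials in the coordinates,
with a denominator vanishing nowhere on `h_reg`. -/
noncomputable def regUp (n d : ℕ) (q : ℂ) : Subalgebra ℂ (hReg n d q → ℂ) where
  carrier := {F | ∃ p s : MvPolynomial (Coord n d) ℂ, ∀ m : hReg n d q,
    MvPolynomial.eval m.1 s ≠ 0 ∧ F m = MvPolynomial.eval m.1 p / MvPolynomial.eval m.1 s}
  mul_mem' := by
    rintro F G ⟨p, s, h⟩ ⟨p', s', h'⟩
    refine ⟨p * p', s * s', fun m => ⟨?_, ?_⟩⟩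
    · simpa using ⟨(h m).1, (h' m).1⟩
    · simp [(h m).2, (h' m).2, div_mul_div_comm]
  add_mem' := by
    rintro F G ⟨p, s, h⟩ ⟨p', s', h'⟩
    refine ⟨p * s' + s * p', s * s', fun m => ⟨?_, ?_⟩⟩
    · simpa using ⟨(h m).1, (h' m).1⟩
    · simp [(h m).2, (h' m).2, div_add_div _ _ (h m).1 (h' m).1]
  algebraMap_mem' := fun c => ⟨MvPolynomial.C c, 1, fun m => by simp⟩

/-- The coordinate functions on `h_reg`. -/
noncomputable def coordFn (q : ℂ) (c : Coord n d) : regUp n d q :=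
  ⟨fun m => m.1 c, MvPolynomial.X c, 1, fun m => by simp⟩

/-- The pullback of functions along `h_reg → h_reg / S_n`. -/
def pullFn (n d : ℕ) (q : ℂ) : (Phase n d q → ℂ) →ₐ[ℂ] (hReg n d q → ℂ) where
  toFun F m := F ⟦m⟧
  map_one' := rfl
  map_mul' _ _ := rfl
  map_zero' := rfl
  map_add' _ _ := rfl
  commutes' _ := rfl

/-- The algebra of regular functions on `h_reg / S_n`, i.e. `ℂ[h_reg]^{S_n}`. -/
noncomputable def reg (n d : ℕ) (q : ℂ) : Subalgebra ℂ (Phase n d q → ℂ) :=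
  (regUp n d q).comap (pullFn n d q)

/-- The pullback of regular functions along `h_reg → h_reg / S_n`. -/
noncomputable def pull (q : ℂ) (F : reg n d q) : regUp n d q := ⟨pullFn n d q F.1, F.2⟩

/-- `B'` on `ℂ[h_reg]` is the local form of the bracket `B` on `h_reg / S_n`: an antisymmetric
biderivation for which `h_reg → h_reg / S_n` preserves brackets. As the `x_i` are distinct, this
covering is étale, so that `B'` is determined by `B`. -/
def IsLocalForm {q : ℂ} (B : Bracket (reg n d q)) (B' : Bracket (regUp n d q)) : Prop :=
  IsSkewBiderivation B' ∧ ∀ F G, pull q (B F G) = B' (pull q F) (pull q G)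

/-- The bracket `B` on `h_reg / S_n` is given, in the local coordinates `x_i, a_i^α, b_i^α`,
by the values `T`. -/
def IsGivenBy {q : ℂ} (T : (Coord n d → ℂ) → Coord n d → Coord n d → ℂ)
    (B : Bracket (reg n d q)) : Prop :=
  ∃ B' : Bracket (regUp n d q), IsLocalForm B B' ∧
    ∀ (m : hReg n d q) (u v : Coord n d), (B' (coordFn q u) (coordFn q v)).1 m = T m.1 u v

/-! ### The brackets in local coordinates -/

/-- `o(α, β)` is `1` if `α < β`, `-1` if `β < α`, and `0` if `α = β`. -/
def o (α β : Fin d) : ℂ := if α < β then 1 else if β < α then -1 else 0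

/-- `δ_{(i ≠ j)} (x_i + x_j) / (x_i - x_j)`. -/
noncomputable def ratio (m : Coord n d → ℂ) (i j : Fin n) : ℂ :=
  if i ≠ j then (m (.x i) + m (.x j)) / (m (.x i) - m (.x j)) else 0

/-- Assembles an antisymmetric table of brackets of coordinates with `{x_i, x_j} = 0`,
`{x_i, a_j^α} = 0`, `{x_i, b_j^α} = ε δ_{ij} x_i b_j^α`, out of `{a_i^α, a_j^β}`,
`{a_i^α, b_j^β}` and `{b_i^α, b_j^β}`. -/
noncomputable def table (ε : ℂ)
    (aa ab bb : (Coord n d → ℂ) → Fin n → Fin n → Fin d → Fin d → ℂ)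
    (m : Coord n d → ℂ) : Coord n d → Coord n d → ℂ
  | .x _, .x _ => 0
  | .x _, .a _ _ => 0
  | .a _ _, .x _ => 0
  | .x i, .b j α => if i = j then ε * (m (.x i) * m (.b j α)) else 0
  | .b j α, .x i => if i = j then -(ε * (m (.x i) * m (.b j α))) else 0
  | .a i α, .a j β => aa m i j α β
  | .a i α, .b j β => ab m i j α β
  | .b j β, .a i α => -ab m i j α β
  | .b i α, .b j β => bb m i j α β

/-- `{a_i^α, a_j^β}_0` (Chalykh–Fairon). -/
noncomputable def cfAA (m : Coord n d → ℂ) (i j : Fin n) (α β : Fin d) : ℂ :=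
  1 / 2 * ratio m i j * (m (.a i α) * m (.a j β) + m (.a j α) * m (.a i β)
      - m (.a j α) * m (.a j β) - m (.a i α) * m (.a i β))
    + 1 / 2 * o β α * (m (.a i α) * m (.a j β) + m (.a j α) * m (.a i β))
    + 1 / 2 * ∑ γ : Fin d, o α γ * m (.a j β) *
        (m (.a i α) * m (.a j γ) + m (.a j α) * m (.a i γ))
    - 1 / 2 * ∑ γ : Fin d, o β γ * m (.a i α) *
        (m (.a j β) * m (.a i γ) + m (.a i β) * m (.a j γ))

/-- `{a_i^α, b_j^β}_0` (Chalykh–Fairon). -/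
noncomputable def cfAB (q : ℂ) (m : Coord n d → ℂ) (i j : Fin n) (α β : Fin d) : ℂ :=
  m (.a i α) * Z q m i j - (if α = β then Z q m i j else 0)
    - 1 / 2 * ratio m i j * (m (.a i α) - m (.a j α)) * m (.b j β)
    + (if α < β then m (.a i α) * m (.b j β) else 0)
    + m (.a i α) * ∑ γ ∈ Finset.univ.filter (fun γ => γ < β),
        m (.a i γ) * (m (.b j γ) - m (.b j β))
    - (if α = β then ∑ γ ∈ Finset.univ.filter (fun γ => γ < β), m (.a i γ) * m (.b j γ) else 0)
    - 1 / 2 * ∑ γ : Fin d, o α γ * m (.b j β) *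
        (m (.a i α) * m (.a j γ) + m (.a j α) * m (.a i γ))

/-- `{b_i^α, b_j^β}_0` (Chalykh–Fairon). -/
noncomputable def cfBB (q : ℂ) (m : Coord n d → ℂ) (i j : Fin n) (α β : Fin d) : ℂ :=
  1 / 2 * ratio m i j * (m (.b i α) * m (.b j β) + m (.b j α) * m (.b i β))
    - m (.b i α) * Z q m i j + m (.b j β) * Z q m j i
    + 1 / 2 * o β α * (m (.b i α) * m (.b j β) - m (.b j α) * m (.b i β))
    - m (.b i α) * ∑ γ ∈ Finset.univ.filter (fun γ => γ < β),
        m (.a i γ) * (m (.b j γ) - m (.b j β))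
    + m (.b j β) * ∑ γ ∈ Finset.univ.filter (fun γ => γ < α),
        m (.a j γ) * (m (.b i γ) - m (.b i α))

/-- The Chalykh–Fairon bracket `{-,-}_0` in local coordinates. -/
noncomputable def cfTable (q : ℂ) : (Coord n d → ℂ) → Coord n d → Coord n d → ℂ :=
  table 1 cfAA (cfAB q) (cfBB q)

/-- `∑_{γ,ε} o(ε,γ) a_i^ε a_j^γ`. -/
noncomputable def oo (m : Coord n d → ℂ) (i j : Fin n) : ℂ :=
  ∑ γ : Fin d, ∑ ε : Fin d, o ε γ * m (.a i ε) * m (.a j γ)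

/-- `{a_i^α, a_j^β}_-` (Arutyunov–Olivucci). -/
noncomputable def aoAA (m : Coord n d → ℂ) (i j : Fin n) (α β : Fin d) : ℂ :=
  1 / 2 * ratio m i j * (m (.a i α) * m (.a j β) + m (.a j α) * m (.a i β)
      - m (.a j α) * m (.a j β) - m (.a i α) * m (.a i β))
    + 1 / 2 * o β α * m (.a j α) * m (.a i β)
    + 1 / 2 * ∑ γ : Fin d, o α γ * m (.a j β) * m (.a j α) * m (.a i γ)
    - 1 / 2 * ∑ γ : Fin d, o β γ * m (.a i α) * m (.a i β) * m (.a j γ)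
    + 1 / 2 * oo m i j * m (.a i α) * m (.a j β)

/-- `{a_i^α, b_j^β}_-` (Arutyunov–Olivucci). -/
noncomputable def aoAB (q : ℂ) (m : Coord n d → ℂ) (i j : Fin n) (α β : Fin d) : ℂ :=
  m (.a i α) * Z q m i j - (if α = β then Z q m i j else 0)
    - 1 / 2 * ratio m i j * (m (.a i α) - m (.a j α)) * m (.b j β)
    + m (.a i α) * ∑ γ ∈ Finset.univ.filter (fun γ => γ < β), m (.a i γ) * m (.b j γ)
    - (if α = β then ∑ γ ∈ Finset.univ.filter (fun γ => γ < β), m (.a i γ) * m (.b j γ) else 0)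
    - 1 / 2 * ∑ γ : Fin d, o α γ * m (.b j β) * m (.a j α) * m (.a i γ)
    - 1 / 2 * oo m i j * m (.a i α) * m (.b j β)
    + 1 / 2 * m (.a i α) * m (.a i β) * m (.b j β)
    - (if α = β then 1 / 2 * m (.a i α) * m (.b j β) else 0)

/-- `{b_i^α, b_j^β}_-` (Arutyunov–Olivucci). -/
noncomputable def aoBB (q : ℂ) (m : Coord n d → ℂ) (i j : Fin n) (α β : Fin d) : ℂ :=
  1 / 2 * ratio m i j * (m (.b i α) * m (.b j β) + m (.b j α) * m (.b i β))
    - m (.b i α) * Z q m i j + m (.b j β) * Z q m j i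
    - 1 / 2 * o β α * m (.b j α) * m (.b i β)
    - m (.b i α) * ∑ γ ∈ Finset.univ.filter (fun γ => γ < β), m (.a i γ) * m (.b j γ)
    + m (.b j β) * ∑ γ ∈ Finset.univ.filter (fun γ => γ < α), m (.a j γ) * m (.b i γ)
    + 1 / 2 * oo m i j * m (.b i α) * m (.b j β)
    + 1 / 2 * (m (.a j α) - m (.a i β)) * m (.b i α) * m (.b j β)

/-- The minus bracket `{-,-}_-` of Arutyunov–Olivucci in local coordinates. -/
noncomputable def aoTable (q : ℂ) : (Coord n d → ℂ) → Coord n d → Coord n d → ℂ :=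
  table 1 aoAA (aoAB q) (aoBB q)

/-- Pairs of spin indices `α < β`. -/
abbrev SpinPair (d : ℕ) : Type := {p : Fin d × Fin d // p.1 < p.2}

/-- The antisymmetric matrix `(z_{αβ})` extending `(z_{αβ})_{α<β}`. -/
def skewExt (z : SpinPair d → ℂ) (α β : Fin d) : ℂ :=
  if h : α < β then z ⟨(α, β), h⟩ else if h : β < α then -z ⟨(β, α), h⟩ else 0

/-- The function `G_z(i, j; α, β)`. -/
noncomputable def gFun (z : SpinPair d → ℂ) (m : Coord n d → ℂ) (i j : Fin n) (α β : Fin d) : ℂ :=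
  skewExt z α β
    + ∑ μ : Fin d, (skewExt z μ α * m (.a j μ) - skewExt z μ β * m (.a i μ))
    + ∑ μ : Fin d, ∑ ν : Fin d, skewExt z μ ν * m (.a i μ) * m (.a j ν)

/-- The bracket `ψ_z^loc` in local coordinates. -/
noncomputable def psiTable (z : SpinPair d → ℂ) :
    (Coord n d → ℂ) → Coord n d → Coord n d → ℂ :=
  table 0 (fun m i j α β => gFun z m i j α β * m (.a i α) * m (.a j β))
    (fun m i j α β => -gFun z m i j α β * m (.a i α) * m (.b j β))
    (fun m i j α β => gFun z m i j α β * m (.b i α) * m (.b j β))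

/-- The spanning family of the pencil: `{-,-}_0`, and `ψ_z` for `z` the standard basis vectors. -/
def pencil {A : Type*} [CommRing A] [Algebra ℂ A] (P₀ : Bracket A)
    (ψ : (SpinPair d → ℂ) →ₗ[ℂ] Bracket A) : Option (SpinPair d) → Bracket A
  | none => P₀
  | some p => ψ (Pi.single p 1)

/-! ### The trigonometric spin Ruijsenaars–Schneider equations -/

/-- `V_{ik} = (x_i + x_k)/(x_i - x_k) - (x_i + q x_k)/(x_i - q x_k)`, for `i ≠ k`. -/
noncomputable def V (q : ℂ) (m : Coord n d → ℂ) (i k : Fin n) : ℂ :=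
  (m (.x i) + m (.x k)) / (m (.x i) - m (.x k))
    - (m (.x i) + q * m (.x k)) / (m (.x i) - q * m (.x k))

/-- The right-hand sides of the equations of motion of `x_i`, `a_i^α`, `b_i^α`. -/
noncomputable def rsField (q : ℂ) (m : Coord n d → ℂ) : Coord n d → ℂ
  | .x i => 2 * f m i i * m (.x i)
  | .a i α => ∑ k ∈ Finset.univ.filter (fun k => k ≠ i),
      V q m i k * f m i k * (m (.a k α) - m (.a i α))
  | .b i α => ∑ k ∈ Finset.univ.filter (fun k => k ≠ i),
      (V q m i k * f m i k * m (.b i α) - V q m k i * f m k i * m (.b k α))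

/-- With respect to the bracket `B` on `h_reg / S_n`, the Hamiltonian `h` generates the
trigonometric spin RS equations `du/dt = {u, h}` for every local coordinate `u`. -/
def GeneratesRS {q : ℂ} (B : Bracket (reg n d q)) (h : reg n d q) : Prop :=
  ∃ B' : Bracket (regUp n d q), IsLocalForm B B' ∧
    ∀ (m : hReg n d q) (u : Coord n d), (B' (coordFn q u) (pull q h)).1 m = rsField q m.1 u

end SpinRS

/-!
The difficulty is the Jacobi identity for `c {-,-}_- + ψ_z`. The idea is to drop the normalization
`∑_α a_i^α = 1`. For independent variables `x_i`, `a_i^α`, `b_i^α` put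
`r_{ij} = ½ (x_i + x_j)/(x_i - x_j)`, `s_{ij} = ½ (x_i + q x_j)/(x_i - q x_j)` and
`{a_i^α, a_j^β} = (r_{ij} + ½ o(β,α)) a_j^α a_i^β`,
`{b_i^α, b_j^β} = (r_{ij} - ½ o(β,α)) b_j^α b_i^β`,
`{a_i^α, b_j^β} = -δ_{αβ} ∑_γ (s_{ij} + ½ o(γ,α)) a_i^γ b_j^γ`. This is `rawBracket`. It is not
Poisson, but the Yang--Baxter equations for `r`, `s` and the signs `o` show that its Jacobiator is
`∑_p E_p ∧ Θ_p` for the generators `E_p` of the rescalings `a_p ↦ t a_p`, `b_p ↦ t⁻¹ b_p` and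
certain bivectors `Θ_p` (`jacobiator_rawBracket`). Hence the Jacobi identity holds for functions
invariant under all rescalings, such as the normalized coordinates `a_i^α / S_i` and `b_i^α S_i`
with `S_i = ∑_α a_i^α`; their brackets are those of Arutyunov and Olivucci. The rescalings of the
spin components, `a_i^μ ↦ t a_i^μ` and `b_i^μ ↦ t⁻¹ b_i^μ` for all `i`, form a torus of symmetries
of the bracket, and twisting by the constant bivectors `∑ z_{μν} ξ_μ ⊗ ξ_ν` in its generators `ξ_μ`
does not affect the Jacobi identity (`jacobiator_smul_add_torus`). On normalized coordinates the
twist is `ψ_z`, since `G_z(i,j;α,β) = z(e_α - a_i, e_β - a_j)`.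

The substitution of the normalized coordinates embeds `ℂ[h_reg]` into the field of rational
functions in the independent variables (`toRat`), because a polynomial that vanishes on `h_reg`
vanishes, after substitution, near a point of `h_reg`. The image is closed under the brackets, which
therefore restrict to `ℂ[h_reg]` (`upBracket`). They commute with permutations, and so descend to
`h_reg / S_n` (`downBracket`); uniqueness holds since biderivations are determined by their values
on coordinates. The Chalykh--Fairon bracket is `{-,-}_- - ψ_{1/2}`, by inspection of the formulas.

The equations of motion come from the brackets with `∑_k f_{kk}`, to which `ψ_z` does not contribute
(`LocalData.sum_pencilTable`). For the order of the pencil, and for the last statement, one uses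
that tangent vectors of `h_reg` are determined by their values on symmetric functions
(`pointDerivation_eq_zero`), and a point of `h_reg` at which all `a_i` are equal to
`(1/d, …, 1/d)` and all `b_i` to `(1, 0, …, 0)`, so that the `𝒵_k` are rescaled Cauchy matrices
(`exists_mem_hReg`). The upper bound on the order comes from the relation
`∑_{α < d} ψ_{αd} = 0`, which holds since the coordinates of each `e_α - a_i` sum to zero; a
non-degenerate bracket is not a `ψ_z`, because `∑_i x_i` is a Casimir function of `ψ_z`.
-/

namespace SpinRS

/-! ### Derivations and brackets -/

section Derivations

variable {ι A C : Type*} [CommRing A] [Algebra ℂ A] [CommRing C] [Algebra ℂ C]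

/-- A derivation `A → C` along an algebra homomorphism `φ : A → C`. -/
def IsDerivationAlong (φ : A →ₐ[ℂ] C) (D : A →ₗ[ℂ] C) : Prop :=
  ∀ F G, D (F * G) = φ F * D G + D F * φ G

/-- The family `s` generates the algebra `A` under the algebra operations and inverses of units. -/
def InvGenerates (s : ι → A) : Prop :=
  ∀ S : Subalgebra ℂ A, (∀ i, s i ∈ S) → (∀ F ∈ S, ∀ G, F * G = 1 → G ∈ S) → S = ⊤

namespace IsDerivationAlong

variable {φ : A →ₐ[ℂ] C} {D D' : A →ₗ[ℂ] C}

lemma map_one (hD : IsDerivationAlong φ D) : D 1 = 0 := by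
  have h := hD 1 1
  simp only [mul_one, _root_.map_one, one_mul] at h
  simpa using h

lemma map_algebraMap (hD : IsDerivationAlong φ D) (c : ℂ) : D (algebraMap ℂ A c) = 0 := by
  rw [Algebra.algebraMap_eq_smul_one, map_smul, hD.map_one, smul_zero]

lemma map_inv (hD : IsDerivationAlong φ D) {F G : A} (h : F * G = 1) :
    D G = φ (-(G * G)) * D F := by
  have h1 := hD F G
  rw [h, hD.map_one] at h1
  have h2 : φ F * φ G = 1 := by rw [← map_mul, h, _root_.map_one]
  rw [map_neg, map_mul]
  linear_combination (-φ G) * h1 - D G * h2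

/-- The values of a derivation lie in any submodule over its source that contains its values on
generators. -/
lemma mem_of_generates (hD : IsDerivationAlong φ D) {s : ι → A} (hs : InvGenerates s)
    (M : Submodule ℂ C) (hM : ∀ F, ∀ c ∈ M, φ F * c ∈ M) (h : ∀ i, D (s i) ∈ M) (F : A) :
    D F ∈ M := by
  let S : Subalgebra ℂ A :=
    { carrier := {F | D F ∈ M}
      mul_mem' := by
        intro F G hF hG
        have hF : D F ∈ M := hF
        have hG : D G ∈ M := hG
        change D (F * G) ∈ M
        rw [hD, mul_comm (D F)]
        exact M.add_mem (hM _ _ hG) (hM _ _ hF)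
      add_mem' := by
        intro F G hF hG
        change D (F + G) ∈ M
        rw [map_add]
        exact M.add_mem hF hG
      algebraMap_mem' := by
        intro c
        change D _ ∈ M
        rw [hD.map_algebraMap]
        exact M.zero_mem }
  have hS : S = ⊤ := hs S h fun F hF G hFG => by
    change D G ∈ M
    rw [hD.map_inv hFG]
    exact hM _ _ hF
  have : F ∈ S := hS ▸ Algebra.mem_top
  exact this

lemma eq_zero (hD : IsDerivationAlong φ D) {s : ι → A} (hs : InvGenerates s)
    (h : ∀ i, D (s i) = 0) (F : A) : D F = 0 := by
  have := hD.mem_of_generates hs ⊥ (fun F c hc => by simp_all) (fun i => by simp [h]) F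
  simpa using this

lemma sub (hD : IsDerivationAlong φ D) (hD' : IsDerivationAlong φ D') :
    IsDerivationAlong φ (D - D') := by
  intro F G
  simp only [LinearMap.sub_apply, hD F G, hD' F G]
  ring

lemma add (hD : IsDerivationAlong φ D) (hD' : IsDerivationAlong φ D') :
    IsDerivationAlong φ (D + D') := by
  intro F G
  simp only [LinearMap.add_apply, hD F G, hD' F G]
  ring

lemma sum {J : Type*} {E : J → A →ₗ[ℂ] C} {t : Finset J} (h : ∀ j, IsDerivationAlong φ (E j)) :
    IsDerivationAlong φ (∑ j ∈ t, E j) := by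
  intro F G
  simp only [LinearMap.sum_apply, h _ F G, Finset.sum_add_distrib, Finset.mul_sum, Finset.sum_mul]

lemma mul_left (hD : IsDerivationAlong φ D) (c : C) :
    IsDerivationAlong φ (LinearMap.mulLeft ℂ c ∘ₗ D) := by
  intro F G
  simp only [LinearMap.comp_apply, LinearMap.mulLeft_apply, hD F G]
  ring

lemma ext_generates (hD : IsDerivationAlong φ D) (hD' : IsDerivationAlong φ D') {s : ι → A}
    (hs : InvGenerates s) (h : ∀ i, D (s i) = D' (s i)) (F : A) : D F = D' F := by
  have := (hD.sub hD').eq_zero hs (fun i => by simp [h]) F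
  exact sub_eq_zero.1 this

/-- The commutator of two derivations is a derivation. -/
lemma commutator {D D' : A →ₗ[ℂ] A} (hD : IsDerivationAlong (AlgHom.id ℂ A) D)
    (hD' : IsDerivationAlong (AlgHom.id ℂ A) D') :
    IsDerivationAlong (AlgHom.id ℂ A) (D ∘ₗ D' - D' ∘ₗ D) := by
  intro F G
  have h1 := hD
  have h2 := hD'
  simp only [IsDerivationAlong, AlgHom.id_apply] at h1 h2
  simp only [LinearMap.sub_apply, LinearMap.comp_apply, h1, h2, map_add, AlgHom.id_apply]
  ring

end IsDerivationAlong

namespace IsSkewBiderivation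

variable {B : Bracket A}

lemma derivation_right (hB : IsSkewBiderivation B) (F : A) :
    IsDerivationAlong (AlgHom.id ℂ A) (B F) := hB.2 F

lemma mul_left (hB : IsSkewBiderivation B) (F G H : A) :
    B (F * G) H = F * B G H + B F H * G := by
  rw [hB.1, hB.2, hB.1 G H, hB.1 F H]
  ring

lemma derivation_left (hB : IsSkewBiderivation B) (H : A) :
    IsDerivationAlong (AlgHom.id ℂ A) (B.flip H) := fun F G => hB.mul_left F G H

lemma add {B' : Bracket A} (hB : IsSkewBiderivation B) (hB' : IsSkewBiderivation B') :
    IsSkewBiderivation (B + B') := by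
  refine ⟨fun F G => ?_, fun F G H => ?_⟩
  · simp only [LinearMap.add_apply]; rw [hB.1, hB'.1]; ring
  · simp only [LinearMap.add_apply, hB.2, hB'.2]; ring

lemma smul (hB : IsSkewBiderivation B) (c : ℂ) : IsSkewBiderivation (c • B) := by
  refine ⟨fun F G => ?_, fun F G H => ?_⟩
  · simp only [LinearMap.smul_apply]; rw [hB.1, smul_neg]
  · simp only [LinearMap.smul_apply, hB.2, smul_add, mul_smul_comm, smul_mul_assoc]

/-- Two biderivations along `φ` that agree on generators are equal. -/
lemma ext_generates {φ : A →ₐ[ℂ] C} {P Q : A →ₗ[ℂ] A →ₗ[ℂ] C} {s : ι → A} (hs : InvGenerates s)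
    (hP : ∀ F, IsDerivationAlong φ (P F)) (hQ : ∀ F, IsDerivationAlong φ (Q F))
    (hP' : ∀ F, IsDerivationAlong φ (P.flip F)) (hQ' : ∀ F, IsDerivationAlong φ (Q.flip F))
    (h : ∀ i j, P (s i) (s j) = Q (s i) (s j)) (F G : A) : P F G = Q F G :=
  (hP F).ext_generates (hQ F) hs
    (fun j => (hP' (s j)).ext_generates (hQ' (s j)) hs (fun i => h i j) F) G

end IsSkewBiderivation

/-- The Jacobiator of a bracket, as the failure of `F ↦ {F, -}` to be a Lie algebra
homomorphism. -/
def jacobiator (B : Bracket A) (F G : A) : A →ₗ[ℂ] A :=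
  B F ∘ₗ B G - B G ∘ₗ B F - B (B F G)

lemma jacobiator_apply (B : Bracket A) (F G H : A) :
    jacobiator B F G H = B F (B G H) - B G (B F H) - B (B F G) H := rfl

lemma jacobiator_swap_left {B : Bracket A} (hB : IsSkewBiderivation B) (F G H : A) :
    jacobiator B F G H = -jacobiator B G F H := by
  simp only [jacobiator_apply]
  rw [hB.1 F G]
  simp only [map_neg, LinearMap.neg_apply]
  ring

lemma jacobiator_swap_right {B : Bracket A} (hB : IsSkewBiderivation B) (F G H : A) :
    jacobiator B F G H = -jacobiator B F H G := by
  simp only [jacobiator_apply]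
  rw [hB.1 H (B F G), hB.1 (B F H) G, hB.1 H G]
  simp only [map_neg]
  ring

lemma jacobiator_derivation {B : Bracket A} (hB : IsSkewBiderivation B) (F G : A) :
    IsDerivationAlong (AlgHom.id ℂ A) (jacobiator B F G) :=
  ((hB.derivation_right F).commutator (hB.derivation_right G)).sub (hB.derivation_right _)

lemma isPoisson_iff {B : Bracket A} :
    IsPoisson B ↔ IsSkewBiderivation B ∧ ∀ F G H, jacobiator B F G H = 0 := by
  refine and_congr_right fun hB => forall_congr' fun F => forall_congr' fun G =>
    forall_congr' fun H => ?_
  rw [jacobiator_apply, hB.1 H F, hB.1 H (B F G), map_neg, ← sub_eq_add_neg, ← sub_eq_add_neg]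

/-- An alternating triderivation that vanishes on generators vanishes. -/
lemma triderivation_eq_zero {s : ι → A} (hs : InvGenerates s) (T : A → A → A →ₗ[ℂ] A)
    (h12 : ∀ F G H, T F G H = -T G F H) (h23 : ∀ F G H, T F G H = -T F H G)
    (hd : ∀ F G, IsDerivationAlong (AlgHom.id ℂ A) (T F G))
    (h0 : ∀ u v w, T (s u) (s v) (s w) = 0) (F G H : A) : T F G H = 0 := by
  have h1 : ∀ u v H, T (s u) (s v) H = 0 := fun u v => (hd _ _).eq_zero hs (h0 u v)
  have h2 : ∀ u G H, T (s u) G H = 0 := fun u G =>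
    (hd _ _).eq_zero hs fun w => by rw [h23, h1, neg_zero]
  exact (hd _ _).eq_zero hs (fun w => by rw [h23, h12, h2, neg_zero, neg_zero]) H

/-- A bivector `∑ z_{μν} ξ_μ ⊗ ξ_ν` built from infinitesimal symmetries `ξ_μ` of `B` has vanishing
Schouten bracket with `B`. -/
lemma schouten_torus_eq_zero {κ : Type*} [Fintype κ] {B Ψ : Bracket A}
    (hB : IsSkewBiderivation B) {ξ : κ → A →ₗ[ℂ] A} {z : κ → κ → ℂ}
    (hz : ∀ μ ν, z μ ν = -z ν μ)
    (hinv : ∀ μ F G, ξ μ (B F G) = B (ξ μ F) G + B F (ξ μ G))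
    (hΨ : ∀ F G, Ψ F G = ∑ μ, ∑ ν, z μ ν • (ξ μ F * ξ ν G)) (F G H : A) :
    B F (Ψ G H) + Ψ F (B G H) - B G (Ψ F H) - Ψ G (B F H) - B (Ψ F G) H - Ψ (B F G) H = 0 := by
  have hswap : ∑ μ, ∑ ν, z μ ν • (B (ξ μ F) H * ξ ν G)
      = -∑ μ, ∑ ν, z μ ν • (ξ μ G * B (ξ ν F) H) := by
    rw [Finset.sum_comm, ← Finset.sum_neg_distrib]
    refine Finset.sum_congr rfl fun μ _ => ?_
    rw [← Finset.sum_neg_distrib]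
    refine Finset.sum_congr rfl fun ν _ => ?_
    rw [hz, neg_smul, mul_comm]
  simp only [hΨ, map_sum, map_smul, LinearMap.sum_apply, LinearMap.smul_apply, hB.2, hB.mul_left,
    hinv, smul_add, Finset.sum_add_distrib, mul_add, add_mul, hswap]
  have h6 : ∑ μ, ∑ ν, z μ ν • (B G (ξ μ F) * ξ ν H)
      = -∑ μ, ∑ ν, z μ ν • (B (ξ μ F) G * ξ ν H) := by
    simp only [← Finset.sum_neg_distrib, ← smul_neg, ← neg_mul, ← hB.1]
  rw [h6]
  ring

/-- If `ξ_μ` are pairwise commuting infinitesimal symmetries of `B`, then the Jacobiator of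
`c B + ∑ z_{μν} ξ_μ ⊗ ξ_ν` is `c²` times that of `B`. -/
lemma jacobiator_smul_add_torus {κ : Type*} [Fintype κ] {B Ψ : Bracket A}
    (hB : IsSkewBiderivation B) (hΨs : IsSkewBiderivation Ψ) {ξ : κ → A →ₗ[ℂ] A} {z : κ → κ → ℂ}
    (hz : ∀ μ ν, z μ ν = -z ν μ)
    (hξ : ∀ μ, IsDerivationAlong (AlgHom.id ℂ A) (ξ μ))
    (hcomm : ∀ μ ν F, ξ μ (ξ ν F) = ξ ν (ξ μ F))
    (hinv : ∀ μ F G, ξ μ (B F G) = B (ξ μ F) G + B F (ξ μ G))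
    (hΨ : ∀ F G, Ψ F G = ∑ μ, ∑ ν, z μ ν • (ξ μ F * ξ ν G)) (c : ℂ) (F G H : A) :
    jacobiator (c • B + Ψ) F G H = c ^ 2 • jacobiator B F G H := by
  have hΨinv : ∀ μ F G, ξ μ (Ψ F G) = Ψ (ξ μ F) G + Ψ F (ξ μ G) := by
    intro ρ F G
    simp only [hΨ, map_sum, map_smul, ← Finset.sum_add_distrib, ← smul_add]
    refine Finset.sum_congr rfl fun μ _ => Finset.sum_congr rfl fun ν _ => ?_
    rw [hξ ρ, AlgHom.id_apply, AlgHom.id_apply, hcomm ρ, hcomm ρ, add_comm]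
  have h1 := schouten_torus_eq_zero hB hz hinv hΨ F G H
  have h2 := schouten_torus_eq_zero hΨs hz hΨinv hΨ F G H
  have h3 : (2 : ℂ) • jacobiator Ψ F G H = 0 := by
    rw [two_smul, jacobiator_apply, ← h2]; ring
  have h4 : jacobiator Ψ F G H = 0 := by
    simpa using congrArg (fun t => (2⁻¹ : ℂ) • t) h3
  rw [jacobiator_apply] at h4
  simp only [jacobiator_apply, LinearMap.add_apply, LinearMap.smul_apply, map_add, map_smul]
  simp only [Algebra.smul_def, map_pow]
  linear_combination h4 + algebraMap ℂ A c * h1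

end Derivations

/-! ### Rational functions of the unreduced coordinates -/

section RationalFunctions

variable {n d : ℕ}

noncomputable instance : DecidableEq (Coord n d) := Classical.decEq _

noncomputable instance : Fintype (Coord n d) :=
  Fintype.ofSurjective
    (fun t : Fin n ⊕ (Fin n × Fin d) ⊕ (Fin n × Fin d) =>
      t.elim Coord.x (Sum.elim (fun p => Coord.a p.1 p.2) fun p => Coord.b p.1 p.2))
    (by
      rintro (i | ⟨i, α⟩ | ⟨i, α⟩)
      · exact ⟨.inl i, rfl⟩
      · exact ⟨.inr (.inl (i, α)), rfl⟩
      · exact ⟨.inr (.inr (i, α)), rfl⟩)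

/-- The field of rational functions of independent variables `x_i`, `a_i^α`, `b_i^α`; the
normalization `∑_α a_i^α = 1` is not imposed. -/
abbrev RatField (n d : ℕ) : Type := FractionRing (MvPolynomial (Coord n d) ℂ)

/-- The independent variables, as rational functions. -/
noncomputable def ratVar (u : Coord n d) : RatField n d :=
  algebraMap (MvPolynomial (Coord n d) ℂ) _ (MvPolynomial.X u)

lemma ratVar_generates : InvGenerates (ratVar : Coord n d → RatField n d) := by
  intro S hX hinv
  have hpoly : ∀ p : MvPolynomial (Coord n d) ℂ, algebraMap _ (RatField n d) p ∈ S := by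
    intro p
    induction p using MvPolynomial.induction_on with
    | C c =>
      rw [← MvPolynomial.algebraMap_eq, ← IsScalarTower.algebraMap_apply]
      exact S.algebraMap_mem c
    | add p q hp hq => rw [map_add]; exact S.add_mem hp hq
    | mul_X p u hp => rw [map_mul]; exact S.mul_mem hp (hX u)
  refine eq_top_iff.2 fun F _ => ?_
  obtain ⟨p, s, hs, rfl⟩ := IsFractionRing.div_surjective (A := MvPolynomial (Coord n d) ℂ) F
  rw [div_eq_mul_inv]
  refine S.mul_mem (hpoly p) (hinv _ (hpoly s) _ (mul_inv_cancel₀ ?_))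
  simp [nonZeroDivisors.ne_zero hs]

/-- The homomorphism `F ↦ F + ε v(F)` to the dual numbers that corresponds to the vector field
with components `v`. -/
noncomputable def dualHom (v : Coord n d → RatField n d) :
    RatField n d →ₐ[ℂ] TrivSqZeroExt (RatField n d) (RatField n d) :=
  IsLocalization.liftAlgHom (M := nonZeroDivisors (MvPolynomial (Coord n d) ℂ))
    (f := MvPolynomial.aeval fun u => TrivSqZeroExt.inl (ratVar u) + TrivSqZeroExt.inr (v u))
    (by
      intro s
      rw [TrivSqZeroExt.isUnit_iff_isUnit_fst, isUnit_iff_ne_zero]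
      have h : (TrivSqZeroExt.fstHom ℂ (RatField n d) (RatField n d)).comp
          (MvPolynomial.aeval fun u => TrivSqZeroExt.inl (ratVar u) + TrivSqZeroExt.inr (v u))
          = IsScalarTower.toAlgHom ℂ (MvPolynomial (Coord n d) ℂ) (RatField n d) := by
        ext u; simp [ratVar]
      have h' := DFunLike.congr_fun h s.1
      simp only [AlgHom.comp_apply, TrivSqZeroExt.fstHom_apply, IsScalarTower.toAlgHom_apply] at h'
      rw [h']
      simp)

lemma dualHom_ratVar (v : Coord n d → RatField n d) (u : Coord n d) :
    dualHom v (ratVar u) = TrivSqZeroExt.inl (ratVar u) + TrivSqZeroExt.inr (v u) := by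
  simp [dualHom, ratVar]

lemma fst_dualHom (v : Coord n d → RatField n d) (F : RatField n d) : (dualHom v F).fst = F := by
  have h : (TrivSqZeroExt.fstHom ℂ (RatField n d) (RatField n d)).comp (dualHom v)
      = AlgHom.id ℂ _ := by
    refine IsLocalization.algHom_ext (nonZeroDivisors (MvPolynomial (Coord n d) ℂ)) ?_
    ext u
    change (dualHom v (ratVar u)).fst = ratVar u
    simp [dualHom_ratVar]
  exact DFunLike.congr_fun h F

/-- The derivation (vector field) of the field of rational functions with components `v`. -/
noncomputable def vectorField (v : Coord n d → RatField n d) : RatField n d →ₗ[ℂ] RatField n d :=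
  TrivSqZeroExt.sndHom (RatField n d) (RatField n d) |>.restrictScalars ℂ |>.comp
    (dualHom v).toLinearMap

lemma vectorField_ratVar (v : Coord n d → RatField n d) (u : Coord n d) :
    vectorField v (ratVar u) = v u := by
  simp [vectorField, dualHom_ratVar]

lemma vectorField_derivation (v : Coord n d → RatField n d) :
    IsDerivationAlong (AlgHom.id ℂ _) (vectorField v) := by
  intro F G
  simp [vectorField, fst_dualHom, mul_comm]

/-- The biderivation of the field of rational functions with prescribed brackets `T` of
the variables. -/
noncomputable def bracketOf (T : Coord n d → Coord n d → RatField n d) : Bracket (RatField n d) :=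
  ∑ w, (LinearMap.mul ℂ (RatField n d)).compl₁₂ (vectorField (Pi.single w 1)) (vectorField (T w))

lemma bracketOf_apply (T : Coord n d → Coord n d → RatField n d) (F G : RatField n d) :
    bracketOf T F G = ∑ w, vectorField (Pi.single w 1) F * vectorField (T w) G := by
  simp [bracketOf]

lemma bracketOf_ratVar (T : Coord n d → Coord n d → RatField n d) (u v : Coord n d) :
    bracketOf T (ratVar u) (ratVar v) = T u v := by
  simp only [bracketOf_apply, vectorField_ratVar]
  simp [Pi.single_apply]

lemma bracketOf_derivation_right (T : Coord n d → Coord n d → RatField n d) (F : RatField n d) :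
    IsDerivationAlong (AlgHom.id ℂ _) (bracketOf T F) := by
  intro G H
  simp only [bracketOf_apply, vectorField_derivation _ G H, AlgHom.id_apply, Finset.mul_sum,
    Finset.sum_mul, ← Finset.sum_add_distrib]
  exact Finset.sum_congr rfl fun w _ => by ring

lemma bracketOf_derivation_left (T : Coord n d → Coord n d → RatField n d) (G : RatField n d) :
    IsDerivationAlong (AlgHom.id ℂ _) ((bracketOf T).flip G) := by
  intro F H
  simp only [LinearMap.flip_apply, bracketOf_apply, vectorField_derivation _ F H,
    AlgHom.id_apply, Finset.mul_sum, Finset.sum_mul, ← Finset.sum_add_distrib]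
  exact Finset.sum_congr rfl fun w _ => by ring

lemma bracketOf_skew {T : Coord n d → Coord n d → RatField n d} (hT : ∀ u v, T u v = -T v u) :
    IsSkewBiderivation (bracketOf T) := by
  refine ⟨fun F G => ?_, bracketOf_derivation_right T⟩
  have h : ∀ F, IsDerivationAlong (AlgHom.id ℂ _) ((-(bracketOf T).flip) F) := by
    intro F G H
    have := bracketOf_derivation_left T F G H
    simp only [LinearMap.flip_apply, AlgHom.id_apply] at this
    simp only [LinearMap.neg_apply, LinearMap.flip_apply, AlgHom.id_apply, this]
    ring
  have h' : ∀ F, IsDerivationAlong (AlgHom.id ℂ _) ((-(bracketOf T).flip).flip F) := by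
    intro F G H
    have := bracketOf_derivation_right T F G H
    simp only [AlgHom.id_apply] at this
    simp only [LinearMap.neg_apply, LinearMap.flip_apply, AlgHom.id_apply, this]
    ring
  exact IsSkewBiderivation.ext_generates ratVar_generates (bracketOf_derivation_right T) h
    (bracketOf_derivation_left T) h' (fun u v => by
      simpa [bracketOf_ratVar] using hT u v) F G

end RationalFunctions

/-! ### The data entering the brackets -/

section LocalData

variable {n d : ℕ}

/-- Half the sign `o(α, β)`, in a `ℂ`-algebra. -/
noncomputable def halfSign (A : Type*) [CommRing A] [Algebra ℂ A] (α β : Fin d) : A :=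
  algebraMap ℂ A (o α β / 2)

lemma o_skew (α β : Fin d) : o α β = -o β α := by
  unfold o
  rcases lt_trichotomy α β with h | h | h
  · simp [h, h.not_gt]
  · simp [h]
  · simp [h, h.not_gt]

lemma o_self (α : Fin d) : o α α = 0 := by simp [o]

/-- The classical Yang--Baxter equation for the constant part of the trigonometric `r`-matrix. -/
lemma o_cyclic (α β γ : Fin d) :
    o α β * o β γ + o β γ * o γ α + o γ α * o α β = if α = β ∧ β = γ then 0 else -1 := by
  unfold o
  rcases lt_trichotomy α β with h1 | h1 | h1 <;> rcases lt_trichotomy β γ with h2 | h2 | h2 <;>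
    rcases lt_trichotomy γ α with h3 | h3 | h3 <;>
    first
    | (exfalso; omega)
    | (subst_vars; simp_all [not_lt_of_gt, ne_of_lt, ne_of_gt])

section
variable {A : Type*} [CommRing A] [Algebra ℂ A]

lemma halfSign_skew (α β : Fin d) : halfSign A α β = -halfSign A β α := by
  rw [halfSign, halfSign, o_skew, neg_div, map_neg]

lemma halfSign_self (α : Fin d) : halfSign A α α = 0 := by simp [halfSign, o_self]

end

lemma halfSign_cyclic {A : Type*} [Field A] [Algebra ℂ A] (α β γ : Fin d) :
    halfSign A α β * halfSign A β γ + halfSign A β γ * halfSign A γ α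
      + halfSign A γ α * halfSign A α β = if α = β ∧ β = γ then 0 else -(1 / 4) := by
  have h := congrArg (fun t => algebraMap ℂ A (t / 4)) (o_cyclic α β γ)
  simp only [halfSign, ← map_mul, ← map_add]
  convert h using 2
  · ring
  · split_ifs
    · simp
    · rw [neg_div, map_neg, map_div₀, map_one, map_ofNat]

/-- The data entering the brackets of the spin variables: the vectors `a_i`, `b_i`, and
`r_{ij} = ½ (x_i + x_j)/(x_i - x_j)` (zero for `i = j`), `s_{ij} = ½ (x_i + q x_j)/(x_i - q x_j)`. -/
structure LocalData (A : Type*) (n d : ℕ) where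
  a : Fin n → Fin d → A
  b : Fin n → Fin d → A
  r : Fin n → Fin n → A
  s : Fin n → Fin n → A

namespace LocalData

variable {A : Type*} [CommRing A] [Algebra ℂ A] (L : LocalData A n d)

/-- The bracket `{a_i^α, a_j^β}` before normalization. -/
noncomputable def rawAA (i j : Fin n) (α β : Fin d) : A :=
  (L.r i j + halfSign A β α) * (L.a j α * L.a i β)

/-- The bracket `{b_i^α, b_j^β}` before normalization. -/
noncomputable def rawBB (i j : Fin n) (α β : Fin d) : A :=
  (L.r i j - halfSign A β α) * (L.b j α * L.b i β)

/-- The sum `∑_γ (s_{ij} + ½ o(γ, α)) a_i^γ b_j^γ`. -/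
noncomputable def pairing (i j : Fin n) (α : Fin d) : A :=
  ∑ γ, (L.s i j + halfSign A γ α) * (L.a i γ * L.b j γ)

/-- The bracket `{a_i^α, b_j^β}` before normalization. -/
noncomputable def rawAB (i j : Fin n) (α β : Fin d) : A :=
  if α = β then -L.pairing i j α else 0

end LocalData

/-- A table of brackets of the coordinates with `{x_i, x_j} = {x_i, a_j^α} = 0`,
`{x_i, b_j^α} = δ_{ij} y_i b_j^α`. -/
def assemble {A : Type*} [CommRing A] (y : Fin n → A) (b : Fin n → Fin d → A)
    (aa ab bb : Fin n → Fin n → Fin d → Fin d → A) : Coord n d → Coord n d → A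
  | .x _, .x _ => 0
  | .x _, .a _ _ => 0
  | .a _ _, .x _ => 0
  | .x i, .b j α => if i = j then y i * b j α else 0
  | .b j α, .x i => if i = j then -(y i * b j α) else 0
  | .a i α, .a j β => aa i j α β
  | .a i α, .b j β => ab i j α β
  | .b j β, .a i α => -ab i j α β
  | .b i α, .b j β => bb i j α β

lemma assemble_skew {A : Type*} [CommRing A] {y : Fin n → A} {b : Fin n → Fin d → A}
    {aa ab bb : Fin n → Fin n → Fin d → Fin d → A}
    (haa : ∀ i j α β, aa i j α β = -aa j i β α) (hbb : ∀ i j α β, bb i j α β = -bb j i β α)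
    (u v : Coord n d) : assemble y b aa ab bb u v = -assemble y b aa ab bb v u := by
  cases u <;> cases v <;> simp only [assemble, neg_zero, neg_neg]
  · split_ifs <;> simp
  · exact haa _ _ _ _
  · split_ifs <;> simp
  · exact hbb _ _ _ _

end LocalData

/-! ### The unreduced minus bracket and its Jacobiator -/

section Unreduced

variable {n d : ℕ} (q : ℂ)

/-- The variable `x_i` as a rational function. -/
noncomputable def xv (i : Fin n) : RatField n d := ratVar (.x i)

/-- The variable `a_i^α` as a rational function, not normalized. -/
noncomputable def av (i : Fin n) (α : Fin d) : RatField n d := ratVar (.a i α)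

/-- The variable `b_i^α` as a rational function, not normalized. -/
noncomputable def bv (i : Fin n) (α : Fin d) : RatField n d := ratVar (.b i α)

instance : CharZero (RatField n d) := algebraRat.charZero _

lemma ratVar_injective : Function.Injective (ratVar : Coord n d → RatField n d) :=
  (IsFractionRing.injective _ _).comp (MvPolynomial.X_injective)

lemma xv_ne (i : Fin n) : (xv i : RatField n d) ≠ 0 := by
  simp [xv, ratVar]

lemma xv_sub_ne {i j : Fin n} (h : i ≠ j) : (xv i - xv j : RatField n d) ≠ 0 :=
  sub_ne_zero.2 fun e => h (by simpa using ratVar_injective e)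

/-- The scalar `q` as a rational function. -/
noncomputable def qv : RatField n d := algebraMap ℂ _ q

lemma xv_sub_q_ne (hq : q ≠ 1) (i j : Fin n) : (xv i - qv q * xv j : RatField n d) ≠ 0 := by
  have h : (MvPolynomial.X (.x i) - MvPolynomial.C q * MvPolynomial.X (.x j) :
      MvPolynomial (Coord n d) ℂ) ≠ 0 := fun h => by
    have h1 := congrArg (MvPolynomial.eval fun _ => (1 : ℂ)) h
    simp only [map_sub, map_mul, MvPolynomial.eval_X, MvPolynomial.eval_C, mul_one,
      map_zero] at h1
    exact hq (sub_eq_zero.1 h1).symm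
  have h2 : (xv i - qv q * xv j : RatField n d) = algebraMap _ _
      (MvPolynomial.X (.x i) - MvPolynomial.C q * MvPolynomial.X (.x j) :
        MvPolynomial (Coord n d) ℂ) := by
    rw [map_sub, map_mul, ← MvPolynomial.algebraMap_eq, ← IsScalarTower.algebraMap_apply]
    rfl
  rw [h2]
  exact (map_ne_zero_iff _ (IsFractionRing.injective _ _)).2 h

/-- The unreduced coordinates. -/
noncomputable def rawData : LocalData (RatField n d) n d where
  a := av
  b := bv
  r i j := if i = j then 0 else (xv i + xv j) / (xv i - xv j) / 2
  s i j := (xv i + qv q * xv j) / (xv i - qv q * xv j) / 2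

lemma rawData_r_skew (i j : Fin n) : (rawData (d := d) q).r i j = -(rawData q).r j i := by
  simp only [rawData]
  split_ifs with h h' h'
  · simp
  · exact absurd h.symm h'
  · exact absurd h'.symm h
  · have h1 := xv_sub_ne (d := d) h
    have h2 := xv_sub_ne (d := d) (Ne.symm h)
    field_simp
    ring

/-- The unreduced minus bracket. -/
noncomputable def rawBracket : Bracket (RatField n d) :=
  bracketOf (assemble xv bv (rawData q).rawAA (rawData q).rawAB (rawData q).rawBB)

lemma rawBracket_skew : IsSkewBiderivation (rawBracket (n := n) (d := d) q) := by
  refine bracketOf_skew (assemble_skew (fun i j α β => ?_) fun i j α β => ?_)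
  · rw [LocalData.rawAA, LocalData.rawAA, rawData_r_skew, halfSign_skew]; ring
  · rw [LocalData.rawBB, LocalData.rawBB, rawData_r_skew, halfSign_skew]; ring

/-- The derivative `x_i ∂r_{ij}/∂x_i`, which is `¼ - r_{ij}²` for `i ≠ j` and zero for `i = j`. -/
noncomputable def rDefect (i j : Fin n) : RatField n d :=
  if i = j then 0 else 1 / 4 - (rawData q).r i j ^ 2

lemma rDefect_self (i : Fin n) : rDefect (d := d) q i i = 0 := by simp [rDefect]

lemma rDefect_symm (i j : Fin n) : rDefect (d := d) q i j = rDefect q j i := by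
  simp only [rDefect, eq_comm (a := i), rawData_r_skew q i j, neg_sq]

lemma rawData_r_self (i : Fin n) : (rawData (d := d) q).r i i = 0 := by simp [rawData]

/-- The Yang--Baxter equation for the spectral part of the trigonometric `r`-matrix, and its
failure at coinciding points. -/
lemma rawData_r_cyclic (i j k : Fin n) :
    (rawData (d := d) q).r i j * (rawData q).r j k + (rawData q).r j k * (rawData q).r k i
      + (rawData q).r k i * (rawData q).r i j
    = (if i = j then rDefect q j k else 0) + (if j = k then rDefect q k i else 0)
      + (if k = i then rDefect q i j else 0) - (if i = j ∧ j = k then 0 else 1 / 4) := by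
  by_cases hij : i = j
  · subst hij
    by_cases hik : i = k
    · subst hik; simp [rDefect, rawData]
    · have := rawData_r_skew (d := d) q k i
      simp only [rawData_r_self, rDefect, hik, Ne.symm hik, this, true_and, if_true, if_false]
      ring
  by_cases hjk : j = k
  · subst hjk
    have := rawData_r_skew (d := d) q j i
    simp only [rawData_r_self, rDefect, hij, Ne.symm hij, this, if_true, if_false, false_and]
    ring
  by_cases hik : k = i
  · subst hik
    have := rawData_r_skew (d := d) q k j
    simp only [rawData_r_self, rDefect, hij, hjk, this, if_true, if_false, false_and]
    ring
  · have h1 := xv_sub_ne (d := d) hij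
    have h2 := xv_sub_ne (d := d) hjk
    have h3 := xv_sub_ne (d := d) hik
    simp only [rawData, hij, hjk, hik, if_false, false_and]
    field_simp
    ring

/-- The Yang--Baxter equation with one point rescaled by `q`. -/
lemma rawData_rs_cyclic (hq : q ≠ 1) (i j k : Fin n) :
    (rawData (d := d) q).s j k * (rawData q).s i k + (rawData q).r i j * (rawData q).s i k
      - (rawData q).r i j * (rawData q).s j k
    = if i = j then (rawData q).s i k ^ 2 else 1 / 4 := by
  by_cases hij : i = j
  · subst hij; simp [rawData_r_self, sq]
  · have h1 := xv_sub_ne (d := d) hij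
    have h2 := xv_sub_q_ne (d := d) q hq i k
    have h3 := xv_sub_q_ne (d := d) q hq j k
    simp only [rawData, hij, if_false]
    field_simp
    ring

/-- The Yang--Baxter equation with two points rescaled by `q`. -/
lemma rawData_sr_cyclic (hq : q ≠ 1) (i j k : Fin n) :
    (rawData (d := d) q).s i j * (rawData q).s i k + (rawData q).r j k * (rawData q).s i k
      - (rawData q).r j k * (rawData q).s i j
    = if j = k then (rawData q).s i j ^ 2 else 1 / 4 := by
  by_cases hij : j = k
  · subst hij; simp [rawData_r_self, sq]
  · have h1 := xv_sub_ne (d := d) hij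
    have h2 := xv_sub_q_ne (d := d) q hq i j
    have h3 := xv_sub_q_ne (d := d) q hq i k
    simp only [rawData, hij, if_false]
    field_simp
    ring

end Unreduced

section Jacobi

lemma IsDerivationAlong.map_div {K : Type*} [Field K] [Algebra ℂ K] {D : K →ₗ[ℂ] K}
    (hD : IsDerivationAlong (AlgHom.id ℂ K) D) {G : K} (hG : G ≠ 0) (F : K) :
    D (F / G) = (D F - F / G * D G) / G := by
  have h := hD (F / G) G
  rw [div_mul_cancel₀ F hG] at h
  simp only [AlgHom.id_apply] at h
  field_simp at h ⊢
  linear_combination -h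

variable {n d : ℕ} (q : ℂ)

lemma rawBracket_x_x (i j : Fin n) : rawBracket (d := d) q (xv i) (xv j) = 0 :=
  bracketOf_ratVar _ _ _
lemma rawBracket_x_a (i j : Fin n) (α : Fin d) : rawBracket q (xv i) (av j α) = 0 :=
  bracketOf_ratVar _ _ _
lemma rawBracket_a_x (i j : Fin n) (α : Fin d) : rawBracket q (av j α) (xv i) = 0 :=
  bracketOf_ratVar _ _ _
lemma rawBracket_x_b (i j : Fin n) (α : Fin d) :
    rawBracket q (xv i) (bv j α) = if i = j then xv i * bv j α else 0 :=
  bracketOf_ratVar _ _ _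
lemma rawBracket_b_x (i j : Fin n) (α : Fin d) :
    rawBracket q (bv j α) (xv i) = if i = j then -(xv i * bv j α) else 0 :=
  bracketOf_ratVar _ _ _
lemma rawBracket_a_a (i j : Fin n) (α β : Fin d) :
    rawBracket q (av i α) (av j β)
      = ((rawData q).r i j + halfSign _ β α) * (av j α * av i β) :=
  bracketOf_ratVar _ _ _
lemma rawBracket_b_b (i j : Fin n) (α β : Fin d) :
    rawBracket q (bv i α) (bv j β)
      = ((rawData q).r i j - halfSign _ β α) * (bv j α * bv i β) :=
  bracketOf_ratVar _ _ _
lemma rawBracket_a_b (i j : Fin n) (α β : Fin d) :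
    rawBracket q (av i α) (bv j β) = if α = β then -(rawData q).pairing i j α else 0 :=
  bracketOf_ratVar _ _ _
lemma rawBracket_b_a (i j : Fin n) (α β : Fin d) :
    rawBracket q (bv i α) (av j β) = if β = α then (rawData q).pairing j i β else 0 := by
  rw [(rawBracket_skew q).1, rawBracket_a_b]
  split_ifs <;> simp

lemma rawBracket_mul (F G H : RatField n d) :
    rawBracket q F (G * H) = G * rawBracket q F H + rawBracket q F G * H :=
  (rawBracket_skew q).2 F G H

lemma rawBracket_mul_left (F G H : RatField n d) :
    rawBracket q (F * G) H = F * rawBracket q G H + rawBracket q F H * G :=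
  (rawBracket_skew q).mul_left F G H

lemma rawBracket_algebraMap (F : RatField n d) (c : ℂ) :
    rawBracket q F (algebraMap ℂ _ c) = 0 :=
  ((rawBracket_skew q).derivation_right F).map_algebraMap c

lemma rawBracket_halfSign (F : RatField n d) (α β : Fin d) :
    rawBracket q F (halfSign _ α β) = 0 :=
  rawBracket_algebraMap q F _

lemma IsDerivationAlong.map_two {A : Type*} [CommRing A] [Algebra ℂ A] {D : A →ₗ[ℂ] A}
    (hD : IsDerivationAlong (AlgHom.id ℂ A) D) : D 2 = 0 := by
  have := hD.map_algebraMap 2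
  rwa [map_ofNat] at this

section

variable {D : RatField n d →ₗ[ℂ] RatField n d}

/-- A derivation acts on `r_{jk}` and `s_{jk}` through its values on `x_j` and `x_k`. -/
lemma IsDerivationAlong.apply_r (hD : IsDerivationAlong (AlgHom.id ℂ _) D) (j k : Fin n) :
    D ((rawData q).r j k) = rDefect q j k * (D (xv j) / xv j - D (xv k) / xv k) := by
  by_cases h : j = k
  · simp [rawData, rDefect, h]
  · have h1 := xv_sub_ne (d := d) h
    have hj := xv_ne (d := d) j
    have hk := xv_ne (d := d) k
    simp only [rDefect, rawData, h, if_false]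
    rw [hD.map_div two_ne_zero, hD.map_div h1, hD.map_two, map_sub, map_add]
    field_simp
    ring

lemma IsDerivationAlong.apply_s (hD : IsDerivationAlong (AlgHom.id ℂ _) D) (hq : q ≠ 1)
    (j k : Fin n) :
    D ((rawData q).s j k)
      = (1 / 4 - (rawData q).s j k ^ 2) * (D (xv j) / xv j - D (xv k) / xv k) := by
  have h1 := xv_sub_q_ne (d := d) q hq j k
  have hj := xv_ne (d := d) j
  have hk := xv_ne (d := d) k
  have hq' : D (qv q) = 0 := hD.map_algebraMap q
  simp only [rawData]
  rw [hD.map_div two_ne_zero, hD.map_div h1, hD.map_two, map_sub, map_add, hD, hq']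
  simp only [AlgHom.id_apply]
  field_simp
  ring

end

lemma rawBracket_r (F : RatField n d) (j k : Fin n) :
    rawBracket q F ((rawData q).r j k)
      = rDefect q j k * (rawBracket q F (xv j) / xv j - rawBracket q F (xv k) / xv k) :=
  ((rawBracket_skew q).derivation_right F).apply_r q j k

lemma rawBracket_s (hq : q ≠ 1) (F : RatField n d) (j k : Fin n) :
    rawBracket q F ((rawData q).s j k)
      = (1 / 4 - (rawData q).s j k ^ 2)
        * (rawBracket q F (xv j) / xv j - rawBracket q F (xv k) / xv k) :=
  ((rawBracket_skew q).derivation_right F).apply_s q hq j k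

lemma rawBracket_a_r (i j k : Fin n) (α : Fin d) :
    rawBracket q (av i α) ((rawData q).r j k) = 0 := by
  simp [rawBracket_r, rawBracket_a_x]

lemma rawBracket_a_s (hq : q ≠ 1) (i j k : Fin n) (α : Fin d) :
    rawBracket q (av i α) ((rawData q).s j k) = 0 := by
  simp [rawBracket_s q hq, rawBracket_a_x]

lemma rawBracket_b_x_div (i j : Fin n) (α : Fin d) :
    rawBracket q (bv i α) (xv j) / xv j = if i = j then -bv i α else 0 := by
  have hj := xv_ne (d := d) j
  rw [rawBracket_b_x]
  by_cases h : i = j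
  · subst h; simp only [if_true]; field_simp
  · simp [h, Ne.symm h]

lemma rawBracket_b_r (i j k : Fin n) (α : Fin d) :
    rawBracket q (bv i α) ((rawData q).r j k)
      = rDefect q j k * ((if i = k then bv i α else 0) - if i = j then bv i α else 0) := by
  rw [rawBracket_r, rawBracket_b_x_div, rawBracket_b_x_div]
  split_ifs <;> ring

lemma rawBracket_b_s (hq : q ≠ 1) (i j k : Fin n) (α : Fin d) :
    rawBracket q (bv i α) ((rawData q).s j k)
      = (1 / 4 - (rawData q).s j k ^ 2)
        * ((if i = k then bv i α else 0) - if i = j then bv i α else 0) := by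
  rw [rawBracket_s q hq, rawBracket_b_x_div, rawBracket_b_x_div]
  split_ifs <;> ring

/-- `f_{ij} = ∑_α a_i^α b_j^α`. -/
noncomputable def fv (i j : Fin n) : RatField n d := ∑ α, av i α * bv j α

lemma rawBracket_halfSign_left (F : RatField n d) (α β : Fin d) :
    rawBracket q (halfSign _ α β) F = 0 := by
  rw [(rawBracket_skew q).1, rawBracket_halfSign, neg_zero]

lemma rawBracket_r_a (i j k : Fin n) (α : Fin d) :
    rawBracket q ((rawData q).r j k) (av i α) = 0 := by
  rw [(rawBracket_skew q).1, rawBracket_a_r, neg_zero]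

lemma rawBracket_r_b (i j k : Fin n) (α : Fin d) :
    rawBracket q ((rawData q).r j k) (bv i α)
      = rDefect q j k * ((if i = j then bv i α else 0) - if i = k then bv i α else 0) := by
  rw [(rawBracket_skew q).1, rawBracket_b_r]
  ring

/-- By the Yang--Baxter equations this Jacobiator is supported at coinciding particle indices. -/
lemma jacobiator_a_a_a (i j k : Fin n) (α β γ : Fin d) :
    jacobiator (rawBracket q) (av i α) (av j β) (av k γ)
      = ((if i = j then rDefect q j k else 0) + (if j = k then rDefect q k i else 0)
        + (if k = i then rDefect q i j else 0))
        * (av j α * av k β * av i γ - av k α * av i β * av j γ) := by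
  have h1 := rawData_r_cyclic (d := d) q i j k
  have h2 := halfSign_cyclic (A := RatField n d) α β γ
  simp only [jacobiator_apply, rawBracket_a_a, rawBracket_mul, rawBracket_mul_left, map_add,
    LinearMap.add_apply, rawBracket_halfSign, rawBracket_halfSign_left, rawBracket_a_r,
    rawBracket_r_a]
  rw [rawData_r_skew q k i] at h1
  rw [halfSign_skew γ α] at h2
  rw [rawData_r_skew q j i, halfSign_skew γ β, halfSign_skew β α, halfSign_skew γ α]
  -- The Yang--Baxter equations for `r` and for the signs compensate each other, except at
  -- coinciding particle indices, and for coinciding spin indices where the two monomials agree.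
  have h3 : (if i = j ∧ j = k then 0 else 1 / 4 : RatField n d)
      * (av j α * av k β * av i γ - av k α * av i β * av j γ)
      = 1 / 4 * (av j α * av k β * av i γ - av k α * av i β * av j γ) := by
    split_ifs with h
    · obtain ⟨rfl, rfl⟩ := h; ring
    · rfl
  have h4 : (if α = β ∧ β = γ then 0 else -(1 / 4) : RatField n d)
      * (av j α * av k β * av i γ - av k α * av i β * av j γ)
      = -(1 / 4) * (av j α * av k β * av i γ - av k α * av i β * av j γ) := by
    split_ifs with h
    · obtain ⟨rfl, rfl⟩ := h; ring
    · rfl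
  linear_combination (av j α * av k β * av i γ - av k α * av i β * av j γ) * (h1 - h2) - h3 - h4

lemma jacobiator_b_b_b (i j k : Fin n) (α β γ : Fin d) :
    jacobiator (rawBracket q) (bv i α) (bv j β) (bv k γ) = 0 := by
  have h1 := rawData_r_cyclic (d := d) q i j k
  have h2 := halfSign_cyclic (A := RatField n d) α β γ
  simp only [jacobiator_apply, rawBracket_b_b, rawBracket_mul, rawBracket_mul_left, map_sub,
    LinearMap.sub_apply, rawBracket_halfSign, rawBracket_halfSign_left, rawBracket_b_r,
    rawBracket_r_b]
  rw [rawData_r_skew q k i] at h1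
  rw [halfSign_skew γ α] at h2
  rw [rawData_r_skew q j i, halfSign_skew γ β, halfSign_skew β α, halfSign_skew γ α]
  have h3 : (if i = j ∧ j = k then 0 else 1 / 4 : RatField n d)
      * (bv j α * bv k β * bv i γ - bv k α * bv i β * bv j γ)
      = 1 / 4 * (bv j α * bv k β * bv i γ - bv k α * bv i β * bv j γ) := by
    split_ifs with h
    · obtain ⟨rfl, rfl⟩ := h; ring
    · rfl
  have h4 : (if α = β ∧ β = γ then 0 else -(1 / 4) : RatField n d)
      * (bv j α * bv k β * bv i γ - bv k α * bv i β * bv j γ)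
      = -(1 / 4) * (bv j α * bv k β * bv i γ - bv k α * bv i β * bv j γ) := by
    split_ifs with h
    · obtain ⟨rfl, rfl⟩ := h; ring
    · rfl
  -- The terms with derivatives of `r` cancel the failure of the Yang--Baxter equation.
  have h5 : (rDefect q j k * ((if i = k then bv i α else 0) - if i = j then bv i α else 0)
        * (bv k β * bv j γ)
      - rDefect q i k * ((if j = k then bv j β else 0) - if j = i then bv j β else 0)
        * (bv k α * bv i γ)
      - rDefect q i j * ((if k = i then bv k γ else 0) - if k = j then bv k γ else 0)
        * (bv j α * bv i β) : RatField n d)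
      + ((if i = j then rDefect q j k else 0) + (if j = k then rDefect q k i else 0)
        + (if k = i then rDefect q i j else 0))
        * (bv j α * bv k β * bv i γ - bv k α * bv i β * bv j γ) = 0 := by
    by_cases hij : i = j
    · subst hij
      by_cases hik : i = k
      · subst hik; simp [rDefect_self]
      · simp [hik, Ne.symm hik, rDefect_self]; ring
    by_cases hjk : j = k
    · subst hjk
      simp [hij, Ne.symm hij, rDefect_self, rDefect_symm q j i]; ring
    by_cases hik : i = k
    · subst hik
      simp [hij, Ne.symm hij, rDefect_self, rDefect_symm q j i]; ring
    · simp [hij, hjk, hik, Ne.symm hij, Ne.symm hjk, Ne.symm hik]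
  linear_combination (bv j α * bv k β * bv i γ - bv k α * bv i β * bv j γ) * (h1 - h2) - h3 - h4
    + h5

lemma pairing_eq (j k : Fin n) (β : Fin d) : (rawData q).pairing j k β
    = ∑ μ, ((rawData q).s j k + halfSign _ μ β) * (av j μ * bv k μ) := rfl

lemma pairing_combination (i k : Fin n) (α β : Fin d) (c₁ c₂ c₃ c₄ : RatField n d) :
    ∑ μ, (c₁ * ((rawData q).s i k + halfSign _ μ α) + c₂ * ((rawData q).s i k + halfSign _ μ β)
        + c₃ + c₄ * (if α = β ∧ β = μ then 1 else 0)) * (av i μ * bv k μ)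
      = c₁ * (rawData q).pairing i k α + c₂ * (rawData q).pairing i k β + c₃ * fv i k
        + c₄ * if α = β then av i α * bv k α else 0 := by
  have h : (if α = β then av i α * bv k α else 0 : RatField n d)
      = ∑ μ, (if α = β ∧ β = μ then 1 else 0) * (av i μ * bv k μ) := by
    by_cases h : α = β
    · subst h; simp
    · simp [h]
  rw [h, pairing_eq, pairing_eq, fv, Finset.mul_sum, Finset.mul_sum, Finset.mul_sum,
    Finset.mul_sum, ← Finset.sum_add_distrib, ← Finset.sum_add_distrib, ← Finset.sum_add_distrib]
  exact Finset.sum_congr rfl fun μ _ => by ring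

/-- The Hamiltonian action of `a_i^α` on the sums `∑_μ (s_{jk} + ½ o(μ, β)) a_j^μ b_k^μ`. -/
lemma rawBracket_a_pairing (hq : q ≠ 1) (i j k : Fin n) (α β : Fin d) :
    rawBracket q (av i α) ((rawData q).pairing j k β)
      = ((rawData q).r i j + halfSign _ β α) * (av j α * (rawData q).pairing i k β)
        - av j α * ((if i = j then (rawData q).s i k ^ 2 - 1 / 4 else 0) * fv i k
          + 1 / 4 * if α = β then av i α * bv k α else 0) := by
  have hcoef : ∀ μ : Fin d,
      ((rawData q).s j k + halfSign _ μ β) * ((rawData q).r i j + halfSign _ μ α)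
        = ((rawData q).s j k + halfSign _ α β) * ((rawData q).s i k + halfSign _ μ α)
          + ((rawData q).r i j + halfSign _ β α) * ((rawData q).s i k + halfSign _ μ β)
          + (-if i = j then (rawData q).s i k ^ 2 - 1 / 4 else 0)
          + (-(1 / 4)) * (if α = β ∧ β = μ then 1 else 0 : RatField n d) := by
    intro μ
    have h1 := rawData_rs_cyclic (d := d) q hq i j k
    have h2 := halfSign_cyclic (A := RatField n d) α β μ
    have h3 : (if i = j then (rawData q).s i k ^ 2 - 1 / 4 else 0 : RatField n d)
      = (if i = j then (rawData q).s i k ^ 2 else 1 / 4) - 1 / 4 := by split_ifs <;> ring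
    have h4 : (-(1 / 4)) * (if α = β ∧ β = μ then 1 else 0 : RatField n d)
      = -(if α = β ∧ β = μ then 0 else -(1 / 4)) - 1 / 4 := by split_ifs <;> ring
    rw [h3, h4, ← h1, ← h2, halfSign_skew β α, halfSign_skew β μ]
    ring
  have hterm : ∀ μ, rawBracket q (av i α)
        (((rawData q).s j k + halfSign _ μ β) * (av j μ * bv k μ))
      = av j α * ((((rawData q).s j k + halfSign _ μ β)
          * ((rawData q).r i j + halfSign _ μ α)) * (av i μ * bv k μ))
        + if α = μ then -(((rawData q).s j k + halfSign _ α β) * av j α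
          * (rawData q).pairing i k α) else 0 := by
    intro μ
    simp only [rawBracket_mul, map_add, rawBracket_a_s q hq, rawBracket_halfSign, rawBracket_a_a,
      rawBracket_a_b]
    split_ifs with h
    · subst h; ring
    · ring
  rw [pairing_eq, map_sum, Finset.sum_congr rfl fun μ _ => hterm μ, Finset.sum_add_distrib,
    Finset.sum_ite_eq, if_pos (Finset.mem_univ _), ← Finset.mul_sum,
    Finset.sum_congr rfl fun μ _ => congrArg (· * (av i μ * bv k μ)) (hcoef μ),
    pairing_combination]
  ring

lemma jacobiator_a_a_b (hq : q ≠ 1) (i j k : Fin n) (α β γ : Fin d) :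
    jacobiator (rawBracket q) (av i α) (av j β) (bv k γ)
      = (if i = j then (rawData q).s i k ^ 2 - 1 / 4 else 0) * fv i k
          * ((if β = γ then av i α else 0) - if α = γ then av i β else 0)
        - rDefect q i j * ((if k = i then bv k γ else 0) - if k = j then bv k γ else 0)
          * (av j α * av i β) := by
  have h1 : ∀ (i j : Fin n) (α β : Fin d),
      rawBracket q (av i α) (if β = γ then -(rawData q).pairing j k β else 0)
      = -if β = γ then ((rawData q).r i j + halfSign _ β α) * (av j α * (rawData q).pairing i k β)
        - av j α * ((if i = j then (rawData q).s i k ^ 2 - 1 / 4 else 0) * fv i k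
          + 1 / 4 * if α = β then av i α * bv k α else 0) else 0 := by
    intro i j α β
    by_cases h : β = γ
    · subst h; rw [if_pos rfl, if_pos rfl, map_neg, rawBracket_a_pairing q hq]
    · rw [if_neg h, if_neg h, map_zero, neg_zero]
  simp only [jacobiator_apply, rawBracket_a_a, rawBracket_a_b, h1, rawBracket_mul_left, map_add,
    LinearMap.add_apply, rawBracket_halfSign_left, rawBracket_r_b]
  rw [rawData_r_skew q j i, halfSign_skew α β]
  by_cases hij : i = j
  · subst hij
    by_cases hβ : β = γ
    · by_cases hα : α = γ
      · subst hβ hα; simp only [if_true]; ring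
      · subst hβ; simp only [hα, Ne.symm hα, if_true, if_false, rDefect_self]; ring
    · by_cases hα : α = γ
      · subst hα; simp only [hβ, Ne.symm hβ, if_true, if_false, rDefect_self]; ring
      · simp only [hα, hβ, if_true, if_false, rDefect_self]; ring
  · by_cases hβ : β = γ
    · by_cases hα : α = γ
      · subst hβ hα; simp only [hij, Ne.symm hij, if_true, if_false]; ring
      · subst hβ; simp only [hα, Ne.symm hα, hij, Ne.symm hij, if_true, if_false]; ring
    · by_cases hα : α = γ
      · subst hα; simp only [hβ, Ne.symm hβ, hij, Ne.symm hij, if_true, if_false]; ring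
      · simp only [hα, hβ, hij, Ne.symm hij, if_false]; ring

/-- The Hamiltonian action of `b_j^β` on the sums `∑_μ (s_{ik} + ½ o(μ, α)) a_i^μ b_k^μ`. -/
lemma rawBracket_b_pairing (hq : q ≠ 1) (i j k : Fin n) (α β : Fin d) :
    rawBracket q (bv j β) ((rawData q).pairing i k α)
      = ((rawData q).r j k - halfSign _ α β) * (bv k β * (rawData q).pairing i j α)
        + (if j = i then (rawData q).s i k ^ 2 - 1 / 4 else 0) * bv j β * fv i k
        + 1 / 4 * if α = β then av i α * (bv j α * bv k α) else 0 := by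
  have hcoef : ∀ μ : Fin d,
      ((rawData q).s i k + halfSign _ μ α) * ((rawData q).r j k - halfSign _ μ β)
        = ((rawData q).r j k - halfSign _ α β) * ((rawData q).s i j + halfSign _ μ α)
          + (-((rawData q).s i k + halfSign _ β α)) * ((rawData q).s i j + halfSign _ μ β)
          + (if j = k then (rawData q).s i j ^ 2 - 1 / 4 else 0)
          + 1 / 4 * (if α = β ∧ β = μ then 1 else 0 : RatField n d) := by
    intro μ
    have h1 := rawData_sr_cyclic (d := d) q hq i j k
    have h2 := halfSign_cyclic (A := RatField n d) α β μ
    have h3 : (if j = k then (rawData q).s i j ^ 2 - 1 / 4 else 0 : RatField n d)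
      = (if j = k then (rawData q).s i j ^ 2 else 1 / 4) - 1 / 4 := by split_ifs <;> ring
    have h4 : 1 / 4 * (if α = β ∧ β = μ then 1 else 0 : RatField n d)
      = (if α = β ∧ β = μ then 0 else -(1 / 4)) + 1 / 4 := by split_ifs <;> ring
    rw [h3, h4, ← h1, ← h2, halfSign_skew β α, halfSign_skew β μ]
    ring
  have hterm : ∀ μ, rawBracket q (bv j β)
        (((rawData q).s i k + halfSign _ μ α) * (av i μ * bv k μ))
      = bv k β * ((((rawData q).s i k + halfSign _ μ α)
          * ((rawData q).r j k - halfSign _ μ β)) * (av i μ * bv j μ))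
        + (1 / 4 - (rawData q).s i k ^ 2)
          * ((if j = k then bv j β else 0) - if j = i then bv j β else 0) * (av i μ * bv k μ)
        + if β = μ then ((rawData q).s i k + halfSign _ β α) * (rawData q).pairing i j β * bv k β
          else 0 := by
    intro μ
    simp only [rawBracket_mul, map_add, rawBracket_b_s q hq, rawBracket_halfSign, rawBracket_b_b,
      rawBracket_b_a, eq_comm (a := μ)]
    by_cases h : β = μ
    · subst h; simp only [if_true]; ring
    · simp only [h, if_false]; ring
  rw [pairing_eq, map_sum, Finset.sum_congr rfl fun μ _ => hterm μ, Finset.sum_add_distrib,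
    Finset.sum_add_distrib,
    Finset.sum_ite_eq, if_pos (Finset.mem_univ _), ← Finset.mul_sum, ← Finset.mul_sum,
    Finset.sum_congr rfl fun μ _ => congrArg (· * (av i μ * bv j μ)) (hcoef μ),
    pairing_combination, ← fv]
  by_cases hα : α = β
  · subst hα
    by_cases hjk : j = k
    · subst hjk; split_ifs <;> ring
    · simp only [hjk, if_false]; split_ifs <;> ring
  · by_cases hjk : j = k
    · subst hjk; simp only [hα, if_false]; split_ifs <;> ring
    · simp only [hjk, hα, if_false]; split_ifs <;> ring

lemma jacobiator_a_b_b (hq : q ≠ 1) (i j k : Fin n) (α β γ : Fin d) :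
    jacobiator (rawBracket q) (av i α) (bv j β) (bv k γ)
      = (if j = i then (rawData q).s i k ^ 2 - 1 / 4 else 0) * bv j β
          * (if α = γ then fv i k else 0)
        - (if k = i then (rawData q).s i j ^ 2 - 1 / 4 else 0) * bv k γ
          * (if α = β then fv i j else 0) := by
  have h1 : rawBracket q (bv j β) (if α = γ then -(rawData q).pairing i k α else 0)
      = -if α = γ then rawBracket q (bv j β) ((rawData q).pairing i k α) else 0 := by
    split_ifs <;> simp
  have h2 : rawBracket q (if α = β then -(rawData q).pairing i j α else 0) (bv k γ)
      = if α = β then rawBracket q (bv k γ) ((rawData q).pairing i j α) else 0 := by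
    rw [(rawBracket_skew q).1]; split_ifs <;> simp
  simp only [jacobiator_apply, rawBracket_b_b, rawBracket_a_b, h1, h2, rawBracket_b_pairing q hq,
    rawBracket_mul, map_sub, rawBracket_halfSign, rawBracket_a_r]
  rw [rawData_r_skew q k j, halfSign_skew γ β]
  by_cases hβ : α = β
  · by_cases hγ : α = γ
    · subst hβ hγ; simp only [if_true, halfSign_self]; ring
    · subst hβ; simp only [hγ, if_true, if_false, halfSign_skew α γ]; ring
  · by_cases hγ : α = γ
    · subst hγ; simp only [hβ, if_true, if_false, halfSign_skew α β]; ring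
    · simp only [hβ, hγ, if_false]; ring

end Jacobi

/-! ### The Jacobiator as a combination of rescalings -/

section Rescalings

variable {n d : ℕ} (q : ℂ)

/-- The infinitesimal generator of the rescaling `a_p ↦ t a_p`, `b_p ↦ t⁻¹ b_p`. -/
noncomputable def euler (p : Fin n) : RatField n d →ₗ[ℂ] RatField n d :=
  vectorField fun
    | .x _ => 0
    | .a i α => if p = i then av i α else 0
    | .b i α => if p = i then -bv i α else 0

lemma euler_xv (p i : Fin n) : euler (d := d) p (xv i) = 0 := vectorField_ratVar _ _
lemma euler_av (p i : Fin n) (α : Fin d) : euler p (av i α) = if p = i then av i α else 0 :=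
  vectorField_ratVar _ _
lemma euler_bv (p i : Fin n) (α : Fin d) : euler p (bv i α) = if p = i then -bv i α else 0 :=
  vectorField_ratVar _ _

/-- The bivectors `Θ_p` such that the Jacobiator of the unreduced bracket is `∑_p E_p ∧ Θ_p`, where
`E_p` are the generators of the rescalings. -/
noncomputable def defectBivector (p : Fin n) : Bracket (RatField n d) :=
  bracketOf (assemble 0 bv
    (fun i j α β => (if p = i then rDefect q p j * (av j α * av i β) else 0)
      - if p = j then rDefect q p i * (av j α * av i β) else 0)
    (fun i j α β => if p = i then
      if α = β then ((rawData q).s i j ^ 2 - 1 / 4) * fv i j else 0 else 0)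
    (fun _ _ _ _ => 0))

lemma defectBivector_skew (p : Fin n) : IsSkewBiderivation (defectBivector (d := d) q p) :=
  bracketOf_skew (assemble_skew
    (fun i j α β => by split_ifs <;> subst_vars <;> ring)
    fun _ _ _ _ => neg_zero.symm)

/-- The trivector `∑_p E_p ∧ Θ_p`. -/
noncomputable def defectTrivector (F G : RatField n d) : RatField n d →ₗ[ℂ] RatField n d :=
  ∑ p, (LinearMap.mulLeft ℂ (euler p F) ∘ₗ defectBivector q p G
    + LinearMap.mulLeft ℂ (euler p G) ∘ₗ (defectBivector q p).flip F
    + LinearMap.mulLeft ℂ (defectBivector q p F G) ∘ₗ euler p)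

lemma defectTrivector_apply (F G H : RatField n d) :
    defectTrivector q F G H = ∑ p, (euler p F * defectBivector q p G H
      + euler p G * defectBivector q p H F + euler p H * defectBivector q p F G) := by
  simp only [defectTrivector, LinearMap.sum_apply, LinearMap.add_apply, LinearMap.comp_apply,
    LinearMap.mulLeft_apply, LinearMap.flip_apply, mul_comm (euler _ H)]

lemma defectTrivector_derivation (F G : RatField n d) :
    IsDerivationAlong (AlgHom.id ℂ _) (defectTrivector q F G) :=
  .sum fun p => ((((defectBivector_skew q p).derivation_right G).mul_left _).add
    (((defectBivector_skew q p).derivation_left F).mul_left _)).add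
    ((vectorField_derivation _).mul_left _)

lemma defectTrivector_swap_left (F G H : RatField n d) :
    defectTrivector q F G H = -defectTrivector q G F H := by
  simp only [defectTrivector_apply, ← Finset.sum_neg_distrib]
  refine Finset.sum_congr rfl fun p _ => ?_
  rw [(defectBivector_skew q p).1 G H, (defectBivector_skew q p).1 H F,
    (defectBivector_skew q p).1 F G]
  ring

lemma defectTrivector_swap_right (F G H : RatField n d) :
    defectTrivector q F G H = -defectTrivector q F H G := by
  simp only [defectTrivector_apply, ← Finset.sum_neg_distrib]
  refine Finset.sum_congr rfl fun p _ => ?_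
  rw [(defectBivector_skew q p).1 G H, (defectBivector_skew q p).1 H F,
    (defectBivector_skew q p).1 F G]
  ring

lemma defectBivector_x_left (p i : Fin n) (u : Coord n d) :
    defectBivector q p (xv i) (ratVar u) = 0 := by
  rw [xv, defectBivector, bracketOf_ratVar]; cases u <;> simp [assemble]
lemma defectBivector_x_right (p i : Fin n) (u : Coord n d) :
    defectBivector q p (ratVar u) (xv i) = 0 := by
  rw [xv, defectBivector, bracketOf_ratVar]; cases u <;> simp [assemble]
lemma defectBivector_a_a (p i j : Fin n) (α β : Fin d) : defectBivector q p (av i α) (av j β)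
    = (if p = i then rDefect q p j * (av j α * av i β) else 0)
      - if p = j then rDefect q p i * (av j α * av i β) else 0 := bracketOf_ratVar _ _ _
lemma defectBivector_a_b (p i j : Fin n) (α β : Fin d) : defectBivector q p (av i α) (bv j β)
    = if p = i then if α = β then ((rawData q).s i j ^ 2 - 1 / 4) * fv i j else 0 else 0 :=
  bracketOf_ratVar _ _ _
lemma defectBivector_b_a (p i j : Fin n) (α β : Fin d) : defectBivector q p (bv j β) (av i α)
    = -if p = i then if α = β then ((rawData q).s i j ^ 2 - 1 / 4) * fv i j else 0 else 0 :=
  bracketOf_ratVar _ _ _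
lemma defectBivector_b_b (p i j : Fin n) (α β : Fin d) :
    defectBivector q p (bv i α) (bv j β) = 0 := bracketOf_ratVar _ _ _

lemma rawBracket_x_pairing (hq : q ≠ 1) (i j k : Fin n) (β : Fin d) :
    rawBracket q (xv i) ((rawData q).pairing j k β)
      = if i = k then xv i * (rawData q).pairing j k β else 0 := by
  have h : ∀ μ, rawBracket q (xv i)
      (((rawData q).s j k + halfSign _ μ β) * (av j μ * bv k μ))
      = (if i = k then xv i else 0)
        * (((rawData q).s j k + halfSign _ μ β) * (av j μ * bv k μ)) := by
    intro μ
    simp only [rawBracket_mul, map_add, rawBracket_s q hq, rawBracket_halfSign, rawBracket_x_x,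
      rawBracket_x_a, rawBracket_x_b]
    split_ifs <;> ring
  rw [pairing_eq, map_sum, Finset.sum_congr rfl fun μ _ => h μ, ← Finset.mul_sum]
  split_ifs <;> ring

lemma jacobiator_x (hq : q ≠ 1) (i : Fin n) (u v : Coord n d) :
    jacobiator (rawBracket q) (xv i) (ratVar u) (ratVar v) = 0 := by
  have hr : ∀ j k, rawBracket (d := d) q (xv i) ((rawData q).r j k) = 0 := fun j k => by
    simp [rawBracket_r, rawBracket_x_x]
  have haa : ∀ j k (α β : Fin d),
      jacobiator (rawBracket q) (xv i) (av j α) (av k β) = 0 := by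
    intro j k α β
    simp [jacobiator_apply, rawBracket_a_a, rawBracket_mul, hr, rawBracket_halfSign,
      rawBracket_x_a]
  have hab : ∀ j k (α β : Fin d),
      jacobiator (rawBracket q) (xv i) (av j α) (bv k β) = 0 := by
    intro j k α β
    simp only [jacobiator_apply, rawBracket_a_b, rawBracket_x_b, rawBracket_x_a, map_zero,
      LinearMap.zero_apply]
    by_cases h : i = k <;> by_cases h' : α = β <;>
      simp [h, h', rawBracket_mul, rawBracket_x_pairing q hq, rawBracket_a_x, rawBracket_a_b]
  have hbb : ∀ j k (α β : Fin d),
      jacobiator (rawBracket q) (xv i) (bv j α) (bv k β) = 0 := by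
    intro j k α β
    simp only [jacobiator_apply, rawBracket_b_b, rawBracket_x_b, rawBracket_mul, map_sub, hr,
      rawBracket_halfSign]
    by_cases h : i = k <;> by_cases h' : i = j <;> by_cases h'' : j = k <;> subst_vars <;>
      simp_all [rawBracket_mul, rawBracket_mul_left, rawBracket_b_x, rawBracket_x_b,
        rawBracket_b_b] <;> ring
  have hxa : ∀ j k (α : Fin d), jacobiator (rawBracket q) (xv i) (xv j) (av k α) = 0 := by
    intro j k α
    simp [jacobiator_apply, rawBracket_x_a, rawBracket_x_x]
  have hxb : ∀ j k (α : Fin d), jacobiator (rawBracket q) (xv i) (xv j) (bv k α) = 0 := by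
    intro j k α
    simp only [jacobiator_apply, rawBracket_x_b, rawBracket_x_x]
    by_cases h : i = k <;> by_cases h' : j = k <;>
      simp [h, h', rawBracket_mul, rawBracket_x_b, rawBracket_x_x]
  have hsk := jacobiator_swap_right (rawBracket_skew (n := n) (d := d) q)
  rcases u with j | ⟨j, α⟩ | ⟨j, α⟩ <;> rcases v with k | ⟨k, β⟩ | ⟨k, β⟩
  · change jacobiator (rawBracket q) (xv i) (xv j) (xv k) = 0
    simp [jacobiator_apply, rawBracket_x_x]
  · exact hxa _ _ _
  · exact hxb _ _ _
  · rw [hsk]; exact neg_eq_zero.2 (hxa _ _ _)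
  · exact haa _ _ _ _
  · exact hab _ _ _ _
  · rw [hsk]; exact neg_eq_zero.2 (hxb _ _ _)
  · rw [hsk]; exact neg_eq_zero.2 (hab _ _ _ _)
  · exact hbb _ _ _ _

/-- The Jacobiator of the unreduced bracket is `∑_p E_p ∧ Θ_p`. -/
theorem jacobiator_rawBracket (hq : q ≠ 1) (F G H : RatField n d) :
    jacobiator (rawBracket q) F G H = defectTrivector q F G H := by
  have hsk := rawBracket_skew (n := n) (d := d) q
  have hl := defectTrivector_swap_left (n := n) (d := d) q
  have hr := defectTrivector_swap_right (n := n) (d := d) q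
  have tl : ∀ F G H, (jacobiator (rawBracket (n := n) (d := d) q) F G - defectTrivector q F G) H
      = -(jacobiator (rawBracket q) G F - defectTrivector q G F) H := fun F G H => by
    rw [LinearMap.sub_apply, LinearMap.sub_apply, jacobiator_swap_left hsk, hl]; ring
  have tr : ∀ F G H, (jacobiator (rawBracket (n := n) (d := d) q) F G - defectTrivector q F G) H
      = -(jacobiator (rawBracket q) F H - defectTrivector q F H) G := fun F G H => by
    rw [LinearMap.sub_apply, LinearMap.sub_apply, jacobiator_swap_right hsk, hr]; ring
  rw [← sub_eq_zero]
  refine triderivation_eq_zero ratVar_generates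
    (fun F G => jacobiator (rawBracket q) F G - defectTrivector q F G) tl tr
    (fun F G => (jacobiator_derivation hsk F G).sub (defectTrivector_derivation q F G)) ?_ F G H
  have hx : ∀ i (u v : Coord n d), (jacobiator (rawBracket q) (xv i) (ratVar u)
      - defectTrivector q (xv i) (ratVar u)) (ratVar v) = 0 := by
    intro i u v
    rw [LinearMap.sub_apply, jacobiator_x q hq, defectTrivector_apply]
    simp [euler_xv, defectBivector_x_left, defectBivector_x_right]
  have haaa : ∀ (i j k : Fin n) (α β γ : Fin d), (jacobiator (rawBracket q) (av i α) (av j β)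
      - defectTrivector q (av i α) (av j β)) (av k γ) = 0 := by
    intro i j k α β γ
    rw [LinearMap.sub_apply, jacobiator_a_a_a, defectTrivector_apply]
    simp only [euler_av, defectBivector_a_a, Finset.sum_add_distrib, ite_mul, zero_mul,
      Finset.sum_ite_eq', Finset.mem_univ, if_true]
    split_ifs <;> subst_vars <;>
      first | contradiction | ring1
  have haab : ∀ (i j k : Fin n) (α β γ : Fin d), (jacobiator (rawBracket q) (av i α) (av j β)
      - defectTrivector q (av i α) (av j β)) (bv k γ) = 0 := by
    intro i j k α β γ
    rw [LinearMap.sub_apply, jacobiator_a_a_b q hq, defectTrivector_apply]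
    simp only [euler_av, euler_bv, defectBivector_a_a, defectBivector_a_b, defectBivector_b_a,
      Finset.sum_add_distrib, ite_mul, zero_mul,
      neg_mul, Finset.sum_ite_eq', Finset.mem_univ, if_true]
    split_ifs <;> subst_vars <;>
      first | contradiction | ring1 | (simp only [rDefect_symm]; ring1)
  have habb : ∀ (i j k : Fin n) (α β γ : Fin d), (jacobiator (rawBracket q) (av i α) (bv j β)
      - defectTrivector q (av i α) (bv j β)) (bv k γ) = 0 := by
    intro i j k α β γ
    rw [LinearMap.sub_apply, jacobiator_a_b_b q hq, defectTrivector_apply]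
    simp only [euler_av, euler_bv, defectBivector_b_b, defectBivector_a_b, defectBivector_b_a,
      Finset.sum_add_distrib, ite_mul, zero_mul,
      neg_mul, Finset.sum_ite_eq', Finset.mem_univ, if_true]
    split_ifs <;> subst_vars <;>
      first | contradiction | ring1
  have hbbb : ∀ (i j k : Fin n) (α β γ : Fin d), (jacobiator (rawBracket q) (bv i α) (bv j β)
      - defectTrivector q (bv i α) (bv j β)) (bv k γ) = 0 := by
    intro i j k α β γ
    rw [LinearMap.sub_apply, jacobiator_b_b_b, defectTrivector_apply]
    simp [defectBivector_b_b]
  rintro (i | ⟨i, α⟩ | ⟨i, α⟩) v w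
  · exact hx _ _ _
  · rcases v with j | ⟨j, β⟩ | ⟨j, β⟩
    · rw [tl]; exact neg_eq_zero.2 (hx _ _ _)
    · rcases w with k | ⟨k, γ⟩ | ⟨k, γ⟩
      · rw [tr, tl, neg_neg]; exact hx _ _ _
      · exact haaa _ _ _ _ _ _
      · exact haab _ _ _ _ _ _
    · rcases w with k | ⟨k, γ⟩ | ⟨k, γ⟩
      · rw [tr, tl, neg_neg]; exact hx _ _ _
      · rw [tr]; exact neg_eq_zero.2 (haab _ _ _ _ _ _)
      · exact habb _ _ _ _ _ _
  · rcases v with j | ⟨j, β⟩ | ⟨j, β⟩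
    · rw [tl]; exact neg_eq_zero.2 (hx _ _ _)
    · rcases w with k | ⟨k, γ⟩ | ⟨k, γ⟩
      · rw [tr, tl, neg_neg]; exact hx _ _ _
      · rw [tl, tr, neg_neg]; exact haab _ _ _ _ _ _
      · rw [tl]; exact neg_eq_zero.2 (habb _ _ _ _ _ _)
    · rcases w with k | ⟨k, γ⟩ | ⟨k, γ⟩
      · rw [tr, tl, neg_neg]; exact hx _ _ _
      · rw [tr, tl, neg_neg]; exact habb _ _ _ _ _ _
      · exact hbbb _ _ _ _ _ _

/-- The Jacobi identity for functions that are invariant under the rescalings. -/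
theorem jacobiator_rawBracket_of_euler (hq : q ≠ 1) {F G H : RatField n d}
    (hF : ∀ p, euler p F = 0) (hG : ∀ p, euler p G = 0) (hH : ∀ p, euler p H = 0) :
    jacobiator (rawBracket q) F G H = 0 := by
  simp [jacobiator_rawBracket q hq, defectTrivector_apply, hF, hG, hH]

end Rescalings

/-! ### The torus action on the spin indices -/

section Torus

variable {n d : ℕ} (q : ℂ)

/-- The infinitesimal generator of the rescaling `a_i^μ ↦ t a_i^μ`, `b_i^μ ↦ t⁻¹ b_i^μ` of the
`μ`-th components of all spin vectors. -/
noncomputable def torus (μ : Fin d) : RatField n d →ₗ[ℂ] RatField n d :=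
  vectorField fun
    | .x _ => 0
    | .a i α => if μ = α then av i α else 0
    | .b i α => if μ = α then -bv i α else 0

lemma torus_xv (μ : Fin d) (i : Fin n) : torus μ (xv i) = 0 := vectorField_ratVar _ _
lemma torus_av (μ α : Fin d) (i : Fin n) : torus μ (av i α) = if μ = α then av i α else 0 :=
  vectorField_ratVar _ _
lemma torus_bv (μ α : Fin d) (i : Fin n) : torus μ (bv i α) = if μ = α then -bv i α else 0 :=
  vectorField_ratVar _ _

lemma torus_derivation (μ : Fin d) :
    IsDerivationAlong (AlgHom.id ℂ _) (torus μ : RatField n d →ₗ[ℂ] RatField n d) :=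
  vectorField_derivation _

lemma torus_mul (μ : Fin d) (F G : RatField n d) :
    torus μ (F * G) = F * torus μ G + torus μ F * G := torus_derivation μ F G

lemma torus_comm (μ ν : Fin d) (F : RatField n d) : torus μ (torus ν F) = torus ν (torus μ F) := by
  have h := ((torus_derivation (n := n) μ).commutator (torus_derivation ν)).eq_zero
    ratVar_generates ?_ F
  · exact sub_eq_zero.1 h
  rintro (i | ⟨i, α⟩ | ⟨i, α⟩)
  · change torus μ (torus ν (xv i)) - torus ν (torus μ (xv i)) = 0
    simp [torus_xv]
  · change torus μ (torus ν (av i α)) - torus ν (torus μ (av i α)) = 0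
    simp only [torus_av]
    split_ifs <;> simp [torus_av, *]
  · change torus μ (torus ν (bv i α)) - torus ν (torus μ (bv i α)) = 0
    simp only [torus_bv]
    split_ifs <;> simp [torus_bv, *]

/-- A derivation that preserves the brackets of generators preserves the bracket. -/
lemma derivation_preserves {ι A : Type*} [CommRing A] [Algebra ℂ A] {s : ι → A}
    (hs : InvGenerates s) {B : Bracket A} (hB : IsSkewBiderivation B) {D : A →ₗ[ℂ] A}
    (hD : IsDerivationAlong (AlgHom.id ℂ A) D)
    (h : ∀ i j, D (B (s i) (s j)) = B (D (s i)) (s j) + B (s i) (D (s j))) (F G : A) :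
    D (B F G) = B (D F) G + B F (D G) := by
  have hder : ∀ F, IsDerivationAlong (AlgHom.id ℂ A) ((D ∘ₗ B F - B F ∘ₗ D) - B (D F)) := fun F =>
    (hD.commutator (hB.derivation_right F)).sub (hB.derivation_right _)
  have h1 : ∀ i G, ((D ∘ₗ B (s i) - B (s i) ∘ₗ D) - B (D (s i))) G = 0 := fun i =>
    (hder _).eq_zero hs fun j => by
      simp only [LinearMap.sub_apply, LinearMap.comp_apply, h]; ring
  have h2 := (hder F).eq_zero hs (fun i => by
    have := h1 i F
    simp only [LinearMap.sub_apply, LinearMap.comp_apply] at this ⊢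
    rw [hB.1 F (s i), hB.1 F (D (s i)), hB.1 (D F) (s i), map_neg]
    linear_combination -this) G
  simp only [LinearMap.sub_apply, LinearMap.comp_apply] at h2
  linear_combination h2

lemma torus_r (μ : Fin d) (i j : Fin n) : torus μ ((rawData q).r i j) = 0 := by
  rw [(torus_derivation μ).apply_r, torus_xv, torus_xv]; simp

lemma torus_s (hq : q ≠ 1) (μ : Fin d) (i j : Fin n) : torus μ ((rawData q).s i j) = 0 := by
  rw [(torus_derivation μ).apply_s q hq, torus_xv, torus_xv]; simp

lemma torus_halfSign (μ α β : Fin d) : torus μ (halfSign (RatField n d) α β) = 0 :=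
  (torus_derivation μ).map_algebraMap _

lemma torus_pairing (hq : q ≠ 1) (μ : Fin d) (i j : Fin n) (α : Fin d) :
    torus μ ((rawData q).pairing i j α) = 0 := by
  rw [pairing_eq, map_sum]
  refine Finset.sum_eq_zero fun γ _ => ?_
  simp only [torus_mul, map_add, torus_s q hq, torus_halfSign, torus_av, torus_bv]
  split_ifs <;> ring

/-- The unreduced minus bracket is invariant under the torus. -/
lemma torus_rawBracket (hq : q ≠ 1) (μ : Fin d) (F G : RatField n d) :
    torus μ (rawBracket q F G) = rawBracket q (torus μ F) G + rawBracket q F (torus μ G) := by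
  refine derivation_preserves ratVar_generates (rawBracket_skew q) (torus_derivation μ) ?_ F G
  have hsk := (rawBracket_skew (n := n) (d := d) q).1
  have hswap : ∀ F G : RatField n d, torus μ (rawBracket q F G)
        = rawBracket q (torus μ F) G + rawBracket q F (torus μ G) →
      torus μ (rawBracket q G F) = rawBracket q (torus μ G) F + rawBracket q G (torus μ F) := by
    intro F G h
    rw [hsk G F, map_neg, h, hsk G, hsk _ F]; ring
  have hxa : ∀ (i j : Fin n) (α : Fin d), torus μ (rawBracket q (xv i) (av j α))
      = rawBracket q (torus μ (xv i)) (av j α) + rawBracket q (xv i) (torus μ (av j α)) := by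
    intro i j α
    rw [rawBracket_x_a, torus_xv, torus_av]
    split_ifs <;> simp [rawBracket_x_a]
  have hxb : ∀ (i j : Fin n) (α : Fin d), torus μ (rawBracket q (xv i) (bv j α))
      = rawBracket q (torus μ (xv i)) (bv j α) + rawBracket q (xv i) (torus μ (bv j α)) := by
    intro i j α
    rw [rawBracket_x_b, torus_xv, torus_bv]
    by_cases h : i = j <;> by_cases h' : μ = α <;>
      simp [rawBracket_x_b, torus_mul, torus_xv, torus_bv, h, h']
  have hab : ∀ (i j : Fin n) (α β : Fin d), torus μ (rawBracket q (av i α) (bv j β))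
      = rawBracket q (torus μ (av i α)) (bv j β) + rawBracket q (av i α) (torus μ (bv j β)) := by
    intro i j α β
    rw [rawBracket_a_b, torus_av, torus_bv]
    by_cases h : α = β
    · subst h; split_ifs <;> simp [rawBracket_a_b, torus_pairing q hq]
    · split_ifs <;> simp [rawBracket_a_b, h]
  rintro (i | ⟨i, α⟩ | ⟨i, α⟩) (j | ⟨j, β⟩ | ⟨j, β⟩)
  · change torus μ (rawBracket q (xv i) (xv j))
      = rawBracket q (torus μ (xv i)) (xv j) + rawBracket q (xv i) (torus μ (xv j))
    simp [rawBracket_x_x, torus_xv]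
  · exact hxa _ _ _
  · exact hxb _ _ _
  · exact hswap _ _ (hxa _ _ _)
  · change torus μ (rawBracket q (av i α) (av j β))
      = rawBracket q (torus μ (av i α)) (av j β) + rawBracket q (av i α) (torus μ (av j β))
    rw [rawBracket_a_a, torus_av, torus_av]
    simp only [torus_mul, map_add, torus_r, torus_halfSign, torus_av]
    split_ifs <;> simp [rawBracket_a_a] <;> ring
  · exact hab _ _ _ _
  · exact hswap _ _ (hxb _ _ _)
  · exact hswap _ _ (hab _ _ _ _)
  · change torus μ (rawBracket q (bv i α) (bv j β))
      = rawBracket q (torus μ (bv i α)) (bv j β) + rawBracket q (bv i α) (torus μ (bv j β))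
    rw [rawBracket_b_b, torus_bv, torus_bv]
    simp only [torus_mul, map_sub, torus_r, torus_halfSign, torus_bv]
    split_ifs <;> simp [rawBracket_b_b] <;> ring

/-- The bracket `∑ z_{μν} ξ_μ ⊗ ξ_ν`, where `ξ_μ` are the generators of the torus. -/
noncomputable def torusBracket (z : Fin d → Fin d → ℂ) : Bracket (RatField n d) :=
  ∑ μ, ∑ ν, z μ ν • (LinearMap.mul ℂ (RatField n d)).compl₁₂ (torus μ) (torus ν)

lemma torusBracket_apply (z : Fin d → Fin d → ℂ) (F G : RatField n d) :
    torusBracket z F G = ∑ μ, ∑ ν, z μ ν • (torus μ F * torus ν G) := by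
  simp [torusBracket]

lemma torusBracket_skew {z : Fin d → Fin d → ℂ} (hz : ∀ μ ν, z μ ν = -z ν μ) :
    IsSkewBiderivation (torusBracket (n := n) z) := by
  refine ⟨fun F G => ?_, fun F G H => ?_⟩
  · rw [torusBracket_apply, torusBracket_apply, Finset.sum_comm, ← Finset.sum_neg_distrib]
    refine Finset.sum_congr rfl fun μ _ => ?_
    rw [← Finset.sum_neg_distrib]
    refine Finset.sum_congr rfl fun ν _ => ?_
    rw [hz, neg_smul, mul_comm]
  · simp only [torusBracket_apply, Finset.mul_sum, Finset.sum_mul, ← Finset.sum_add_distrib]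
    refine Finset.sum_congr rfl fun μ _ => Finset.sum_congr rfl fun ν _ => ?_
    simp only [torus_mul, Algebra.smul_def]
    ring

lemma skewExt_skew (z : SpinPair d → ℂ) (α β : Fin d) : skewExt z α β = -skewExt z β α := by
  unfold skewExt
  rcases lt_trichotomy α β with h | h | h
  · simp [h, h.not_gt]
  · simp [h]
  · simp [h, h.not_gt]

/-- The unreduced form of `c {-,-}_- + ψ_z`. -/
noncomputable def rawPencil (c : ℂ) (z : SpinPair d → ℂ) : Bracket (RatField n d) :=
  c • rawBracket q + torusBracket (skewExt z)

lemma rawPencil_skew (c : ℂ) (z : SpinPair d → ℂ) :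
    IsSkewBiderivation (rawPencil (n := n) q c z) :=
  ((rawBracket_skew q).smul c).add (torusBracket_skew (skewExt_skew z))

/-- The Jacobi identity for the whole unreduced pencil, on functions invariant under the
rescalings. -/
theorem jacobiator_rawPencil (hq : q ≠ 1) (c : ℂ) (z : SpinPair d → ℂ) {F G H : RatField n d}
    (hF : ∀ p, euler p F = 0) (hG : ∀ p, euler p G = 0) (hH : ∀ p, euler p H = 0) :
    jacobiator (rawPencil q c z) F G H = 0 := by
  rw [rawPencil, jacobiator_smul_add_torus (rawBracket_skew q)
    (torusBracket_skew (skewExt_skew z)) (skewExt_skew z) torus_derivation torus_comm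
    (torus_rawBracket q hq) (torusBracket_apply _),
    jacobiator_rawBracket_of_euler q hq hF hG hH, smul_zero]

end Torus

/-! ### Normalization of the vectors `a_i` -/

namespace LocalData

variable {n d : ℕ}

section Defs

variable {A : Type*} [CommRing A] [Algebra ℂ A] (L : LocalData A n d)

/-- The bracket `{a_i^α, a_j^β}_-` of normalized coordinates, obtained from the unreduced bracket
by the Leibniz rule. -/
noncomputable def redAA (i j : Fin n) (α β : Fin d) : A :=
  (L.rawAA i j α β - L.a j β * ∑ ε, L.rawAA i j α ε)
    - L.a i α * ∑ δ, (L.rawAA i j δ β - L.a j β * ∑ ε, L.rawAA i j δ ε)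

/-- The bracket `{a_i^α, b_j^β}_-` of normalized coordinates. -/
noncomputable def redAB (i j : Fin n) (α β : Fin d) : A :=
  (L.rawAB i j α β + L.b j β * ∑ ε, L.rawAA i j α ε)
    - L.a i α * ∑ δ, (L.rawAB i j δ β + L.b j β * ∑ ε, L.rawAA i j δ ε)

/-- The bracket `{b_i^α, b_j^β}_-` of normalized coordinates. -/
noncomputable def redBB (i j : Fin n) (α β : Fin d) : A :=
  (L.rawBB i j α β - L.b j β * ∑ ε, L.rawAB j i ε α)
    + L.b i α * ∑ δ, (L.rawAB i j δ β + L.b j β * ∑ ε, L.rawAA i j δ ε)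

/-- The factor `z(e_α - a_i, e_β - a_j)` of the bracket `ψ_z`, where `z` is regarded as a bilinear
form. -/
noncomputable def twist (z : Fin d → Fin d → ℂ) (i j : Fin n) (α β : Fin d) : A :=
  ∑ μ, ∑ ν, z μ ν •
    (((if μ = α then 1 else 0) - L.a i μ) * ((if ν = β then 1 else 0) - L.a j ν))

/-- The brackets of normalized coordinates with respect to `c {-,-}_- + ψ_z`. -/
noncomputable def pencilTable (x : Fin n → A) (c : ℂ) (z : Fin d → Fin d → ℂ) :
    Coord n d → Coord n d → A :=
  c • assemble x L.b L.redAA L.redAB L.redBB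
    + assemble 0 L.b (fun i j α β => L.twist z i j α β * (L.a i α * L.a j β))
      (fun i j α β => -(L.twist z i j α β * (L.a i α * L.b j β)))
      (fun i j α β => L.twist z i j α β * (L.b i α * L.b j β))

end Defs

section Map

variable {A C : Type*} [CommRing A] [Algebra ℂ A] [CommRing C] [Algebra ℂ C] (φ : A →ₐ[ℂ] C)
  (L : LocalData A n d)

/-- The image of local data under an algebra homomorphism. -/
def map : LocalData C n d where
  a i α := φ (L.a i α)
  b i α := φ (L.b i α)
  r i j := φ (L.r i j)
  s i j := φ (L.s i j)

lemma map_halfSign (α β : Fin d) : φ (halfSign A α β) = halfSign C α β := φ.commutes _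

lemma map_rawAA (i j : Fin n) (α β : Fin d) : φ (L.rawAA i j α β) = (L.map φ).rawAA i j α β := by
  simp [rawAA, map, map_halfSign]

lemma map_rawBB (i j : Fin n) (α β : Fin d) : φ (L.rawBB i j α β) = (L.map φ).rawBB i j α β := by
  simp [rawBB, map, map_halfSign]

lemma map_rawAB (i j : Fin n) (α β : Fin d) : φ (L.rawAB i j α β) = (L.map φ).rawAB i j α β := by
  unfold rawAB
  split_ifs <;> simp [pairing, map, map_halfSign]

lemma map_twist (z : Fin d → Fin d → ℂ) (i j : Fin n) (α β : Fin d) :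
    φ (L.twist z i j α β) = (L.map φ).twist z i j α β := by
  simp only [twist, map, map_sum, map_smul, map_mul, map_sub, apply_ite φ, map_one, map_zero]

lemma map_pencilTable (x : Fin n → A) (c : ℂ) (z : Fin d → Fin d → ℂ) (u v : Coord n d) :
    φ (L.pencilTable x c z u v) = (L.map φ).pencilTable (fun i => φ (x i)) c z u v := by
  have ha : ∀ i α, (L.map φ).a i α = φ (L.a i α) := fun _ _ => rfl
  have hb : ∀ i α, (L.map φ).b i α = φ (L.b i α) := fun _ _ => rfl
  cases u <;> cases v <;>
    simp [pencilTable, assemble, redAA, redAB, redBB, map_rawAA, map_rawAB, map_rawBB, map_twist,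
      ha, hb, apply_ite φ]

end Map

end LocalData

section Normalization

variable {n d : ℕ} (q : ℂ)

/-- The sum `∑_α a_i^α`. -/
noncomputable def Sv (i : Fin n) : RatField n d := ∑ α, av i α

lemma Sv_ne (hd : 0 < d) (i : Fin n) : (Sv i : RatField n d) ≠ 0 := by
  have h : (∑ α, MvPolynomial.X (.a i α) : MvPolynomial (Coord n d) ℂ) ≠ 0 := fun h => by
    have h1 := congrArg (MvPolynomial.eval fun _ => (1 : ℂ)) h
    simp at h1
    omega
  have h2 : (Sv i : RatField n d)
      = algebraMap _ _ (∑ α, MvPolynomial.X (.a i α) : MvPolynomial (Coord n d) ℂ) := by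
    rw [map_sum]; rfl
  rw [h2]
  exact (map_ne_zero_iff _ (IsFractionRing.injective _ _)).2 h

/-- The local data of the normalized coordinates, as rational functions of the unreduced ones. -/
noncomputable def normData : LocalData (RatField n d) n d where
  a i α := av i α / Sv i
  b i α := bv i α * Sv i
  r := (rawData (d := d) q).r
  s := (rawData (d := d) q).s

/-- The normalized coordinates, as rational functions of the unreduced ones. -/
noncomputable def normVar : Coord n d → RatField n d
  | .x i => xv i
  | .a i α => av i α / Sv i
  | .b i α => bv i α * Sv i

variable {D : RatField n d →ₗ[ℂ] RatField n d}

lemma IsDerivationAlong.apply_normVar_a (hD : IsDerivationAlong (AlgHom.id ℂ _) D) (hd : 0 < d)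
    (i : Fin n) (α : Fin d) : D (av i α / Sv i)
      = (D (av i α) - (normData q).a i α * ∑ ε, D (av i ε)) / Sv i := by
  rw [hD.map_div (Sv_ne hd i), ← map_sum]
  rfl

lemma IsDerivationAlong.apply_normVar_b (hD : IsDerivationAlong (AlgHom.id ℂ _) D) (hd : 0 < d)
    (i : Fin n) (α : Fin d) : D (bv i α * Sv i)
      = D (bv i α) * Sv i + (normData q).b i α * (∑ ε, D (av i ε)) / Sv i := by
  have h := Sv_ne (n := n) hd i
  rw [hD, ← map_sum]
  simp only [AlgHom.id_apply, normData, Sv] at *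
  field_simp
  ring

/-- The normalized coordinates are invariant under the rescalings. -/
lemma euler_normVar (hd : 0 < d) (p : Fin n) (u : Coord n d) : euler p (normVar u) = 0 := by
  have hD : IsDerivationAlong (AlgHom.id ℂ _) (euler p : RatField n d →ₗ[ℂ] _) :=
    vectorField_derivation _
  have h : ∀ i, ∑ ε, euler p (av i ε : RatField n d) = if p = i then Sv i else 0 := by
    intro i
    simp only [euler_av]
    split_ifs <;> simp [Sv]
  rcases u with i | ⟨i, α⟩ | ⟨i, α⟩
  · exact euler_xv p i
  · have hS := Sv_ne (n := n) hd i
    rw [normVar, hD.apply_normVar_a 0 hd, h, euler_av]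
    split_ifs
    · simp only [normData]; field_simp; ring
    · simp
  · have hS := Sv_ne (n := n) hd i
    rw [normVar, hD.apply_normVar_b 0 hd, h, euler_bv]
    split_ifs
    · simp only [normData]; field_simp; ring
    · simp

lemma torus_normVar_a (hd : 0 < d) (μ α : Fin d) (i : Fin n) : torus μ (av i α / Sv i)
    = ((if μ = α then 1 else 0) - (normData q).a i μ) * (normData q).a i α := by
  have hS := Sv_ne (n := n) hd i
  rw [(torus_derivation μ).apply_normVar_a q hd]
  simp only [torus_av, Finset.sum_ite_eq, Finset.mem_univ, if_true, normData]
  split_ifs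
  · field_simp
  · field_simp; ring

lemma torus_normVar_b (hd : 0 < d) (μ α : Fin d) (i : Fin n) : torus μ (bv i α * Sv i)
    = -(((if μ = α then 1 else 0) - (normData q).a i μ) * (normData q).b i α) := by
  have hS := Sv_ne (n := n) hd i
  rw [(torus_derivation μ).apply_normVar_b q hd]
  simp only [torus_av, torus_bv, Finset.sum_ite_eq, Finset.mem_univ, if_true, normData]
  split_ifs
  · field_simp; ring
  · field_simp; ring

lemma rawData_rawAA (hd : 0 < d) (i j : Fin n) (α β : Fin d) :
    (rawData q).rawAA i j α β = Sv i * Sv j * (normData q).rawAA i j α β := by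
  have hi := Sv_ne (n := n) hd i
  have hj := Sv_ne (n := n) hd j
  simp only [LocalData.rawAA, normData, rawData]
  field_simp

lemma rawData_rawBB (hd : 0 < d) (i j : Fin n) (α β : Fin d) :
    (rawData q).rawBB i j α β = (normData q).rawBB i j α β / (Sv i * Sv j) := by
  have hi := Sv_ne (n := n) hd i
  have hj := Sv_ne (n := n) hd j
  simp only [LocalData.rawBB, normData, rawData]
  field_simp

lemma rawData_rawAB (hd : 0 < d) (i j : Fin n) (α β : Fin d) :
    (rawData q).rawAB i j α β = Sv i / Sv j * (normData q).rawAB i j α β := by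
  have hi := Sv_ne (n := n) hd i
  have hj := Sv_ne (n := n) hd j
  simp only [LocalData.rawAB, LocalData.pairing, normData, rawData]
  split_ifs
  · rw [mul_neg, Finset.mul_sum]
    congr 1
    exact Finset.sum_congr rfl fun γ _ => by field_simp
  · simp

lemma rawBracket_a_normVar_a (hd : 0 < d) (i j : Fin n) (α β : Fin d) :
    rawBracket q (av i α) (av j β / Sv j) = Sv i * ((normData q).rawAA i j α β
      - (normData q).a j β * ∑ ε, (normData q).rawAA i j α ε) := by
  have h : ∀ ε, rawBracket q (av i α) (av j ε) = Sv i * Sv j * (normData q).rawAA i j α ε :=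
    fun ε => (rawBracket_a_a q i j α ε).trans (rawData_rawAA q hd i j α ε)
  have hj := Sv_ne (n := n) hd j
  rw [((rawBracket_skew q).derivation_right _).apply_normVar_a q hd]
  simp only [h, ← Finset.mul_sum]
  field_simp

lemma rawBracket_a_normVar_b (hd : 0 < d) (i j : Fin n) (α β : Fin d) :
    rawBracket q (av i α) (bv j β * Sv j) = Sv i * ((normData q).rawAB i j α β
      + (normData q).b j β * ∑ ε, (normData q).rawAA i j α ε) := by
  have h : ∀ ε, rawBracket q (av i α) (av j ε) = Sv i * Sv j * (normData q).rawAA i j α ε :=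
    fun ε => (rawBracket_a_a q i j α ε).trans (rawData_rawAA q hd i j α ε)
  have h' : rawBracket q (av i α) (bv j β) = Sv i / Sv j * (normData q).rawAB i j α β :=
    (rawBracket_a_b q i j α β).trans (rawData_rawAB q hd i j α β)
  have hj := Sv_ne (n := n) hd j
  rw [((rawBracket_skew q).derivation_right _).apply_normVar_b q hd]
  simp only [h, h', ← Finset.mul_sum]
  field_simp

lemma rawBracket_b_normVar_b (hd : 0 < d) (i j : Fin n) (α β : Fin d) :
    rawBracket q (bv i α) (bv j β * Sv j) = ((normData q).rawBB i j α β
      - (normData q).b j β * ∑ ε, (normData q).rawAB j i ε α) / Sv i := by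
  have h : ∀ ε, rawBracket q (bv i α) (av j ε)
      = -(Sv j / Sv i * (normData q).rawAB j i ε α) := fun ε => by
    rw [(rawBracket_skew q).1, ← rawData_rawAB q hd]
    exact congrArg _ (rawBracket_a_b q j i ε α)
  have h' : rawBracket q (bv i α) (bv j β) = (normData q).rawBB i j α β / (Sv i * Sv j) :=
    (rawBracket_b_b q i j α β).trans (rawData_rawBB q hd i j α β)
  have hi := Sv_ne (n := n) hd i
  have hj := Sv_ne (n := n) hd j
  rw [((rawBracket_skew q).derivation_right _).apply_normVar_b q hd]
  simp only [h, h', Finset.sum_neg_distrib, ← Finset.mul_sum]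
  field_simp
  ring

/-- The unreduced minus bracket of normalized coordinates. -/
lemma rawBracket_normVar (hd : 0 < d) (u v : Coord n d) :
    rawBracket q (normVar u) (normVar v)
      = assemble xv (normData q).b (normData q).redAA (normData q).redAB (normData q).redBB u v := by
  have hsk := (rawBracket_skew (n := n) (d := d) q).1
  have hxS : ∀ i j : Fin n, rawBracket (d := d) q (xv i) (Sv j) = 0 := fun i j => by
    simp [Sv, rawBracket_x_a]
  have hxa : ∀ (i j : Fin n) (α : Fin d), rawBracket q (xv i) (av j α / Sv j) = 0 := by
    intro i j α
    rw [((rawBracket_skew q).derivation_right _).map_div (Sv_ne hd j), hxS, rawBracket_x_a]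
    simp
  have hxb : ∀ (i j : Fin n) (α : Fin d), rawBracket q (xv i) (bv j α * Sv j)
      = if i = j then xv i * (normData q).b j α else 0 := by
    intro i j α
    rw [rawBracket_mul, hxS, rawBracket_x_b]
    split_ifs
    · simp only [normData]; ring
    · simp
  have haa : ∀ (i j : Fin n) (α β : Fin d), rawBracket q (av i α / Sv i) (av j β / Sv j)
      = (normData q).redAA i j α β := by
    intro i j α β
    have hi := Sv_ne (n := n) hd i
    have h := ((rawBracket_skew q).derivation_left (av j β / Sv j)).apply_normVar_a q hd i α
    simp only [LinearMap.flip_apply, rawBracket_a_normVar_a q hd, ← Finset.mul_sum] at h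
    rw [h, LocalData.redAA]
    field_simp
  have hab : ∀ (i j : Fin n) (α β : Fin d), rawBracket q (av i α / Sv i) (bv j β * Sv j)
      = (normData q).redAB i j α β := by
    intro i j α β
    have hi := Sv_ne (n := n) hd i
    have h := ((rawBracket_skew q).derivation_left (bv j β * Sv j)).apply_normVar_a q hd i α
    simp only [LinearMap.flip_apply, rawBracket_a_normVar_b q hd, ← Finset.mul_sum] at h
    rw [h, LocalData.redAB]
    field_simp
  have hbb : ∀ (i j : Fin n) (α β : Fin d), rawBracket q (bv i α * Sv i) (bv j β * Sv j)
      = (normData q).redBB i j α β := by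
    intro i j α β
    have hi := Sv_ne (n := n) hd i
    have h := ((rawBracket_skew q).derivation_left (bv j β * Sv j)).apply_normVar_b q hd i α
    simp only [LinearMap.flip_apply, rawBracket_a_normVar_b q hd, rawBracket_b_normVar_b q hd,
      ← Finset.mul_sum] at h
    rw [h, LocalData.redBB]
    field_simp
  rcases u with i | ⟨i, α⟩ | ⟨i, α⟩ <;> rcases v with j | ⟨j, β⟩ | ⟨j, β⟩ <;>
    simp only [normVar, assemble]
  · exact rawBracket_x_x q i j
  · exact hxa _ _ _
  · exact hxb _ _ _
  · rw [hsk, hxa, neg_zero]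
  · exact haa _ _ _ _
  · exact hab _ _ _ _
  · rw [hsk, hxb]; split_ifs <;> simp
  · rw [hsk, hab]
  · exact hbb _ _ _ _

/-- The unreduced form of `ψ_z` on normalized coordinates. -/
lemma torusBracket_normVar (hd : 0 < d) (z : Fin d → Fin d → ℂ) (hz : ∀ μ ν, z μ ν = -z ν μ)
    (u v : Coord n d) : torusBracket z (normVar u) (normVar v)
      = assemble 0 (normData q).b
        (fun i j α β => (normData q).twist z i j α β * ((normData q).a i α * (normData q).a j β))
        (fun i j α β => -((normData q).twist z i j α β * ((normData q).a i α * (normData q).b j β)))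
        (fun i j α β => (normData q).twist z i j α β * ((normData q).b i α * (normData q).b j β))
        u v := by
  have hsk := (torusBracket_skew (n := n) hz).1
  have hx : ∀ (i : Fin n) (G : RatField n d), torusBracket z (xv i) G = 0 := fun i G => by
    simp [torusBracket_apply, torus_xv]
  have hab : ∀ (i j : Fin n) (α β : Fin d), torusBracket z (av i α / Sv i) (bv j β * Sv j)
      = -((normData q).twist z i j α β * ((normData q).a i α * (normData q).b j β)) := by
    intro i j α β
    simp only [torusBracket_apply, LocalData.twist, Finset.sum_mul, ← Finset.sum_neg_distrib,
      torus_normVar_a q hd, torus_normVar_b q hd, Algebra.smul_def]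
    exact Finset.sum_congr rfl fun μ _ => Finset.sum_congr rfl fun ν _ => by ring
  rcases u with i | ⟨i, α⟩ | ⟨i, α⟩ <;> rcases v with j | ⟨j, β⟩ | ⟨j, β⟩ <;>
    simp only [normVar, assemble]
  · exact hx _ _
  · exact hx _ _
  · simp [hx]
  · rw [hsk, hx, neg_zero]
  · simp only [torusBracket_apply, LocalData.twist, Finset.sum_mul, torus_normVar_a q hd,
      Algebra.smul_def]
    exact Finset.sum_congr rfl fun μ _ => Finset.sum_congr rfl fun ν _ => by ring
  · exact hab _ _ _ _
  · rw [hsk, hx]; simp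
  · rw [hsk, hab]
  · simp only [torusBracket_apply, LocalData.twist, Finset.sum_mul, torus_normVar_b q hd,
      Algebra.smul_def]
    exact Finset.sum_congr rfl fun μ _ => Finset.sum_congr rfl fun ν _ => by ring

/-- The unreduced pencil induces the pencil of local tables on the normalized coordinates. -/
lemma rawPencil_normVar (hd : 0 < d) (c : ℂ) (z : SpinPair d → ℂ) (u v : Coord n d) :
    rawPencil q c z (normVar u) (normVar v)
      = (normData q).pencilTable xv c (skewExt z) u v := by
  rw [rawPencil, LinearMap.add_apply, LinearMap.add_apply, LinearMap.smul_apply,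
    LinearMap.smul_apply, rawBracket_normVar q hd, torusBracket_normVar q hd _ (skewExt_skew z)]
  rfl

end Normalization

/-! ### The Arutyunov--Olivucci, Chalykh--Fairon and `ψ` tables -/

section Tables

variable {n d : ℕ} (q : ℂ)

/-- The local data at a point. -/
noncomputable def ptData (m : Coord n d → ℂ) : LocalData ℂ n d where
  a i α := m (.a i α)
  b i α := m (.b i α)
  r i j := if i = j then 0 else (m (.x i) + m (.x j)) / (m (.x i) - m (.x j)) / 2
  s i j := (m (.x i) + q * m (.x j)) / (m (.x i) - q * m (.x j)) / 2

lemma halfSign_complex (α β : Fin d) : halfSign ℂ α β = o α β / 2 := rfl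

/-- The sum `∑_γ o(α, γ) a_i^γ`. -/
noncomputable def signSum (m : Coord n d → ℂ) (i : Fin n) (α : Fin d) : ℂ :=
  ∑ γ, o α γ * m (.a i γ)

lemma ratio_eq (m : Coord n d → ℂ) (i j : Fin n) : ratio m i j = 2 * (ptData q m).r i j := by
  by_cases h : i = j
  · simp [ratio, ptData, h]
  · simp only [ratio, ptData, ne_eq, h, not_false_eq_true, if_true, if_false]
    ring

lemma ptData_r_skew (m : Coord n d → ℂ) (i j : Fin n) :
    (ptData q m).r i j = -(ptData q m).r j i := by
  by_cases h : i = j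
  · simp [ptData, h]
  · simp only [ptData, h, Ne.symm h, if_false]
    rw [← neg_sub (m (.x j)), div_neg, add_comm]
    ring

lemma hReg_x_ne (hq : q ≠ 1) {m : Coord n d → ℂ} (hm : m ∈ hReg n d q) (i j : Fin n) :
    m (.x i) - q * m (.x j) ≠ 0 := by
  by_cases h : i = j
  · subst h
    have : m (.x i) - q * m (.x i) = (1 - q) * m (.x i) := by ring
    rw [this]
    exact mul_ne_zero (sub_ne_zero.2 hq.symm) (hm.1 i)
  · exact sub_ne_zero.2 (hm.2.1 i j h).2

lemma Z_eq (hq : q ≠ 1) {m : Coord n d → ℂ} (hm : m ∈ hReg n d q) (i j : Fin n) :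
    Z q m i j = f m i j * ((ptData q m).s i j - 1 / 2) := by
  have h1 := hReg_x_ne q hq hm i j
  have h2 := hm.1 j
  have h3 : m (.x i) * (m (.x j))⁻¹ - q ≠ 0 := by
    have : m (.x i) * (m (.x j))⁻¹ - q = (m (.x i) - q * m (.x j)) / m (.x j) := by
      field_simp
    rw [this]
    exact div_ne_zero h1 h2
  simp only [Z, Matrix.of_apply, ptData]
  rw [div_eq_iff h3]
  field_simp
  ring

lemma ptData_pairing (hq : q ≠ 1) {m : Coord n d → ℂ} (hm : m ∈ hReg n d q) (i j : Fin n)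
    (α : Fin d) : (ptData q m).pairing i j α
      = Z q m i j + ∑ γ ∈ Finset.univ.filter (fun γ => γ < α), m (.a i γ) * m (.b j γ)
        + 1 / 2 * (m (.a i α) * m (.b j α)) := by
  have h : ∀ γ, ((ptData q m).s i j + halfSign ℂ γ α) * (m (.a i γ) * m (.b j γ))
      = ((ptData q m).s i j - 1 / 2) * (m (.a i γ) * m (.b j γ))
        + (if γ < α then m (.a i γ) * m (.b j γ) else 0)
        + if α = γ then 1 / 2 * (m (.a i γ) * m (.b j γ)) else 0 := by
    intro γ
    rw [halfSign_complex, o]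
    rcases lt_trichotomy γ α with h | h | h
    · simp only [h, if_true, h.ne', if_false]; ring
    · subst h; simp only [lt_irrefl, if_true, if_false]; ring
    · simp only [h, if_true, h.not_gt, h.ne, if_false]; ring
  change ∑ γ, ((ptData q m).s i j + halfSign ℂ γ α) * (m (.a i γ) * m (.b j γ)) = _
  simp only [h, Finset.sum_add_distrib, Finset.sum_ite_eq, Finset.mem_univ, if_true,
    ← Finset.mul_sum, Z_eq q hq hm, Finset.sum_filter, f]
  ring

variable {m : Coord n d → ℂ}

lemma ptData_sum_rawAA_right (hm : m ∈ hReg n d q) (i j : Fin n) (α : Fin d) :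
    ∑ ε, (ptData q m).rawAA i j α ε
      = m (.a j α) * ((ptData q m).r i j - 1 / 2 * signSum m i α) := by
  have h : ∀ ε, (ptData q m).rawAA i j α ε = m (.a j α) * ((ptData q m).r i j * m (.a i ε)
      - 1 / 2 * (o α ε * m (.a i ε))) := fun ε => by
    rw [LocalData.rawAA, halfSign_complex, o_skew]; simp only [ptData]; ring
  simp only [h, ← Finset.mul_sum, Finset.sum_sub_distrib, hm.2.2.1, signSum, mul_one]

lemma ptData_sum_rawAA_left (hm : m ∈ hReg n d q) (i j : Fin n) (β : Fin d) :
    ∑ δ, (ptData q m).rawAA i j δ β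
      = m (.a i β) * ((ptData q m).r i j + 1 / 2 * signSum m j β) := by
  have h : ∀ δ, (ptData q m).rawAA i j δ β = m (.a i β) * ((ptData q m).r i j * m (.a j δ)
      + 1 / 2 * (o β δ * m (.a j δ))) := fun δ => by
    rw [LocalData.rawAA, halfSign_complex]; simp only [ptData]; ring
  simp only [h, ← Finset.mul_sum, Finset.sum_add_distrib, hm.2.2.1, signSum, mul_one]

lemma ptData_sum_sum_rawAA (hm : m ∈ hReg n d q) (i j : Fin n) :
    ∑ δ, ∑ ε, (ptData q m).rawAA i j δ ε = (ptData q m).r i j + 1 / 2 * oo m i j := by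
  have h : ∀ δ, ∑ ε, (ptData q m).rawAA i j δ ε = (ptData q m).r i j * m (.a j δ)
      + 1 / 2 * ∑ ε, o ε δ * m (.a i ε) * m (.a j δ) := fun δ => by
    rw [ptData_sum_rawAA_right q hm, signSum, mul_sub, Finset.mul_sum, Finset.mul_sum,
      Finset.mul_sum, sub_eq_add_neg, ← Finset.sum_neg_distrib, mul_comm]
    congr 1
    exact Finset.sum_congr rfl fun ε _ => by rw [o_skew]; ring
  simp only [h, Finset.sum_add_distrib, ← Finset.mul_sum, hm.2.2.1, oo, mul_one]

lemma ptData_sum_rawAB (hq : q ≠ 1) (hm : m ∈ hReg n d q) (i j : Fin n) (β : Fin d) :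
    ∑ δ, (ptData q m).rawAB i j δ β = -(Z q m i j
        + ∑ γ ∈ Finset.univ.filter (fun γ => γ < β), m (.a i γ) * m (.b j γ)
        + 1 / 2 * (m (.a i β) * m (.b j β))) := by
  rw [← ptData_pairing q hq hm]
  simp [LocalData.rawAB]

lemma aoAA_eq (hm : m ∈ hReg n d q) (i j : Fin n) (α β : Fin d) :
    aoAA m i j α β = (ptData q m).redAA i j α β := by
  have h1 : ∀ α β, ∑ γ, o α γ * m (.a j β) * m (.a j α) * m (.a i γ)
      = m (.a j β) * m (.a j α) * signSum m i α := fun α β => by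
    rw [signSum, Finset.mul_sum]; exact Finset.sum_congr rfl fun γ _ => by ring
  have h2 : ∑ γ, o β γ * m (.a i α) * m (.a i β) * m (.a j γ)
      = m (.a i α) * m (.a i β) * signSum m j β := by
    rw [signSum, Finset.mul_sum]; exact Finset.sum_congr rfl fun γ _ => by ring
  rw [aoAA, h1, h2, ratio_eq q, LocalData.redAA, Finset.sum_sub_distrib, ← Finset.mul_sum,
    ptData_sum_rawAA_right q hm, ptData_sum_rawAA_left q hm, ptData_sum_sum_rawAA q hm,
    LocalData.rawAA, halfSign_complex]
  simp only [ptData]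
  ring

lemma aoAB_eq (hq : q ≠ 1) (hm : m ∈ hReg n d q) (i j : Fin n) (α β : Fin d) :
    aoAB q m i j α β = (ptData q m).redAB i j α β := by
  have h1 : ∑ γ, o α γ * m (.b j β) * m (.a j α) * m (.a i γ)
      = m (.b j β) * m (.a j α) * signSum m i α := by
    rw [signSum, Finset.mul_sum]; exact Finset.sum_congr rfl fun γ _ => by ring
  rw [aoAB, h1, ratio_eq q, LocalData.redAB, Finset.sum_add_distrib, ← Finset.mul_sum,
    ptData_sum_rawAA_right q hm, ptData_sum_sum_rawAA q hm, ptData_sum_rawAB q hq hm,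
    LocalData.rawAB, ptData_pairing q hq hm]
  simp only [ptData]
  by_cases h : α = β
  · subst h; simp only [if_true]; ring
  · simp only [h, if_false]; ring

lemma aoBB_eq (hq : q ≠ 1) (hm : m ∈ hReg n d q) (i j : Fin n) (α β : Fin d) :
    aoBB q m i j α β = (ptData q m).redBB i j α β := by
  rw [aoBB, ratio_eq q, LocalData.redBB, Finset.sum_add_distrib, ← Finset.mul_sum,
    ptData_sum_sum_rawAA q hm, ptData_sum_rawAB q hq hm, ptData_sum_rawAB q hq hm,
    LocalData.rawBB, halfSign_complex]
  simp only [ptData]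
  ring

/-- The factor `G_z(i, j; α, β)` is `z(e_α - a_i, e_β - a_j)`. -/
lemma twist_eq (z : SpinPair d → ℂ) (i j : Fin n) (α β : Fin d) :
    (ptData q m).twist (skewExt z) i j α β = gFun z m i j α β := by
  have h : ∀ μ ν, skewExt z μ ν • (((if μ = α then 1 else 0) - (ptData q m).a i μ)
        * ((if ν = β then 1 else 0) - (ptData q m).a j ν))
      = (if ν = β then (if μ = α then skewExt z μ ν else 0) - skewExt z μ ν * m (.a i μ) else 0)
        + (if μ = α then skewExt z ν μ * m (.a j ν) else 0)
        + skewExt z μ ν * m (.a i μ) * m (.a j ν) := by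
    intro μ ν
    rw [skewExt_skew z ν μ, smul_eq_mul]
    simp only [ptData]
    split_ifs <;> ring
  simp only [LocalData.twist, h, gFun, Finset.sum_add_distrib, Finset.sum_sub_distrib,
    Finset.sum_ite_eq', Finset.mem_univ, if_true]
  rw [Finset.sum_comm (f := fun μ ν => if μ = α then skewExt z ν μ * m (.a j ν) else 0)]
  simp only [Finset.sum_ite_eq', Finset.mem_univ, if_true]
  ring

/-- The Arutyunov--Olivucci formulas are those of the reduction of the unreduced minus bracket. -/
lemma aoTable_eq (hq : q ≠ 1) (hm : m ∈ hReg n d q) (u v : Coord n d) :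
    aoTable q m u v = (ptData q m).pencilTable (fun i => m (.x i)) 1 0 u v := by
  have h : ∀ i j α β, (ptData q m).twist 0 i j α β = 0 := by simp [LocalData.twist]
  cases u <;> cases v <;>
    simp [aoTable, table, LocalData.pencilTable, assemble, aoAA_eq q hm, aoAB_eq q hq hm,
      aoBB_eq q hq hm, h] <;> rfl

lemma psiTable_eq (z : SpinPair d → ℂ) (u v : Coord n d) :
    psiTable z m u v = (ptData q m).pencilTable (fun i => m (.x i)) 0 (skewExt z) u v := by
  cases u <;> cases v <;>
    simp only [psiTable, table, LocalData.pencilTable, assemble, twist_eq q, mul_assoc, zero_smul,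
      zero_add, zero_mul, neg_zero, neg_mul, Pi.zero_apply] <;> rfl

lemma skewExt_half (α β : Fin d) : skewExt (fun _ => 1 / 2) α β = o α β / 2 := by
  unfold skewExt o
  split_ifs <;> ring

lemma gFun_half (i j : Fin n) (α β : Fin d) : gFun (fun _ => 1 / 2) m i j α β
    = 1 / 2 * (o α β - signSum m j α + signSum m i β + oo m i j) := by
  have h1 : ∀ i α, ∑ μ, o μ α * m (.a i μ) = -signSum m i α := fun i α => by
    rw [signSum, ← Finset.sum_neg_distrib]
    exact Finset.sum_congr rfl fun γ _ => by rw [o_skew]; ring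
  have h2 : oo m i j = ∑ μ, ∑ ν, o μ ν * m (.a i μ) * m (.a j ν) := Finset.sum_comm
  have h3 : ∑ μ, (o μ α / 2 * m (.a j μ) - o μ β / 2 * m (.a i μ))
      = 1 / 2 * (∑ μ, o μ α * m (.a j μ) - ∑ μ, o μ β * m (.a i μ)) := by
    rw [← Finset.sum_sub_distrib, Finset.mul_sum]
    exact Finset.sum_congr rfl fun γ _ => by ring
  have h4 : ∑ μ, ∑ ν, o μ ν / 2 * m (.a i μ) * m (.a j ν) = 1 / 2 * oo m i j := by
    rw [h2, Finset.mul_sum]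
    refine Finset.sum_congr rfl fun γ _ => ?_
    rw [Finset.mul_sum]
    exact Finset.sum_congr rfl fun γ _ => by ring
  simp only [gFun, skewExt_half, h3, h4, h1]
  ring

lemma sum_lt_a (hm : m ∈ hReg n d q) (i : Fin n) (β : Fin d) :
    ∑ γ ∈ Finset.univ.filter (fun γ => γ < β), m (.a i γ)
      = 1 / 2 * (1 - m (.a i β) - signSum m i β) := by
  have h : ∀ γ, (if γ < β then m (.a i γ) else 0)
      = 1 / 2 * m (.a i γ) - (if β = γ then 1 / 2 * m (.a i γ) else 0)
        - 1 / 2 * (o β γ * m (.a i γ)) := by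
    intro γ
    rw [o]
    rcases lt_trichotomy γ β with h | h | h
    · simp only [h, if_true, h.ne', h.not_gt, if_false]; ring
    · subst h; simp only [lt_irrefl, if_true, if_false]; ring
    · simp only [h, if_true, h.not_gt, h.ne, if_false]; ring
  rw [Finset.sum_filter, Finset.sum_congr rfl fun γ _ => h γ, Finset.sum_sub_distrib,
    Finset.sum_sub_distrib, Finset.sum_ite_eq, if_pos (Finset.mem_univ _), ← Finset.mul_sum,
    ← Finset.mul_sum, hm.2.2.1, ← signSum]
  ring

lemma sum_lt_ab (hm : m ∈ hReg n d q) (i j : Fin n) (β : Fin d) :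
    ∑ γ ∈ Finset.univ.filter (fun γ => γ < β), m (.a i γ) * (m (.b j γ) - m (.b j β))
      = ∑ γ ∈ Finset.univ.filter (fun γ => γ < β), m (.a i γ) * m (.b j γ)
        - 1 / 2 * (1 - m (.a i β) - signSum m i β) * m (.b j β) := by
  rw [← sum_lt_a q hm, Finset.sum_mul, ← Finset.sum_sub_distrib]
  exact Finset.sum_congr rfl fun γ _ => by ring

lemma cfAA_eq (i j : Fin n) (α β : Fin d) : cfAA m i j α β
    = aoAA m i j α β - gFun (fun _ => 1 / 2) m i j α β * m (.a i α) * m (.a j β) := by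
  have h1 : ∑ γ, o α γ * m (.a j β) * (m (.a i α) * m (.a j γ) + m (.a j α) * m (.a i γ))
      = m (.a j β) * (m (.a i α) * signSum m j α + m (.a j α) * signSum m i α) := by
    rw [signSum, signSum, Finset.mul_sum, Finset.mul_sum, ← Finset.sum_add_distrib,
      Finset.mul_sum]
    exact Finset.sum_congr rfl fun γ _ => by ring
  have h2 : ∑ γ, o β γ * m (.a i α) * (m (.a j β) * m (.a i γ) + m (.a i β) * m (.a j γ))
      = m (.a i α) * (m (.a j β) * signSum m i β + m (.a i β) * signSum m j β) := by
    rw [signSum, signSum, Finset.mul_sum, Finset.mul_sum, ← Finset.sum_add_distrib,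
      Finset.mul_sum]
    exact Finset.sum_congr rfl fun γ _ => by ring
  have h3 : ∑ γ, o α γ * m (.a j β) * m (.a j α) * m (.a i γ)
      = m (.a j β) * m (.a j α) * signSum m i α := by
    rw [signSum, Finset.mul_sum]; exact Finset.sum_congr rfl fun γ _ => by ring
  have h4 : ∑ γ, o β γ * m (.a i α) * m (.a i β) * m (.a j γ)
      = m (.a i α) * m (.a i β) * signSum m j β := by
    rw [signSum, Finset.mul_sum]; exact Finset.sum_congr rfl fun γ _ => by ring
  rw [cfAA, aoAA, h1, h2, h3, h4, gFun_half, o_skew α β]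
  ring

lemma cfAB_eq (hm : m ∈ hReg n d q) (i j : Fin n) (α β : Fin d) : cfAB q m i j α β
    = aoAB q m i j α β + gFun (fun _ => 1 / 2) m i j α β * m (.a i α) * m (.b j β) := by
  have h1 : ∑ γ, o α γ * m (.b j β) * (m (.a i α) * m (.a j γ) + m (.a j α) * m (.a i γ))
      = m (.b j β) * (m (.a i α) * signSum m j α + m (.a j α) * signSum m i α) := by
    rw [signSum, signSum, Finset.mul_sum, Finset.mul_sum, ← Finset.sum_add_distrib,
      Finset.mul_sum]
    exact Finset.sum_congr rfl fun γ _ => by ring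
  have h2 : ∑ γ, o α γ * m (.b j β) * m (.a j α) * m (.a i γ)
      = m (.b j β) * m (.a j α) * signSum m i α := by
    rw [signSum, Finset.mul_sum]; exact Finset.sum_congr rfl fun γ _ => by ring
  rw [cfAB, aoAB, h1, h2, gFun_half, sum_lt_ab q hm]
  rcases lt_trichotomy α β with h | h | h
  · simp only [o, h, h.ne, if_true, if_false]; ring
  · subst h; simp only [o, lt_irrefl, if_true, if_false]; ring
  · simp only [o, h, h.ne', h.not_gt, if_true, if_false]; ring

lemma cfBB_eq (hm : m ∈ hReg n d q) (i j : Fin n) (α β : Fin d) : cfBB q m i j α β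
    = aoBB q m i j α β - gFun (fun _ => 1 / 2) m i j α β * m (.b i α) * m (.b j β) := by
  rw [cfBB, aoBB, gFun_half, sum_lt_ab q hm, sum_lt_ab q hm, o_skew α β]
  ring

/-- The Chalykh--Fairon bracket differs from the minus bracket by `ψ_{1/2}`. -/
lemma cfTable_eq (hm : m ∈ hReg n d q) (u v : Coord n d) :
    cfTable q m u v = aoTable q m u v - psiTable (fun _ => 1 / 2) m u v := by
  rcases u with i | ⟨i, α⟩ | ⟨i, α⟩ <;> rcases v with j | ⟨j, β⟩ | ⟨j, β⟩ <;>
    simp only [cfTable, aoTable, psiTable, table, zero_mul, neg_zero, ite_self, sub_zero]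
  · exact cfAA_eq i j α β
  · rw [cfAB_eq q hm]; ring
  · rw [cfAB_eq q hm]; ring
  · exact cfBB_eq q hm i j α β

/-- Tables are equivariant under permutations of the particles if their blocks are. -/
lemma table_perm {ε : ℂ} {aa ab bb : (Coord n d → ℂ) → Fin n → Fin n → Fin d → Fin d → ℂ}
    (m : Coord n d → ℂ) (σ : Equiv.Perm (Fin n))
    (haa : ∀ i j, aa (fun c => m (c.perm σ)) i j = aa m (σ i) (σ j))
    (hab : ∀ i j, ab (fun c => m (c.perm σ)) i j = ab m (σ i) (σ j))
    (hbb : ∀ i j, bb (fun c => m (c.perm σ)) i j = bb m (σ i) (σ j)) (u v : Coord n d) :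
    table ε aa ab bb (fun c => m (c.perm σ)) u v = table ε aa ab bb m (u.perm σ) (v.perm σ) := by
  rcases u with i | ⟨i, α⟩ | ⟨i, α⟩ <;> rcases v with j | ⟨j, β⟩ | ⟨j, β⟩
  · rfl
  · rfl
  · simp [table, Coord.perm]
  · rfl
  · exact congrFun₂ (haa i j) α β
  · exact congrFun₂ (hab i j) α β
  · simp [table, Coord.perm]
  · exact congrArg Neg.neg (congrFun₂ (hab j i) β α)
  · exact congrFun₂ (hbb i j) α β

lemma ratio_perm (m : Coord n d → ℂ) (σ : Equiv.Perm (Fin n)) (i j : Fin n) :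
    ratio (fun c => m (c.perm σ)) i j = ratio m (σ i) (σ j) := by
  simp [ratio, Coord.perm]

lemma aoTable_perm (m : Coord n d → ℂ) (σ : Equiv.Perm (Fin n)) (u v : Coord n d) :
    aoTable q (fun c => m (c.perm σ)) u v = aoTable q m (u.perm σ) (v.perm σ) := by
  refine table_perm m σ (fun i j => ?_) (fun i j => ?_) (fun i j => ?_) u v
  · funext α β; simp only [aoAA, ratio_perm]; rfl
  · funext α β; simp only [aoAB, ratio_perm]; rfl
  · funext α β; simp only [aoBB, ratio_perm]; rfl

lemma psiTable_perm (z : SpinPair d → ℂ) (m : Coord n d → ℂ) (σ : Equiv.Perm (Fin n))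
    (u v : Coord n d) :
    psiTable z (fun c => m (c.perm σ)) u v = psiTable z m (u.perm σ) (v.perm σ) :=
  table_perm m σ (fun _ _ => rfl) (fun _ _ => rfl) (fun _ _ => rfl) u v

end Tables

/-! ### Regular functions on `h_reg` as rational functions -/

section Regular

open Filter Topology

variable {n d : ℕ} {q : ℂ}

/-- The rescaling of a point to `∑_α a_i^α = 1`, meaningful if none of these sums is zero. -/
noncomputable def normPt (m : Coord n d → ℂ) : Coord n d → ℂ
  | .x i => m (.x i)
  | .a i α => m (.a i α) / ∑ γ, m (.a i γ)
  | .b i α => m (.b i α) * ∑ γ, m (.a i γ)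

lemma normPt_of_mem {m : Coord n d → ℂ} (hm : m ∈ hReg n d q) : normPt m = m := by
  funext u
  cases u <;> simp [normPt, hm.2.2.1]

/-- The substitution of the normalized coordinates into polynomials. -/
noncomputable def evNorm : MvPolynomial (Coord n d) ℂ →ₐ[ℂ] RatField n d :=
  MvPolynomial.aeval normVar

/-- The common denominator `∏_i S_i` of the normalized coordinates. -/
noncomputable def normDenom (n d : ℕ) : MvPolynomial (Coord n d) ℂ :=
  ∏ i, ∑ α, MvPolynomial.X (.a i α)

lemma algebraMap_sum_a (i : Fin n) :
    algebraMap (MvPolynomial (Coord n d) ℂ) (RatField n d) (∑ α, MvPolynomial.X (.a i α))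
      = Sv i := by
  rw [map_sum]; rfl

lemma algebraMap_normDenom_ne (hd : 0 < d) :
    algebraMap (MvPolynomial (Coord n d) ℂ) (RatField n d) (normDenom n d) ≠ 0 := by
  rw [normDenom, map_prod]
  exact Finset.prod_ne_zero_iff.2 fun i _ => by rw [algebraMap_sum_a]; exact Sv_ne hd i

/-- Substituting the normalized coordinates into `p` gives a polynomial `P` divided by a power of
`normDenom`, both in the field of rational functions and at points. -/
def HasNumerator (p : MvPolynomial (Coord n d) ℂ) : Prop :=
  ∃ (N : ℕ) (P : MvPolynomial (Coord n d) ℂ),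
    evNorm p * algebraMap _ _ (normDenom n d) ^ N = algebraMap _ _ P ∧
    ∀ m : Coord n d → ℂ, (∀ i, ∑ α, m (.a i α) ≠ 0) →
      MvPolynomial.eval m P
        = MvPolynomial.eval (normPt m) p * MvPolynomial.eval m (normDenom n d) ^ N

lemma HasNumerator.mul {p p' : MvPolynomial (Coord n d) ℂ} (h : HasNumerator p)
    (h' : HasNumerator p') : HasNumerator (p * p') := by
  obtain ⟨N, P, h1, h2⟩ := h
  obtain ⟨N', P', h1', h2'⟩ := h'
  refine ⟨N + N', P * P', ?_, fun m hm => ?_⟩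
  · rw [map_mul, map_mul, ← h1, ← h1']; ring
  · rw [map_mul, map_mul, h2 m hm, h2' m hm]; ring

lemma hasNumerator (hd : 0 < d) (p : MvPolynomial (Coord n d) ℂ) : HasNumerator p := by
  induction p using MvPolynomial.induction_on with
  | C c => exact ⟨0, MvPolynomial.C c, by
      simp only [evNorm, pow_zero, mul_one, ← MvPolynomial.algebraMap_eq,
        ← IsScalarTower.algebraMap_apply, AlgHom.commutes], by simp⟩
  | add p p' h h' =>
    obtain ⟨N, P, h1, h2⟩ := h
    obtain ⟨N', P', h1', h2'⟩ := h'
    refine ⟨N + N', P * normDenom n d ^ N' + P' * normDenom n d ^ N, ?_, fun m hm => ?_⟩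
    · rw [map_add, map_add, map_mul, map_mul, ← h1, ← h1', map_pow, map_pow]; ring
    · rw [map_add, map_add, map_mul, map_mul, h2 m hm, h2' m hm, map_pow, map_pow]; ring
  | mul_X p u h =>
    refine h.mul ?_
    rcases u with i | ⟨i, α⟩ | ⟨i, α⟩
    · exact ⟨0, MvPolynomial.X (.x i), by simp [evNorm, normVar, xv, ratVar],
        by simp [normPt]⟩
    · refine ⟨1, MvPolynomial.X (.a i α) * ∏ j ∈ Finset.univ.erase i,
        ∑ γ, MvPolynomial.X (.a j γ), ?_, fun m hm => ?_⟩
      · have h := Sv_ne (n := n) hd i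
        rw [pow_one, normDenom, ← Finset.mul_prod_erase _ _ (Finset.mem_univ i), map_mul,
          algebraMap_sum_a, map_mul]
        simp only [evNorm, MvPolynomial.aeval_X, normVar]
        field_simp
        exact mul_comm _ _
      · have h := hm i
        rw [pow_one, normDenom, ← Finset.mul_prod_erase _ _ (Finset.mem_univ i), map_mul, map_mul]
        simp only [MvPolynomial.eval_X, normPt, map_sum]
        field_simp
    · refine ⟨0, MvPolynomial.X (.b i α) * ∑ γ, MvPolynomial.X (.a i γ), ?_, fun m hm => ?_⟩
      · rw [map_mul, algebraMap_sum_a]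
        simp [evNorm, normVar, bv, ratVar]
      · simp [normPt]

lemma continuous_sum_a (i : Fin n) : Continuous fun m : Coord n d → ℂ => ∑ α, m (.a i α) :=
  continuous_finsetSum _ fun _ _ => continuous_apply _

lemma continuous_pairing (s : Finset (Fin d)) (i j : Fin n) :
    Continuous fun m : Coord n d → ℂ => ∑ α ∈ s, m (.a i α) * m (.b j α) :=
  continuous_finsetSum _ fun _ _ => (continuous_apply _).mul (continuous_apply _)

lemma continuousAt_Z (hq : q ≠ 1) {m₀ : Coord n d → ℂ} (hm₀ : m₀ ∈ hReg n d q) (i j : Fin n) :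
    ContinuousAt (fun m : Coord n d → ℂ => Z q m i j) m₀ := by
  have h1 : m₀ (.x i) * (m₀ (.x j))⁻¹ - q ≠ 0 := by
    have h2 := hm₀.1 j
    have : m₀ (.x i) * (m₀ (.x j))⁻¹ - q = (m₀ (.x i) - q * m₀ (.x j)) / m₀ (.x j) := by
      field_simp
    rw [this]
    exact div_ne_zero (hReg_x_ne q hq hm₀ i j) h2
  have hx : ∀ u : Coord n d, ContinuousAt (fun m : Coord n d → ℂ => m u) m₀ := fun u =>
    (continuous_apply u).continuousAt
  have hf : ContinuousAt (fun m : Coord n d → ℂ => f m i j) m₀ :=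
    (continuous_pairing Finset.univ i j).continuousAt
  have hden := ((hx (.x i)).mul ((hx (.x j)).inv₀ (hm₀.1 j))).sub
    (continuousAt_const (y := q))
  exact (continuousAt_const.mul hf).div hden h1

lemma continuousAt_det_calZ (hq : q ≠ 1) {m₀ : Coord n d → ℂ} (hm₀ : m₀ ∈ hReg n d q) (k : ℕ) :
    ContinuousAt (fun m => (calZ q m k).det) m₀ := by
  have h : ContinuousAt (fun m => calZ q m k) m₀ :=
    continuousAt_pi.2 fun i => continuousAt_pi.2 fun j =>
      (continuousAt_Z hq hm₀ i j).add (continuous_pairing _ i j).continuousAt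
  exact (Continuous.matrix_det continuous_id).continuousAt.comp h

lemma continuousAt_normPt {m₀ : Coord n d → ℂ} (h : ∀ i, ∑ α, m₀ (.a i α) ≠ 0) :
    ContinuousAt (normPt (n := n) (d := d)) m₀ := by
  refine continuousAt_pi.2 fun u => ?_
  rcases u with i | ⟨i, α⟩ | ⟨i, α⟩
  · exact (continuous_apply _).continuousAt
  · exact ContinuousAt.div (continuous_apply _).continuousAt (continuous_sum_a i).continuousAt (h i)
  · exact ((continuous_apply _).mul (continuous_sum_a i)).continuousAt

/-- Near a point of `h_reg`, normalized points belong to `h_reg`. -/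
lemma eventually_normPt_mem (hq : q ≠ 1) {m₀ : Coord n d → ℂ} (hm₀ : m₀ ∈ hReg n d q) :
    ∀ᶠ m in 𝓝 m₀, (∀ i, ∑ α, m (.a i α) ≠ 0) ∧ normPt m ∈ hReg n d q := by
  have hS₀ : ∀ i, ∑ α, m₀ (.a i α) ≠ 0 := fun i => by rw [hm₀.2.2.1]; exact one_ne_zero
  have hS : ∀ᶠ m in 𝓝 m₀, ∀ i, ∑ α, m (.a i α) ≠ 0 :=
    eventually_all.2 fun i => (continuous_sum_a i).continuousAt.eventually_ne (hS₀ i)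
  have hx : ∀ u : Coord n d, ContinuousAt (fun m : Coord n d → ℂ => m u) m₀ := fun u =>
    (continuous_apply u).continuousAt
  have hU : ∀ᶠ m in 𝓝 m₀, (∀ i, m (.x i) ≠ 0) ∧
      (∀ i j, i ≠ j → m (.x i) ≠ m (.x j) ∧ m (.x i) ≠ q * m (.x j)) ∧
      ∀ k ≤ d, (calZ q m k).det ≠ 0 := by
    refine (eventually_all.2 fun i => (hx _).eventually_ne (hm₀.1 i)).and
      ((eventually_all.2 fun i => eventually_all.2 fun j => ?_).and ?_)
    · by_cases h : i = j
      · exact Eventually.of_forall fun m h' => absurd h h'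
      · have h1 := ((hx (.x i)).sub (hx (.x j))).eventually_ne (sub_ne_zero.2 (hm₀.2.1 i j h).1)
        have h2 := ((hx (.x i)).sub ((continuousAt_const (y := q)).mul (hx (.x j)))).eventually_ne
          (sub_ne_zero.2 (hm₀.2.1 i j h).2)
        filter_upwards [h1, h2] with m h1 h2 _
        exact ⟨sub_ne_zero.1 h1, sub_ne_zero.1 h2⟩
    · exact (eventually_all_finite (Set.finite_Iic d)).2 fun k hk =>
        (continuousAt_det_calZ hq hm₀ k).eventually_ne (hm₀.2.2.2 k hk)
  have hU' : ∀ᶠ m in 𝓝 (normPt m₀), (∀ i, m (.x i) ≠ 0) ∧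
      (∀ i j, i ≠ j → m (.x i) ≠ m (.x j) ∧ m (.x i) ≠ q * m (.x j)) ∧
      ∀ k ≤ d, (calZ q m k).det ≠ 0 := by
    rwa [normPt_of_mem hm₀]
  filter_upwards [hS, (continuousAt_normPt hS₀).eventually hU'] with m h1 h2
  refine ⟨h1, h2.1, h2.2.1, fun i => ?_, h2.2.2⟩
  simp only [normPt, ← Finset.sum_div]
  exact div_self (h1 i)

/-- A polynomial vanishing on a non-empty open set is zero. -/
lemma eq_zero_of_eventually {p : MvPolynomial (Coord n d) ℂ} {m₀ : Coord n d → ℂ}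
    (h : ∀ᶠ m in 𝓝 m₀, MvPolynomial.eval m p = 0) : p = 0 := by
  obtain ⟨ε, hε, hball⟩ := Metric.eventually_nhds_iff_ball.1 h
  refine MvPolynomial.funext_set (fun u => Metric.ball (m₀ u) ε)
    (fun u => infinite_of_mem_nhds _ (Metric.ball_mem_nhds _ hε)) fun m hm => ?_
  rw [map_zero]
  refine hball m ?_
  rwa [ball_pi _ hε]

/-- A polynomial vanishes on `h_reg` if and only if it vanishes upon substitution of
the normalized coordinates. -/
lemma evNorm_eq_zero_iff (hd : 0 < d) (hq : q ≠ 1) {m₀ : Coord n d → ℂ} (hm₀ : m₀ ∈ hReg n d q)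
    (p : MvPolynomial (Coord n d) ℂ) :
    evNorm p = 0 ↔ ∀ m ∈ hReg n d q, MvPolynomial.eval m p = 0 := by
  obtain ⟨N, P, h1, h2⟩ := hasNumerator hd p
  have h3 : evNorm p = 0 ↔ P = 0 := by
    rw [← map_eq_zero_iff (algebraMap (MvPolynomial (Coord n d) ℂ) (RatField n d))
      (IsFractionRing.injective _ _), ← h1]
    simp [algebraMap_normDenom_ne hd]
  rw [h3]
  constructor
  · rintro rfl m hm
    have hs : ∀ i, ∑ α, m (.a i α) = 1 := hm.2.2.1
    have := h2 m fun i => by rw [hs i]; exact one_ne_zero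
    rw [normPt_of_mem hm, map_zero] at this
    simpa [normDenom, hs] using this.symm
  · intro h
    refine eq_zero_of_eventually (m₀ := m₀) ?_
    filter_upwards [eventually_normPt_mem hq hm₀] with m hm
    rw [h2 m hm.1, h _ hm.2, zero_mul]

end Regular

/-! ### The algebra `ℂ[h_reg]` inside the field of rational functions -/

section Embedding

variable {n d : ℕ} {q : ℂ}

/-- The evaluation of a regular function at a point of `h_reg`. -/
noncomputable def evalUp (m : hReg n d q) : regUp n d q →ₐ[ℂ] ℂ :=
  (Pi.evalAlgHom ℂ (fun _ : hReg n d q => ℂ) m).comp (regUp n d q).val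

lemma evalUp_coordFn (m : hReg n d q) (u : Coord n d) : evalUp m (coordFn q u) = m.1 u := rfl

lemma regUp_ext {F G : regUp n d q} (h : ∀ m, evalUp m F = evalUp m G) : F = G :=
  Subtype.ext (funext h)

/-- The quotient of two polynomials as a regular function. -/
noncomputable def fracUp (p s : MvPolynomial (Coord n d) ℂ)
    (hs : ∀ m : hReg n d q, MvPolynomial.eval m.1 s ≠ 0) : regUp n d q :=
  ⟨fun m => MvPolynomial.eval m.1 p / MvPolynomial.eval m.1 s, p, s, fun m => ⟨hs m, rfl⟩⟩

lemma evalUp_fracUp (p s : MvPolynomial (Coord n d) ℂ)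
    (hs : ∀ m : hReg n d q, MvPolynomial.eval m.1 s ≠ 0) (m : hReg n d q) :
    evalUp m (fracUp p s hs) = MvPolynomial.eval m.1 p / MvPolynomial.eval m.1 s := rfl

lemma exists_fracUp (F : regUp n d q) : ∃ (p s : MvPolynomial (Coord n d) ℂ)
    (hs : ∀ m : hReg n d q, MvPolynomial.eval m.1 s ≠ 0), F = fracUp p s hs := by
  obtain ⟨p, s, h⟩ := F.2
  exact ⟨p, s, fun m => (h m).1, regUp_ext fun m => (h m).2⟩

lemma evalUp_aeval (m : hReg n d q) (p : MvPolynomial (Coord n d) ℂ) :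
    evalUp m (MvPolynomial.aeval (coordFn q) p) = MvPolynomial.eval m.1 p := by
  rw [← AlgHom.comp_apply, MvPolynomial.comp_aeval]
  rfl

lemma coordFn_generates : InvGenerates (coordFn q : Coord n d → regUp n d q) := by
  intro S hS hinv
  have hpoly : ∀ p : MvPolynomial (Coord n d) ℂ, MvPolynomial.aeval (coordFn q) p ∈ S := by
    intro p
    induction p using MvPolynomial.induction_on with
    | C c =>
      rw [← MvPolynomial.algebraMap_eq, AlgHom.commutes]
      exact S.algebraMap_mem c
    | add p p' h h' => rw [map_add]; exact S.add_mem h h'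
    | mul_X p u h => rw [map_mul, MvPolynomial.aeval_X]; exact S.mul_mem h (hS u)
  refine eq_top_iff.2 fun F _ => ?_
  obtain ⟨p, s, hs, rfl⟩ := exists_fracUp F
  have h1 : MvPolynomial.aeval (coordFn q) s * fracUp 1 s hs = 1 := regUp_ext fun m => by
    rw [map_mul, evalUp_aeval, evalUp_fracUp, map_one, map_one, mul_one_div_cancel (hs m)]
  have h2 : fracUp p s hs = MvPolynomial.aeval (coordFn q) p * fracUp 1 s hs :=
    regUp_ext fun m => by
      rw [map_mul, evalUp_aeval, evalUp_fracUp, evalUp_fracUp, map_one, mul_one_div]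
  rw [h2]
  exact S.mul_mem (hpoly p) (hinv _ (hpoly s) _ h1)

variable (hd : 0 < d) (hq : q ≠ 1) (hne : (hReg n d q).Nonempty)

lemma evNorm_ne_zero (hd : 0 < d) (hq : q ≠ 1) (hne : (hReg n d q).Nonempty)
    {s : MvPolynomial (Coord n d) ℂ} (hs : ∀ m : hReg n d q, MvPolynomial.eval m.1 s ≠ 0) :
    evNorm s ≠ 0 := by
  obtain ⟨m, hm⟩ := hne
  exact fun h => hs ⟨m, hm⟩ ((evNorm_eq_zero_iff hd hq hm s).1 h m hm)

lemma evNorm_div_eq (hd : 0 < d) (hq : q ≠ 1) (hne : (hReg n d q).Nonempty)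
    {p s p' s' : MvPolynomial (Coord n d) ℂ} (hs : ∀ m : hReg n d q, MvPolynomial.eval m.1 s ≠ 0)
    (hs' : ∀ m : hReg n d q, MvPolynomial.eval m.1 s' ≠ 0) :
    evNorm p / evNorm s = evNorm p' / evNorm s' ↔ fracUp p s hs = fracUp p' s' hs' := by
  rw [div_eq_div_iff (evNorm_ne_zero hd hq hne hs) (evNorm_ne_zero hd hq hne hs'), ← map_mul,
    ← map_mul, ← sub_eq_zero, ← map_sub]
  obtain ⟨m₀, hm₀⟩ := hne
  rw [evNorm_eq_zero_iff hd hq hm₀]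
  constructor
  · intro h
    refine regUp_ext fun m => ?_
    have h1 := h m.1 m.2
    rw [map_sub, map_mul, map_mul] at h1
    rw [evalUp_fracUp, evalUp_fracUp, div_eq_div_iff (hs m) (hs' m), sub_eq_zero.1 h1]
  · intro h m hm
    have h1 := congrArg (evalUp ⟨m, hm⟩) h
    rw [evalUp_fracUp, evalUp_fracUp, div_eq_div_iff (hs _) (hs' _)] at h1
    rw [map_sub, map_mul, map_mul, h1, sub_self]

/-- The substitution of the normalized coordinates into regular functions on `h_reg`, by means of
a chosen presentation as a fraction; `toRatFun_fracUp` shows that the choice does not matter. -/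
noncomputable def toRatFun (F : regUp n d q) : RatField n d :=
  evNorm (exists_fracUp F).choose / evNorm (exists_fracUp F).choose_spec.choose

lemma toRatFun_fracUp (hd : 0 < d) (hq : q ≠ 1) (hne : (hReg n d q).Nonempty)
    (p s : MvPolynomial (Coord n d) ℂ) (hs : ∀ m : hReg n d q, MvPolynomial.eval m.1 s ≠ 0) :
    toRatFun (fracUp p s hs) = evNorm p / evNorm s :=
  (evNorm_div_eq hd hq hne (exists_fracUp (fracUp p s hs)).choose_spec.choose_spec.choose hs).2
    (exists_fracUp (fracUp p s hs)).choose_spec.choose_spec.choose_spec.symm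

/-- The substitution of the normalized coordinates, as an embedding of `ℂ[h_reg]` into the field
of rational functions of the unreduced coordinates. -/
noncomputable def toRat : regUp n d q →ₐ[ℂ] RatField n d :=
  AlgHom.ofLinearMap
    { toFun := toRatFun
      map_add' := fun F G => by
        obtain ⟨p, s, hs, rfl⟩ := exists_fracUp F
        obtain ⟨p', s', hs', rfl⟩ := exists_fracUp G
        have hss : ∀ m : hReg n d q, MvPolynomial.eval m.1 (s * s') ≠ 0 := fun m => by
          rw [map_mul]; exact mul_ne_zero (hs m) (hs' m)
        have h : fracUp p s hs + fracUp p' s' hs' = fracUp (p * s' + s * p') (s * s') hss :=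
          regUp_ext fun m => by
            simp only [map_add, evalUp_fracUp, map_mul, div_add_div _ _ (hs m) (hs' m)]
        rw [h, toRatFun_fracUp hd hq hne, toRatFun_fracUp hd hq hne, toRatFun_fracUp hd hq hne,
          div_add_div _ _ (evNorm_ne_zero hd hq hne hs) (evNorm_ne_zero hd hq hne hs')]
        simp only [map_add, map_mul]
      map_smul' := fun c F => by
        obtain ⟨p, s, hs, rfl⟩ := exists_fracUp F
        have h : c • fracUp p s hs = fracUp (c • p) s hs := regUp_ext fun m => by
          simp only [map_smul, evalUp_fracUp, MvPolynomial.smul_eval, smul_eq_mul, mul_div_assoc]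
        rw [h, toRatFun_fracUp hd hq hne, toRatFun_fracUp hd hq hne, map_smul, RingHom.id_apply,
          Algebra.smul_def, Algebra.smul_def, mul_div_assoc] }
    (by
      have h : (1 : regUp n d q) = fracUp 1 1 (fun m => by simp) := regUp_ext fun m => by
        simp [evalUp_fracUp]
      change toRatFun _ = _
      rw [h, toRatFun_fracUp hd hq hne, map_one, div_one])
    (fun F G => by
      obtain ⟨p, s, hs, rfl⟩ := exists_fracUp F
      obtain ⟨p', s', hs', rfl⟩ := exists_fracUp G
      have hss : ∀ m : hReg n d q, MvPolynomial.eval m.1 (s * s') ≠ 0 := fun m => by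
        rw [map_mul]; exact mul_ne_zero (hs m) (hs' m)
      have h : fracUp p s hs * fracUp p' s' hs' = fracUp (p * p') (s * s') hss :=
        regUp_ext fun m => by simp only [evalUp_fracUp, map_mul, div_mul_div_comm]
      change toRatFun _ = toRatFun _ * toRatFun _
      rw [h, toRatFun_fracUp hd hq hne, toRatFun_fracUp hd hq hne, toRatFun_fracUp hd hq hne,
        div_mul_div_comm, map_mul, map_mul])

lemma toRat_fracUp (p s : MvPolynomial (Coord n d) ℂ)
    (hs : ∀ m : hReg n d q, MvPolynomial.eval m.1 s ≠ 0) :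
    toRat hd hq hne (fracUp p s hs) = evNorm p / evNorm s :=
  toRatFun_fracUp hd hq hne p s hs

lemma toRat_injective : Function.Injective (toRat hd hq hne) := by
  intro F G h
  obtain ⟨p, s, hs, rfl⟩ := exists_fracUp F
  obtain ⟨p', s', hs', rfl⟩ := exists_fracUp G
  rw [toRat_fracUp, toRat_fracUp] at h
  exact (evNorm_div_eq hd hq hne hs hs').1 h

lemma toRat_coordFn (u : Coord n d) : toRat hd hq hne (coordFn q u) = normVar u := by
  have h : coordFn q u = fracUp (MvPolynomial.X u) 1 (fun m => by simp) := regUp_ext fun m => by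
    simp [evalUp_fracUp, evalUp_coordFn]
  rw [h, toRat_fracUp, map_one, div_one, evNorm, MvPolynomial.aeval_X]

lemma euler_toRat (p : Fin n) (F : regUp n d q) : euler p (toRat hd hq hne F) = 0 := by
  have hD : IsDerivationAlong (toRat hd hq hne) (euler p ∘ₗ (toRat hd hq hne).toLinearMap) := by
    intro F G
    simp only [LinearMap.comp_apply, AlgHom.toLinearMap_apply, map_mul]
    exact vectorField_derivation _ _ _
  refine hD.eq_zero coordFn_generates (fun u => ?_) F
  simp only [LinearMap.comp_apply, AlgHom.toLinearMap_apply, toRat_coordFn]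
  exact euler_normVar hd p u

/-! ### The local brackets on `ℂ[h_reg]` -/

/-- The local coordinates as regular functions on `h_reg`. -/
noncomputable def upData : LocalData (regUp n d q) n d where
  a i α := coordFn q (.a i α)
  b i α := coordFn q (.b i α)
  r i j := if h : i = j then 0 else
    fracUp (MvPolynomial.C (1 / 2) * (MvPolynomial.X (.x i) + MvPolynomial.X (.x j)))
      (MvPolynomial.X (.x i) - MvPolynomial.X (.x j)) fun m => by
        simpa using sub_ne_zero.2 (m.2.2.1 i j h).1
  s i j := fracUp
    (MvPolynomial.C (1 / 2) *
      (MvPolynomial.X (.x i) + MvPolynomial.C q * MvPolynomial.X (.x j)))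
    (MvPolynomial.X (.x i) - MvPolynomial.C q * MvPolynomial.X (.x j)) fun m => by
      simpa using hReg_x_ne q hq m.2 i j

lemma upData_map_evalUp (m : hReg n d q) :
    (upData (d := d) hq).map (evalUp m) = ptData q m.1 := by
  simp only [LocalData.map, upData, ptData, LocalData.mk.injEq]
  refine ⟨rfl, rfl, funext fun i => funext fun j => ?_, funext fun i => funext fun j => ?_⟩
  · split_ifs
    · exact map_zero _
    · simp only [evalUp_fracUp, map_mul, map_add, map_sub, MvPolynomial.eval_C,
        MvPolynomial.eval_X]
      ring
  · simp only [evalUp_fracUp, map_mul, map_add, map_sub, MvPolynomial.eval_C, MvPolynomial.eval_X]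
    ring

lemma evNorm_C (c : ℂ) : evNorm (MvPolynomial.C c : MvPolynomial (Coord n d) ℂ)
    = algebraMap ℂ _ c := AlgHom.commutes _ _

lemma upData_map_toRat : (upData hq).map (toRat hd hq hne) = normData q := by
  have h2 : algebraMap ℂ (RatField n d) (1 / 2) = 1 / 2 := by
    rw [map_div₀, map_one, map_ofNat]
  have hX : ∀ i, evNorm (MvPolynomial.X (.x i) : MvPolynomial (Coord n d) ℂ) = xv i := fun i => by
    rw [evNorm, MvPolynomial.aeval_X]; rfl
  simp only [LocalData.map, upData, normData, LocalData.mk.injEq]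
  refine ⟨funext fun i => funext fun α => toRat_coordFn _ _ _ _,
    funext fun i => funext fun α => toRat_coordFn _ _ _ _,
    funext fun i => funext fun j => ?_, funext fun i => funext fun j => ?_⟩
  · simp only [rawData]
    split_ifs
    · exact map_zero _
    · simp only [toRat_fracUp, map_mul, map_add, map_sub, evNorm_C, hX, h2]
      ring
  · simp only [rawData, toRat_fracUp, map_mul, map_add, map_sub, evNorm_C, hX, h2, qv]
    ring

/-- The brackets of coordinates as regular functions. -/
noncomputable def upTable (c : ℂ) (z : SpinPair d → ℂ) : Coord n d → Coord n d → regUp n d q :=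
  (upData hq).pencilTable (fun i => coordFn q (.x i)) c (skewExt z)

lemma toRat_upTable (c : ℂ) (z : SpinPair d → ℂ) (u v : Coord n d) :
    toRat hd hq hne (upTable hq c z u v)
      = rawPencil q c z (toRat hd hq hne (coordFn q u)) (toRat hd hq hne (coordFn q v)) := by
  rw [toRat_coordFn, toRat_coordFn, rawPencil_normVar q hd, upTable, LocalData.map_pencilTable,
    upData_map_toRat]
  simp only [toRat_coordFn]
  rfl

lemma evalUp_upTable (c : ℂ) (z : SpinPair d → ℂ) (m : hReg n d q) (u v : Coord n d) :
    evalUp m (upTable hq c z u v)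
      = (ptData q m.1).pencilTable (fun i => m.1 (.x i)) c (skewExt z) u v := by
  rw [upTable, LocalData.map_pencilTable, upData_map_evalUp]
  rfl

/-- The unreduced pencil of brackets preserves `ℂ[h_reg]`. -/
lemma rawPencil_mem_range (c : ℂ) (z : SpinPair d → ℂ) (F G : regUp n d q) :
    ∃ H, toRat hd hq hne H = rawPencil q c z (toRat hd hq hne F) (toRat hd hq hne G) := by
  have hmul : ∀ F : regUp n d q, ∀ x ∈ (toRat hd hq hne).range.toSubmodule,
      toRat hd hq hne F * x ∈ (toRat hd hq hne).range.toSubmodule := by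
    rintro F _ ⟨H, rfl⟩
    exact ⟨F * H, map_mul _ _ _⟩
  have hB := rawPencil_skew (n := n) (d := d) q c z
  have h1 : ∀ (u : Coord n d) (G : regUp n d q),
      rawPencil q c z (toRat hd hq hne (coordFn q u)) (toRat hd hq hne G)
        ∈ (toRat hd hq hne).range.toSubmodule := by
    intro u G
    have hD : IsDerivationAlong (toRat hd hq hne)
        (rawPencil q c z (toRat hd hq hne (coordFn q u)) ∘ₗ (toRat hd hq hne).toLinearMap) := by
      intro F G
      simp only [LinearMap.comp_apply, AlgHom.toLinearMap_apply, map_mul]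
      rw [hB.2]
    exact hD.mem_of_generates coordFn_generates _ hmul
      (fun v => ⟨_, toRat_upTable hd hq hne c z u v⟩) G
  have hD : IsDerivationAlong (toRat hd hq hne)
      ((rawPencil q c z).flip (toRat hd hq hne G) ∘ₗ (toRat hd hq hne).toLinearMap) := by
    intro F F'
    simp only [LinearMap.comp_apply, AlgHom.toLinearMap_apply, map_mul, LinearMap.flip_apply]
    rw [hB.mul_left]
  exact hD.mem_of_generates coordFn_generates _ hmul (fun u => h1 u G) F

/-- The values of the bracket `c {-,-}_- + ψ_z` on `ℂ[h_reg]`. -/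
noncomputable def upBracketFun (c : ℂ) (z : SpinPair d → ℂ) (F G : regUp n d q) : regUp n d q :=
  (rawPencil_mem_range hd hq hne c z F G).choose

lemma toRat_upBracketFun (c : ℂ) (z : SpinPair d → ℂ) (F G : regUp n d q) :
    toRat hd hq hne (upBracketFun hd hq hne c z F G)
      = rawPencil q c z (toRat hd hq hne F) (toRat hd hq hne G) :=
  (rawPencil_mem_range hd hq hne c z F G).choose_spec

/-- The bracket `c {-,-}_- + ψ_z` on `ℂ[h_reg]`. -/
noncomputable def upBracket (c : ℂ) (z : SpinPair d → ℂ) : Bracket (regUp n d q) :=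
  LinearMap.mk₂ ℂ (upBracketFun hd hq hne c z)
    (fun F F' G => toRat_injective hd hq hne <| by
      simp only [map_add, LinearMap.add_apply, toRat_upBracketFun])
    (fun t F G => toRat_injective hd hq hne <| by
      simp only [map_smul, LinearMap.smul_apply, toRat_upBracketFun])
    (fun F G G' => toRat_injective hd hq hne <| by
      simp only [map_add, toRat_upBracketFun])
    (fun t F G => toRat_injective hd hq hne <| by
      simp only [map_smul, toRat_upBracketFun])

lemma toRat_upBracket (c : ℂ) (z : SpinPair d → ℂ) (F G : regUp n d q) :
    toRat hd hq hne (upBracket hd hq hne c z F G)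
      = rawPencil q c z (toRat hd hq hne F) (toRat hd hq hne G) :=
  toRat_upBracketFun hd hq hne c z F G

lemma upBracket_skew (c : ℂ) (z : SpinPair d → ℂ) :
    IsSkewBiderivation (upBracket (n := n) hd hq hne c z) := by
  have hB := rawPencil_skew (n := n) (d := d) q c z
  refine ⟨fun F G => toRat_injective hd hq hne ?_, fun F G H => toRat_injective hd hq hne ?_⟩
  · rw [map_neg, toRat_upBracket, toRat_upBracket, hB.1]
  · simp only [map_add, map_mul, toRat_upBracket, hB.2]

lemma upBracket_isPoisson (c : ℂ) (z : SpinPair d → ℂ) :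
    IsPoisson (upBracket (n := n) hd hq hne c z) := by
  refine isPoisson_iff.2 ⟨upBracket_skew hd hq hne c z, fun F G H =>
    toRat_injective hd hq hne ?_⟩
  have h := jacobiator_rawPencil q hq c z (fun p => euler_toRat hd hq hne p F)
    (fun p => euler_toRat hd hq hne p G) (fun p => euler_toRat hd hq hne p H)
  rw [jacobiator_apply] at h ⊢
  simp only [map_sub, toRat_upBracket, map_zero]
  exact h

lemma upBracket_coordFn (c : ℂ) (z : SpinPair d → ℂ) (u v : Coord n d) :
    upBracket hd hq hne c z (coordFn q u) (coordFn q v) = upTable hq c z u v :=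
  toRat_injective hd hq hne (by rw [toRat_upBracket, toRat_upTable])

end Embedding

/-! ### Descent to `h_reg / S_n` -/

section Descent

variable {n d : ℕ} {q : ℂ}

/-- The action of a permutation on `h_reg`. -/
def permPt (σ : Equiv.Perm (Fin n)) (m : hReg n d q) : hReg n d q :=
  ⟨fun c => m.1 (c.perm σ), fun i => m.2.1 (σ i),
    fun i j h => m.2.2.1 (σ i) (σ j) (σ.injective.ne h), fun i => m.2.2.2.1 (σ i), fun k hk => by
      have h : calZ q (fun c => m.1 (c.perm σ)) k = (calZ q m.1 k).submatrix σ σ := rfl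
      rw [h, Matrix.det_submatrix_equiv_self]
      exact m.2.2.2.2 k hk⟩

lemma mk_permPt (σ : Equiv.Perm (Fin n)) (m : hReg n d q) :
    (⟦permPt σ m⟧ : Phase n d q) = ⟦m⟧ :=
  (Quotient.sound ⟨σ, fun _ => rfl⟩ : (⟦m⟧ : Phase n d q) = ⟦permPt σ m⟧).symm

/-- The action of a permutation on regular functions on `h_reg`. -/
noncomputable def permUp (σ : Equiv.Perm (Fin n)) : regUp n d q →ₐ[ℂ] regUp n d q where
  toFun F := ⟨fun m => F.1 (permPt σ m), by
    obtain ⟨p, s, h⟩ := F.2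
    refine ⟨MvPolynomial.rename (Coord.perm σ) p, MvPolynomial.rename (Coord.perm σ) s,
      fun m => ?_⟩
    rw [MvPolynomial.eval_rename, MvPolynomial.eval_rename]
    exact h (permPt σ m)⟩
  map_one' := rfl
  map_mul' _ _ := rfl
  map_zero' := rfl
  map_add' _ _ := rfl
  commutes' _ := rfl

lemma evalUp_permUp (σ : Equiv.Perm (Fin n)) (m : hReg n d q) (F : regUp n d q) :
    evalUp m (permUp σ F) = evalUp (permPt σ m) F := rfl

lemma permUp_coordFn (σ : Equiv.Perm (Fin n)) (u : Coord n d) :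
    permUp σ (coordFn q u) = coordFn q (u.perm σ) := rfl

/-- The pullback of regular functions as an algebra homomorphism. -/
noncomputable def pullHom (q : ℂ) : reg n d q →ₐ[ℂ] regUp n d q where
  toFun := pull q
  map_one' := rfl
  map_mul' _ _ := rfl
  map_zero' := rfl
  map_add' _ _ := rfl
  commutes' _ := rfl

lemma pullHom_injective : Function.Injective (pullHom q : reg n d q → regUp n d q) := by
  intro F G h
  refine Subtype.ext (funext fun y => ?_)
  induction y using Quotient.inductionOn with
  | h m => exact congrFun (congrArg Subtype.val h) m

lemma permUp_pullHom (σ : Equiv.Perm (Fin n)) (F : reg n d q) :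
    permUp σ (pullHom q F) = pullHom q F :=
  regUp_ext fun m => congrArg F.1 (mk_permPt σ m)

lemma exists_pullHom {F : regUp n d q} (hF : ∀ σ, permUp σ F = F) : ∃ G, pullHom q G = F := by
  refine ⟨⟨Quotient.lift F.1 fun m m' h => ?_, ?_⟩, ?_⟩
  · obtain ⟨σ, h⟩ := h
    have h1 : m' = permPt σ m := Subtype.ext (funext h)
    rw [h1]
    exact (congrFun (congrArg Subtype.val (hF σ)) m).symm
  · exact F.2
  · rfl

namespace IsGivenBy

variable {T T' : (Coord n d → ℂ) → Coord n d → Coord n d → ℂ} {B B₁ : Bracket (reg n d q)}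

lemma unique (h : IsGivenBy T B) (h₁ : IsGivenBy T B₁) : B = B₁ := by
  obtain ⟨B', ⟨hs, hp⟩, hT⟩ := h
  obtain ⟨B₁', ⟨hs₁, hp₁⟩, hT₁⟩ := h₁
  have h : ∀ F G, B' F G = B₁' F G :=
    IsSkewBiderivation.ext_generates coordFn_generates hs.derivation_right hs₁.derivation_right
      hs.derivation_left hs₁.derivation_left fun u v => regUp_ext fun m =>
        (hT m u v).trans (hT₁ m u v).symm
  refine LinearMap.ext fun F => LinearMap.ext fun G => pullHom_injective ?_
  exact (hp F G).trans ((h _ _).trans (hp₁ F G).symm)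

lemma congr (h : IsGivenBy T B) (hT : ∀ m ∈ hReg n d q, ∀ u v, T m u v = T' m u v) :
    IsGivenBy T' B := by
  obtain ⟨B', hB, hT'⟩ := h
  exact ⟨B', hB, fun m u v => (hT' m u v).trans (hT m.1 m.2 u v)⟩

lemma add (h : IsGivenBy T B) (h₁ : IsGivenBy T' B₁) :
    IsGivenBy (fun m u v => T m u v + T' m u v) (B + B₁) := by
  obtain ⟨B', ⟨hs, hp⟩, hT⟩ := h
  obtain ⟨B₁', ⟨hs₁, hp₁⟩, hT₁⟩ := h₁
  refine ⟨B' + B₁', ⟨hs.add hs₁, fun F G => ?_⟩, fun m u v =>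
    congrArg₂ (· + ·) (hT m u v) (hT₁ m u v)⟩
  exact congrArg₂ (· + ·) (hp F G) (hp₁ F G)

lemma smul (h : IsGivenBy T B) (c : ℂ) : IsGivenBy (fun m u v => c * T m u v) (c • B) := by
  obtain ⟨B', ⟨hs, hp⟩, hT⟩ := h
  refine ⟨c • B', ⟨hs.smul c, fun F G => ?_⟩, fun m u v => congrArg (c * ·) (hT m u v)⟩
  exact congrArg (c • ·) (hp F G)

lemma iff_eq (h : IsGivenBy T B) (B₁ : Bracket (reg n d q)) : IsGivenBy T B₁ ↔ B₁ = B :=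
  ⟨fun h₁ => h₁.unique h, fun e => e ▸ h⟩

end IsGivenBy

lemma skewExt_add (z z' : SpinPair d → ℂ) (α β : Fin d) :
    skewExt (z + z') α β = skewExt z α β + skewExt z' α β := by
  unfold skewExt
  split_ifs <;> simp [add_comm]

lemma skewExt_smul (c : ℂ) (z : SpinPair d → ℂ) (α β : Fin d) :
    skewExt (c • z) α β = c * skewExt z α β := by
  unfold skewExt
  split_ifs <;> simp

lemma gFun_add (z z' : SpinPair d → ℂ) (m : Coord n d → ℂ) (i j : Fin n) (α β : Fin d) :
    gFun (z + z') m i j α β = gFun z m i j α β + gFun z' m i j α β := by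
  simp only [gFun, skewExt_add, add_mul, Finset.sum_add_distrib, Finset.sum_sub_distrib]
  ring

lemma gFun_smul (c : ℂ) (z : SpinPair d → ℂ) (m : Coord n d → ℂ) (i j : Fin n) (α β : Fin d) :
    gFun (c • z) m i j α β = c * gFun z m i j α β := by
  simp only [gFun, skewExt_smul, mul_add, Finset.mul_sum, mul_sub, mul_assoc]

lemma psiTable_add (z z' : SpinPair d → ℂ) (m : Coord n d → ℂ) (u v : Coord n d) :
    psiTable (z + z') m u v = psiTable z m u v + psiTable z' m u v := by
  cases u <;> cases v <;> simp only [psiTable, table, gFun_add, zero_mul, ite_self, neg_zero,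
    add_zero] <;> ring

lemma psiTable_smul (c : ℂ) (z : SpinPair d → ℂ) (m : Coord n d → ℂ) (u v : Coord n d) :
    psiTable (c • z) m u v = c * psiTable z m u v := by
  cases u <;> cases v <;> simp only [psiTable, table, gFun_smul, zero_mul, ite_self, neg_zero,
    mul_zero] <;> ring

variable (hd : 0 < d) (hq : q ≠ 1) (hne : (hReg n d q).Nonempty)

lemma evalUp_upBracket_coordFn (c : ℂ) (z : SpinPair d → ℂ) (m : hReg n d q) (u v : Coord n d) :
    evalUp m (upBracket hd hq hne c z (coordFn q u) (coordFn q v))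
      = c * aoTable q m.1 u v + psiTable z m.1 u v := by
  rw [upBracket_coordFn, evalUp_upTable, aoTable_eq q hq m.2, psiTable_eq q]
  have h : ∀ i j α β, (ptData q m.1).twist 0 i j α β = 0 := by simp [LocalData.twist]
  simp only [LocalData.pencilTable, Pi.add_apply, Pi.smul_apply, smul_eq_mul, one_mul, zero_mul,
    zero_add]
  have h0 : assemble (0 : Fin n → ℂ) (ptData q m.1).b
      (fun i j α β => (ptData q m.1).twist 0 i j α β
        * ((ptData q m.1).a i α * (ptData q m.1).a j β))
      (fun i j α β => -((ptData q m.1).twist 0 i j α β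
        * ((ptData q m.1).a i α * (ptData q m.1).b j β)))
      (fun i j α β => (ptData q m.1).twist 0 i j α β
        * ((ptData q m.1).b i α * (ptData q m.1).b j β)) u v = 0 := by
    cases u <;> cases v <;> simp [assemble, h]
  rw [h0, add_zero]

/-- The local brackets commute with permutations. -/
lemma permUp_upBracket (c : ℂ) (z : SpinPair d → ℂ) (σ : Equiv.Perm (Fin n))
    (F G : regUp n d q) : permUp σ (upBracket hd hq hne c z F G)
      = upBracket hd hq hne c z (permUp σ F) (permUp σ G) := by
  have hB := upBracket_skew (n := n) hd hq hne c z
  let P : regUp n d q →ₗ[ℂ] regUp n d q →ₗ[ℂ] regUp n d q :=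
    (upBracket hd hq hne c z).compr₂ (permUp σ).toLinearMap
  let Q : regUp n d q →ₗ[ℂ] regUp n d q →ₗ[ℂ] regUp n d q :=
    (upBracket hd hq hne c z).compl₁₂ (permUp σ).toLinearMap (permUp σ).toLinearMap
  refine IsSkewBiderivation.ext_generates (φ := permUp σ) (P := P) (Q := Q) coordFn_generates
    ?_ ?_ ?_ ?_ ?_ F G
  · intro F G H
    change permUp σ (upBracket hd hq hne c z F (G * H)) = _
    rw [hB.2, map_add, map_mul, map_mul]; rfl
  · intro F G H
    change upBracket hd hq hne c z (permUp σ F) (permUp σ (G * H)) = _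
    rw [map_mul, hB.2]; rfl
  · intro H F G
    change permUp σ (upBracket hd hq hne c z (F * G) H) = _
    rw [hB.mul_left, map_add, map_mul, map_mul]; rfl
  · intro H F G
    change upBracket hd hq hne c z (permUp σ (F * G)) (permUp σ H) = _
    rw [map_mul, hB.mul_left]; rfl
  · intro u v
    refine regUp_ext fun m => ?_
    change evalUp m (permUp σ (upBracket hd hq hne c z (coordFn q u) (coordFn q v)))
      = evalUp m (upBracket hd hq hne c z (permUp σ (coordFn q u)) (permUp σ (coordFn q v)))
    rw [evalUp_permUp, permUp_coordFn, permUp_coordFn, evalUp_upBracket_coordFn,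
      evalUp_upBracket_coordFn, ← aoTable_perm, ← psiTable_perm]
    rfl

lemma exists_downBracket (c : ℂ) (z : SpinPair d → ℂ) (F G : reg n d q) :
    ∃ H, pullHom q H = upBracket hd hq hne c z (pullHom q F) (pullHom q G) :=
  exists_pullHom fun σ => by rw [permUp_upBracket, permUp_pullHom, permUp_pullHom]

/-- The values of the bracket `c {-,-}_- + ψ_z` on `h_reg / S_n`. -/
noncomputable def downBracketFun (c : ℂ) (z : SpinPair d → ℂ) (F G : reg n d q) : reg n d q :=
  (exists_downBracket hd hq hne c z F G).choose

lemma pullHom_downBracketFun (c : ℂ) (z : SpinPair d → ℂ) (F G : reg n d q) :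
    pullHom q (downBracketFun hd hq hne c z F G)
      = upBracket hd hq hne c z (pullHom q F) (pullHom q G) :=
  (exists_downBracket hd hq hne c z F G).choose_spec

/-- The bracket `c {-,-}_- + ψ_z` on `h_reg / S_n`. -/
noncomputable def downBracket (c : ℂ) (z : SpinPair d → ℂ) : Bracket (reg n d q) :=
  LinearMap.mk₂ ℂ (downBracketFun hd hq hne c z)
    (fun F F' G => pullHom_injective <| by
      simp only [map_add, LinearMap.add_apply, pullHom_downBracketFun])
    (fun t F G => pullHom_injective <| by
      simp only [map_smul, LinearMap.smul_apply, pullHom_downBracketFun])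
    (fun F G G' => pullHom_injective <| by
      simp only [map_add, pullHom_downBracketFun])
    (fun t F G => pullHom_injective <| by
      simp only [map_smul, pullHom_downBracketFun])

lemma pullHom_downBracket (c : ℂ) (z : SpinPair d → ℂ) (F G : reg n d q) :
    pullHom q (downBracket hd hq hne c z F G)
      = upBracket hd hq hne c z (pullHom q F) (pullHom q G) :=
  pullHom_downBracketFun hd hq hne c z F G

lemma downBracket_localForm (c : ℂ) (z : SpinPair d → ℂ) :
    IsLocalForm (downBracket (n := n) hd hq hne c z) (upBracket hd hq hne c z) :=
  ⟨upBracket_skew hd hq hne c z, pullHom_downBracket hd hq hne c z⟩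

lemma downBracket_isPoisson (c : ℂ) (z : SpinPair d → ℂ) :
    IsPoisson (downBracket (n := n) hd hq hne c z) := by
  obtain ⟨⟨h1, h2⟩, h3⟩ := upBracket_isPoisson (n := n) hd hq hne c z
  refine ⟨⟨fun F G => pullHom_injective ?_, fun F G H => pullHom_injective ?_⟩,
    fun F G H => pullHom_injective ?_⟩
  · rw [map_neg, pullHom_downBracket, pullHom_downBracket, h1]
  · simp only [map_add, map_mul, pullHom_downBracket, h2]
  · simp only [map_add, map_zero, pullHom_downBracket, h3]

lemma downBracket_isGivenBy (c : ℂ) (z : SpinPair d → ℂ) :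
    IsGivenBy (fun m u v => c * aoTable q m u v + psiTable z m u v)
      (downBracket (n := n) hd hq hne c z) :=
  ⟨upBracket hd hq hne c z, downBracket_localForm hd hq hne c z,
    evalUp_upBracket_coordFn hd hq hne c z⟩

/-- The minus bracket of Arutyunov and Olivucci. -/
noncomputable def brMinus : Bracket (reg n d q) := downBracket hd hq hne 1 0

lemma psiTable_zero (m : Coord n d → ℂ) (u v : Coord n d) : psiTable 0 m u v = 0 := by
  have h := psiTable_smul 0 0 m u v
  rwa [zero_smul, zero_mul] at h

lemma brMinus_isGivenBy : IsGivenBy (aoTable q) (brMinus (n := n) hd hq hne) :=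
  (downBracket_isGivenBy hd hq hne 1 0).congr fun m _ u v => by
    rw [one_mul, psiTable_zero, add_zero]

lemma downBracket_zero_isGivenBy (z : SpinPair d → ℂ) :
    IsGivenBy (psiTable z) (downBracket (n := n) hd hq hne 0 z) :=
  (downBracket_isGivenBy hd hq hne 0 z).congr fun m _ u v => by rw [zero_mul, zero_add]

/-- The brackets `ψ_z`, linear in `z`. -/
noncomputable def psi : (SpinPair d → ℂ) →ₗ[ℂ] Bracket (reg n d q) where
  toFun z := downBracket hd hq hne 0 z
  map_add' z z' := (downBracket_zero_isGivenBy hd hq hne (z + z')).unique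
    (((downBracket_zero_isGivenBy hd hq hne z).add (downBracket_zero_isGivenBy hd hq hne z')).congr
      fun m _ u v => (psiTable_add z z' m u v).symm)
  map_smul' c z := (downBracket_zero_isGivenBy hd hq hne (c • z)).unique
    (((downBracket_zero_isGivenBy hd hq hne z).smul c).congr
      fun m _ u v => (psiTable_smul c z m u v).symm)

lemma psi_isGivenBy (z : SpinPair d → ℂ) : IsGivenBy (psiTable z) (psi (n := n) hd hq hne z) :=
  downBracket_zero_isGivenBy hd hq hne z

lemma downBracket_eq (c : ℂ) (z : SpinPair d → ℂ) :
    downBracket (n := n) hd hq hne c z = c • brMinus hd hq hne + psi hd hq hne z :=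
  (downBracket_isGivenBy hd hq hne c z).unique
    (((brMinus_isGivenBy hd hq hne).smul c).add (psi_isGivenBy hd hq hne z))

/-- The bracket of Chalykh and Fairon. -/
noncomputable def brZero : Bracket (reg n d q) := downBracket hd hq hne 1 fun _ => -(1 / 2)

lemma brZero_isGivenBy : IsGivenBy (cfTable q) (brZero (n := n) hd hq hne) :=
  (downBracket_isGivenBy hd hq hne 1 _).congr fun m hm u v => by
    have h : (fun _ : SpinPair d => (-(1 / 2) : ℂ)) = (-1 : ℂ) • fun _ => 1 / 2 := by
      funext p; simp
    rw [cfTable_eq q hm, h, psiTable_smul]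
    ring

lemma brMinus_eq : brMinus (n := n) hd hq hne
    = brZero hd hq hne + psi hd hq hne fun _ => 1 / 2 := by
  rw [brZero, downBracket_eq, one_smul, add_assoc, ← map_add]
  have h : ((fun _ => -(1 / 2) : SpinPair d → ℂ) + fun _ => 1 / 2) = 0 := by
    funext p; simp
  rw [h, map_zero, add_zero]

/-- The members of the pencil spanned by `{-,-}_0` and the `ψ_z`. -/
lemma smul_brZero_add_psi (c : ℂ) (z : SpinPair d → ℂ) :
    c • brZero (n := n) hd hq hne + psi hd hq hne z
      = downBracket hd hq hne c (z - c • fun _ => 1 / 2) := by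
  rw [downBracket_eq, brMinus_eq, smul_add, add_assoc, ← map_smul, ← map_add, add_sub_cancel]

lemma smul_brZero_add_psi_isPoisson (c : ℂ) (z : SpinPair d → ℂ) :
    IsPoisson (c • brZero (n := n) hd hq hne + psi hd hq hne z) := by
  rw [smul_brZero_add_psi]
  exact downBracket_isPoisson hd hq hne c _

lemma pencil_isPoissonPencil : IsPoissonPencil (pencil (brZero (n := n) hd hq hne)
    (psi hd hq hne)) := by
  intro c
  have h : (c.sum fun j z => z • pencil (brZero (n := n) hd hq hne) (psi hd hq hne) j)
      = c none • brZero hd hq hne + psi hd hq hne fun p => c (some p) := by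
    rw [Finsupp.sum_fintype _ (fun j z => z • pencil (brZero (n := n) hd hq hne) (psi hd hq hne) j)
      (fun j => zero_smul ℂ _), Fintype.sum_option]
    congr 1
    have h1 : (fun p => c (some p)) = ∑ p : SpinPair d, c (some p) • Pi.single p (1 : ℂ) := by
      funext p
      simp [Finset.sum_apply, Pi.single_apply]
    rw [h1, map_sum]
    simp [pencil]
  rw [h]
  exact smul_brZero_add_psi_isPoisson hd hq hne _ _

lemma smul_add_smul_isPoisson (s t : ℂ) :
    IsPoisson (s • brZero (n := n) hd hq hne + t • brMinus hd hq hne) := by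
  rw [brMinus_eq, smul_add, ← add_assoc, ← add_smul, ← map_smul]
  exact smul_brZero_add_psi_isPoisson hd hq hne _ _

end Descent

/-! ### The equations of motion -/

namespace LocalData

variable {n d : ℕ} {A : Type*} [CommRing A] [Algebra ℂ A] (L : LocalData A n d)

lemma sum_rawAA_rawAB (i k : Fin n) (α : Fin d) :
    ∑ β, (L.rawAA i k α β * L.b k β + L.a k β * L.rawAB i k α β)
      = (L.r i k - L.s i k) * (∑ β, L.a i β * L.b k β) * L.a k α := by
  have h : ∑ β, L.a k β * L.rawAB i k α β = ∑ β, -(L.a k α *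
      ((L.s i k + halfSign A β α) * (L.a i β * L.b k β))) := by
    simp only [rawAB, mul_ite, mul_zero, Finset.sum_ite_eq, Finset.mem_univ, if_true, pairing,
      Finset.sum_neg_distrib, ← Finset.mul_sum, mul_neg]
  rw [Finset.sum_add_distrib, h, ← Finset.sum_add_distrib, Finset.mul_sum, Finset.sum_mul]
  exact Finset.sum_congr rfl fun β _ => by rw [rawAA]; ring

lemma sum_rawAB_rawBB (i k : Fin n) (α : Fin d) :
    ∑ β, (L.a k β * L.rawBB i k α β - L.b k β * L.rawAB k i β α)
      = (L.r i k + L.s k i) * (∑ β, L.a k β * L.b i β) * L.b k α := by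
  have h : ∑ β, L.b k β * L.rawAB k i β α = ∑ β, -(L.b k α *
      ((L.s k i + halfSign A β α) * (L.a k β * L.b i β))) := by
    simp only [rawAB, mul_ite, mul_zero, Finset.sum_ite_eq', Finset.mem_univ, if_true, pairing,
      Finset.sum_neg_distrib, ← Finset.mul_sum, mul_neg]
  rw [Finset.sum_sub_distrib, h, ← Finset.sum_sub_distrib, Finset.mul_sum, Finset.sum_mul]
  exact Finset.sum_congr rfl fun β _ => by rw [rawBB]; ring

/-- The bracket of `a_i^α` with `∑_β a_k^β b_k^β`. -/
lemma sum_redAA_redAB (hs : ∀ i, ∑ α, L.a i α = 1) (i k : Fin n) (α : Fin d) :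
    ∑ β, (L.redAA i k α β * L.b k β + L.a k β * L.redAB i k α β)
      = (L.r i k - L.s i k) * (∑ β, L.a i β * L.b k β) * (L.a k α - L.a i α) := by
  have h : ∀ β, L.redAA i k α β * L.b k β + L.a k β * L.redAB i k α β
      = (L.rawAA i k α β * L.b k β + L.a k β * L.rawAB i k α β)
        - L.a i α * ∑ δ, (L.rawAA i k δ β * L.b k β + L.a k β * L.rawAB i k δ β) := fun β => by
    simp only [redAA, redAB, Finset.sum_sub_distrib, Finset.sum_add_distrib, ← Finset.mul_sum,
      ← Finset.sum_mul]
    ring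
  simp only [h, Finset.sum_sub_distrib, ← Finset.mul_sum]
  rw [Finset.sum_comm]
  simp only [sum_rawAA_rawAB, ← Finset.mul_sum, hs]
  ring

/-- The bracket of `b_i^α` with `∑_β a_k^β b_k^β`. -/
lemma sum_redAB_redBB (hs : ∀ i, ∑ α, L.a i α = 1) (hr : ∀ i j, L.r i j = -L.r j i)
    (i k : Fin n) (α : Fin d) :
    ∑ β, (-L.redAB k i β α * L.b k β + L.a k β * L.redBB i k α β)
      = (L.r i k - L.s i k) * (∑ β, L.a i β * L.b k β) * L.b i α
        - (L.r k i - L.s k i) * (∑ β, L.a k β * L.b i β) * L.b k α := by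
  have hskew : ∀ β ε, L.rawAA k i β ε = -L.rawAA i k ε β := fun β ε => by
    rw [rawAA, rawAA, hr, halfSign_skew]; ring
  have h : ∀ β, -L.redAB k i β α * L.b k β + L.a k β * L.redBB i k α β
      = (L.a k β * L.rawBB i k α β - L.b k β * L.rawAB k i β α)
        + L.b i α * ∑ δ, (L.rawAA i k δ β * L.b k β + L.a k β * L.rawAB i k δ β) := fun β => by
    have h2 : ∑ δ, ∑ ε, L.rawAA i k ε δ = ∑ δ, ∑ ε, L.rawAA i k δ ε := Finset.sum_comm
    simp only [redBB, redAB, Finset.sum_add_distrib, ← Finset.mul_sum,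
      ← Finset.sum_mul, hskew, Finset.sum_neg_distrib, h2]
    ring
  rw [Finset.sum_congr rfl fun β _ => h β, Finset.sum_add_distrib, sum_rawAB_rawBB,
    ← Finset.mul_sum, Finset.sum_comm]
  simp only [sum_rawAA_rawAB, ← Finset.mul_sum, hs]
  rw [hr i k]
  ring

lemma twist_skew {z : Fin d → Fin d → ℂ} (hz : ∀ μ ν, z μ ν = -z ν μ) (i j : Fin n)
    (α β : Fin d) : L.twist z i j α β = -L.twist z j i β α := by
  rw [twist, twist, Finset.sum_comm, ← Finset.sum_neg_distrib]
  refine Finset.sum_congr rfl fun μ _ => ?_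
  rw [← Finset.sum_neg_distrib]
  refine Finset.sum_congr rfl fun ν _ => ?_
  rw [hz, neg_smul, mul_comm]

/-- The bracket of a coordinate with the Hamiltonian `∑_k ∑_β a_k^β b_k^β`; the brackets `ψ_z` do
not contribute. -/
lemma sum_pencilTable (hs : ∀ i, ∑ α, L.a i α = 1) (hr : ∀ i j, L.r i j = -L.r j i)
    (x : Fin n → A) (c : ℂ) {z : Fin d → Fin d → ℂ} (hz : ∀ μ ν, z μ ν = -z ν μ)
    (u : Coord n d) :
    ∑ k, ∑ β, (L.pencilTable x c z u (.a k β) * L.b k β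
        + L.a k β * L.pencilTable x c z u (.b k β))
      = c • match u with
        | .x i => x i * ∑ β, L.a i β * L.b i β
        | .a i α => ∑ k, (L.r i k - L.s i k) * (∑ β, L.a i β * L.b k β) * (L.a k α - L.a i α)
        | .b i α => ∑ k, ((L.r i k - L.s i k) * (∑ β, L.a i β * L.b k β) * L.b i α
            - (L.r k i - L.s k i) * (∑ β, L.a k β * L.b i β) * L.b k α) := by
  rcases u with i | ⟨i, α⟩ | ⟨i, α⟩
  · simp only [pencilTable, assemble, Pi.add_apply, Pi.smul_apply, smul_zero, add_zero, zero_mul,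
      ite_self, Pi.zero_apply, zero_add]
    rw [Finset.sum_eq_single i (fun k _ hk => by simp [hk.symm]) (by simp), Finset.mul_sum,
      Finset.smul_sum]
    refine Finset.sum_congr rfl fun β _ => ?_
    rw [if_pos rfl, mul_smul_comm]
    congr 1
    ring
  · rw [Finset.smul_sum]
    refine Finset.sum_congr rfl fun k _ => ?_
    rw [← L.sum_redAA_redAB hs, Finset.smul_sum]
    refine Finset.sum_congr rfl fun β _ => ?_
    simp only [pencilTable, assemble, Pi.add_apply, Pi.smul_apply]
    simp only [Algebra.smul_def]
    ring
  · rw [Finset.smul_sum]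
    refine Finset.sum_congr rfl fun k _ => ?_
    rw [← L.sum_redAB_redBB hs hr, Finset.smul_sum]
    refine Finset.sum_congr rfl fun β _ => ?_
    simp only [pencilTable, assemble, Pi.add_apply, Pi.smul_apply]
    simp only [Algebra.smul_def, L.twist_skew hz k i]
    ring

end LocalData

section Hamiltonian

variable {n d : ℕ} {q : ℂ}

/-- Half of the Hamiltonian, as a function on `h_reg`. -/
noncomputable def traceUp : regUp n d q := ∑ i, ∑ α, coordFn q (.a i α) * coordFn q (.b i α)

lemma evalUp_traceUp (m : hReg n d q) : evalUp m traceUp = ∑ i, f m.1 i i := by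
  simp only [traceUp, map_sum, map_mul, evalUp_coordFn, f]

/-- Sums over all particles are symmetric functions. -/
lemma exists_pullHom_sum (g : Fin n → regUp n d q) (hg : ∀ σ i, permUp σ (g i) = g (σ i)) :
    ∃ G, pullHom q G = ∑ i, g i :=
  exists_pullHom fun σ => by rw [map_sum]; simp only [hg]; exact Equiv.sum_comp σ g

lemma exists_hamiltonian : ∃ h : reg n d q, pullHom q h = (2 : ℂ) • traceUp := by
  obtain ⟨G, hG⟩ := exists_pullHom_sum (q := q)
    (fun i : Fin n => ∑ α : Fin d, coordFn q (.a i α) * coordFn q (.b i α)) fun σ i => by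
      simp only [map_sum, map_mul, permUp_coordFn, Coord.perm]
  exact ⟨(2 : ℂ) • G, by rw [map_smul, hG]; rfl⟩

/-- The Hamiltonian `2 ∑_i f_{ii}`. -/
noncomputable def hamiltonian : reg n d q := exists_hamiltonian.choose

lemma pullHom_hamiltonian : pullHom q (hamiltonian : reg n d q) = (2 : ℂ) • traceUp :=
  exists_hamiltonian.choose_spec

lemma hamiltonian_eq (m : hReg n d q) :
    (hamiltonian : reg n d q).1 ⟦m⟧ = 2 * ∑ i, f m.1 i i := by
  have h := congrArg (evalUp m) (pullHom_hamiltonian (n := n) (d := d) (q := q))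
  rwa [map_smul, evalUp_traceUp] at h

lemma sum_f_eq_trace (hq0 : q ≠ 0) (hq : q ≠ 1) (m : hReg n d q) :
    2 * ∑ i, f m.1 i i = 2 * (q⁻¹ - 1) * (Z q m.1).trace := by
  rw [Matrix.trace, mul_assoc]
  congr 1
  rw [Finset.mul_sum]
  refine Finset.sum_congr rfl fun i _ => ?_
  have h1 : (1 : ℂ) - q ≠ 0 := sub_ne_zero.2 hq.symm
  rw [Matrix.diag_apply, Z, Matrix.of_apply, mul_inv_cancel₀ (m.2.1 i)]
  field_simp

variable (hd : 0 < d) (hq : q ≠ 1) (hne : (hReg n d q).Nonempty)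

lemma evalUp_upBracket_traceUp (c : ℂ) (z : SpinPair d → ℂ) (m : hReg n d q) (u : Coord n d) :
    2 * evalUp m (upBracket hd hq hne c z (coordFn q u) traceUp) = c * rsField q m.1 u := by
  have hB := upBracket_skew (n := n) hd hq hne c z
  have h := (ptData q m.1).sum_pencilTable m.2.2.2.1 (ptData_r_skew q m.1) (fun i => m.1 (.x i)) c
    (skewExt_skew z) u
  have h1 : evalUp m (upBracket hd hq hne c z (coordFn q u) traceUp)
      = ∑ k, ∑ β, ((ptData q m.1).pencilTable (fun i => m.1 (.x i)) c (skewExt z) u (.a k β)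
          * (ptData q m.1).b k β + (ptData q m.1).a k β
          * (ptData q m.1).pencilTable (fun i => m.1 (.x i)) c (skewExt z) u (.b k β)) := by
    simp only [traceUp, map_sum, hB.2, map_add, map_mul, upBracket_coordFn, evalUp_upTable,
      evalUp_coordFn]
    exact Finset.sum_congr rfl fun k _ => Finset.sum_congr rfl fun β _ => add_comm _ _
  have hV : ∀ i k, i ≠ k → V q m.1 i k = 2 * ((ptData q m.1).r i k - (ptData q m.1).s i k) :=
    fun i k hik => by simp only [V, ptData, hik, if_false]; ring
  rw [h1, h, smul_eq_mul, mul_left_comm]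
  congr 1
  rcases u with i | ⟨i, α⟩ | ⟨i, α⟩
  · simp only [rsField, f, ptData]; ring
  · simp only [rsField]
    rw [Finset.mul_sum, Finset.sum_filter]
    refine Finset.sum_congr rfl fun k _ => ?_
    by_cases hk : k = i
    · subst hk; simp
    · rw [if_pos hk, hV i k (Ne.symm hk)]
      change _ = _ * (∑ β, (ptData q m.1).a i β * (ptData q m.1).b k β)
        * ((ptData q m.1).a k α - (ptData q m.1).a i α)
      ring
  · simp only [rsField]
    rw [Finset.mul_sum, Finset.sum_filter]
    refine Finset.sum_congr rfl fun k _ => ?_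
    by_cases hk : k = i
    · subst hk; simp
    · rw [if_pos hk, hV i k (Ne.symm hk), hV k i hk]
      change _ = _ * (∑ β, (ptData q m.1).a i β * (ptData q m.1).b k β) * (ptData q m.1).b i α
        - _ * (∑ β, (ptData q m.1).a k β * (ptData q m.1).b i β) * (ptData q m.1).b k α
      ring

lemma generatesRS_downBracket {c : ℂ} (hc : c ≠ 0) (z : SpinPair d → ℂ) :
    GeneratesRS (downBracket (n := n) hd hq hne c z) (c⁻¹ • hamiltonian) := by
  refine ⟨upBracket hd hq hne c z, downBracket_localForm hd hq hne c z, fun m u => ?_⟩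
  change evalUp m (upBracket hd hq hne c z (coordFn q u) (pullHom q (c⁻¹ • hamiltonian))) = _
  rw [map_smul, pullHom_hamiltonian, map_smul, map_smul, map_smul, map_smul, smul_eq_mul,
    smul_eq_mul, evalUp_upBracket_traceUp, inv_mul_cancel_left₀ hc]

end Hamiltonian

/-! ### A point of `h_reg` -/

section SpecialPoint

open Polynomial in
/-- Cauchy matrices with distinct nodes are non-degenerate: a vector in the kernel is the list of
coefficients in the Lagrange basis of a polynomial with too many roots. -/
lemma det_cauchy_ne_zero {K ι : Type*} [Field K] [Fintype ι] [DecidableEq ι] {x y : ι → K}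
    (hx : Function.Injective x) (hy : Function.Injective y) (hxy : ∀ i j, x i ≠ y j) :
    (Matrix.of fun i j => (x i - y j)⁻¹).det ≠ 0 := by
  intro h
  obtain ⟨v, hv, hv0⟩ := Matrix.exists_mulVec_eq_zero_iff.2 h
  let P : K[X] := ∑ j, C (v j) * ∏ k ∈ Finset.univ.erase j, (X - C (y k))
  have hroot : ∀ i, P.eval (x i) = 0 := fun i => by
    have h1 : P.eval (x i) = (∏ k, (x i - y k)) * ∑ j, (x i - y j)⁻¹ * v j := by
      simp only [P, eval_finsetSum, eval_mul, eval_C, eval_prod, eval_sub, eval_X, Finset.mul_sum]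
      refine Finset.sum_congr rfl fun j _ => ?_
      rw [← Finset.mul_prod_erase _ _ (Finset.mem_univ j)]
      have := sub_ne_zero.2 (hxy i j)
      field_simp
    rw [h1]
    have h2 : ∑ j, (x i - y j)⁻¹ * v j = 0 := congrFun hv0 i
    rw [h2, mul_zero]
  have hdeg : P.degree < Fintype.card ι := by
    refine (degree_sum_le _ _).trans_lt ((Finset.sup_lt_iff ?_).2 fun j _ => ?_)
    · exact WithBot.bot_lt_coe _
    · rw [C_mul']
      refine (degree_smul_le _ _).trans_lt ?_
      rw [degree_prod]
      simp only [degree_X_sub_C, Finset.sum_const, nsmul_one, Finset.card_erase_of_mem,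
        Finset.mem_univ, Finset.card_univ]
      have : 0 < Fintype.card ι := Fintype.card_pos_iff.2 ⟨j⟩
      exact_mod_cast Nat.sub_lt this one_pos
  have hP : P = 0 := by
    refine eq_zero_of_degree_lt_of_eval_finset_eq_zero (Finset.univ.map ⟨x, hx⟩) ?_ ?_
    · simpa using hdeg
    · simpa using hroot
  refine hv (funext fun j => ?_)
  have h1 : P.eval (y j) = v j * ∏ k ∈ Finset.univ.erase j, (y j - y k) := by
    simp only [P, eval_finsetSum, eval_mul, eval_C, eval_prod, eval_sub, eval_X]
    refine Finset.sum_eq_single j (fun i _ hij => ?_) (by simp)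
    rw [Finset.prod_eq_zero (Finset.mem_erase.2 ⟨hij.symm, Finset.mem_univ j⟩) (sub_self _),
      mul_zero]
  rw [hP, eval_zero] at h1
  refine (mul_eq_zero.1 h1.symm).resolve_right (Finset.prod_ne_zero_iff.2 fun k hk => ?_)
  exact sub_ne_zero.2 (hy.ne (Finset.ne_of_mem_erase hk).symm)

variable {n d : ℕ} {q : ℂ}

/-- The positions `x_i` can be chosen as the powers of a large number. -/
lemma exists_positions (n : ℕ) (hq0 : q ≠ 0) : ∃ x : Fin n → ℂ, (∀ i, x i ≠ 0) ∧
    Function.Injective x ∧ ∀ i j, i ≠ j → x i ≠ q * x j := by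
  obtain ⟨t, ht⟩ : ∃ t : ℝ, t > 1 + ‖q‖ + ‖q‖⁻¹ := exists_gt _
  have hq1 : 0 < ‖q‖ := norm_pos_iff.2 hq0
  have hq2 : 0 < ‖q‖⁻¹ := inv_pos.2 hq1
  have ht1 : 1 < t := by linarith
  have ht0 : 0 < t := by linarith
  have hinj : Function.Injective fun i : Fin n => ((t ^ (i : ℕ) : ℝ) : ℂ) := fun i j h =>
    Fin.ext (pow_right_injective₀ ht0 ht1.ne' (Complex.ofReal_injective h))
  refine ⟨fun i => ((t ^ (i : ℕ) : ℝ) : ℂ), fun i => ?_, hinj, fun i j hij h => ?_⟩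
  · exact Complex.ofReal_ne_zero.2 (pow_pos ht0 _).ne'
  · have h1 : t ^ (i : ℕ) = ‖q‖ * t ^ (j : ℕ) := by
      have := congrArg norm h
      simpa [abs_of_pos ht0] using this
    rcases lt_or_gt_of_ne (fun e => hij (Fin.ext e) : (i : ℕ) ≠ j) with hlt | hlt
    · have h2 : t ^ (i : ℕ) * t ≤ t ^ (j : ℕ) := by
        rw [← pow_succ]; exact pow_le_pow_right₀ ht1.le hlt
      have h3 : 1 < ‖q‖ * t := by
        have : ‖q‖ * ‖q‖⁻¹ = 1 := mul_inv_cancel₀ hq1.ne'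
        nlinarith
      have h4 := pow_pos ht0 (i : ℕ)
      have h5 := mul_le_mul_of_nonneg_left h2 hq1.le
      nlinarith
    · have h2 : t ^ (j : ℕ) * t ≤ t ^ (i : ℕ) := by
        rw [← pow_succ]; exact pow_le_pow_right₀ ht1.le hlt
      have h4 := pow_pos ht0 (j : ℕ)
      nlinarith

/-- There is a point of `h_reg` at which the vectors `a_i` are all equal to `(1/d, …, 1/d)` and
the vectors `b_i` to `(1, 0, …, 0)`; the matrices `𝒵_k` are then Cauchy matrices up to
rescaling. -/
lemma exists_mem_hReg (hd : 0 < d) (hq0 : q ≠ 0) (hq : q ≠ 1) : ∃ m ∈ hReg n d q,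
    (∀ i α, m (.a i α) = (d : ℂ)⁻¹) ∧ ∀ i, m (.b i ⟨0, hd⟩) = 1 := by
  obtain ⟨x, hx0, hx, hxq⟩ := exists_positions n hq0
  let m : Coord n d → ℂ
    | .x i => x i
    | .a _ _ => (d : ℂ)⁻¹
    | .b _ α => if α = ⟨0, hd⟩ then 1 else 0
  have hd0 : (d : ℂ) ≠ 0 := by exact_mod_cast hd.ne'
  have hxq' : ∀ i j, x i ≠ q * x j := fun i j h => by
    by_cases hij : i = j
    · subst hij
      exact hq (mul_right_cancel₀ (hx0 i) (by rw [← h, one_mul]))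
    · exact hxq i j hij h
  have hf : ∀ i j, f m i j = (d : ℂ)⁻¹ := fun i j => by simp [f, m]
  have hZ : ∀ i j, Z q m i j = (d : ℂ)⁻¹ * q * x j * (x i - q * x j)⁻¹ := fun i j => by
    have h1 : x i * (x j)⁻¹ - q = (x i - q * x j) * (x j)⁻¹ := by
      rw [sub_mul, mul_inv_cancel_right₀ (hx0 j)]
    have h2 : Z q m i j = q * f m i j / (x i * (x j)⁻¹ - q) := rfl
    rw [h2, hf, h1, div_eq_mul_inv, mul_inv, inv_inv]
    ring
  have hC := det_cauchy_ne_zero hx (y := fun j => q * x j)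
    (fun i j h => hx (mul_left_cancel₀ hq0 h)) hxq'
  refine ⟨m, ⟨hx0, fun i j h => ⟨hx.ne h, hxq i j h⟩, fun i => ?_, fun k _ => ?_⟩,
    fun _ _ => rfl, fun i => by simp [m]⟩
  · simp [m, mul_inv_cancel₀ hd0]
  · rcases Nat.eq_zero_or_pos k with rfl | hk
    · have h1 : calZ q m 0 = Matrix.of (fun i j => (x i - q * x j)⁻¹)
          * Matrix.diagonal fun j => (d : ℂ)⁻¹ * q * x j := by
        ext i j
        rw [Matrix.mul_diagonal]
        simp only [calZ, Matrix.of_apply, hZ, Nat.not_lt_zero, Finset.filter_false,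
          Finset.sum_empty, add_zero]
        ring
      rw [h1, Matrix.det_mul, Matrix.det_diagonal]
      exact mul_ne_zero hC (Finset.prod_ne_zero_iff.2 fun j _ =>
        mul_ne_zero (mul_ne_zero (inv_ne_zero hd0) hq0) (hx0 j))
    · have h1 : calZ q m k = Matrix.diagonal (fun i => (d : ℂ)⁻¹ * x i)
          * Matrix.of (fun i j => (x i - q * x j)⁻¹) := by
        ext i j
        rw [Matrix.diagonal_mul]
        have h2 : ∑ β ∈ Finset.univ.filter (fun β : Fin d => β.val < k), m (.a i β) * m (.b j β)
            = (d : ℂ)⁻¹ := by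
          simp [m, hk]
        have h3 := sub_ne_zero.2 (hxq' i j)
        simp only [calZ, Matrix.of_apply, hZ, h2]
        field_simp
        ring
      rw [h1, Matrix.det_mul, Matrix.det_diagonal]
      exact mul_ne_zero (Finset.prod_ne_zero_iff.2 fun j _ =>
        mul_ne_zero (inv_ne_zero hd0) (hx0 j)) hC

end SpecialPoint

/-! ### Vectors tangent to `h_reg / S_n` -/

section Etale

variable {n d : ℕ} {q : ℂ}

/-- A tangent vector of `h_reg` is determined by its values on symmetric functions: the power sums
`∑_i x_i^k`, `∑_i x_i^k a_i^α` and `∑_i x_i^k b_i^α` are local coordinates, by the non-vanishing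
of the Vandermonde determinant of the `x_i`. -/
lemma pointDerivation_eq_zero (m : hReg n d q) {D : regUp n d q →ₗ[ℂ] ℂ}
    (hD : IsDerivationAlong (evalUp m) D) (h : ∀ F, D (pullHom q F) = 0) : D = 0 := by
  have hinj : Function.Injective fun i => m.1 (.x i) := fun i j hij => by
    by_contra hne
    exact (m.2.2.1 i j hne).1 hij
  have hsum : ∀ g : Fin n → regUp n d q, (∀ σ i, permUp σ (g i) = g (σ i)) →
      ∑ i, D (g i) = 0 := fun g hg => by
    obtain ⟨G, hG⟩ := exists_pullHom_sum g hg
    rw [← map_sum, ← hG, h]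
  have hpow : ∀ (u : regUp n d q) (k : ℕ), D (u ^ (k + 1)) = (k + 1) * evalUp m u ^ k * D u := by
    intro u k
    induction k with
    | zero => simp
    | succ k ih => rw [pow_succ, hD, ih, map_pow]; push_cast; ring
  have hx : ∀ i, D (coordFn q (.x i)) = 0 := by
    refine congrFun (Matrix.eq_zero_of_forall_pow_sum_mul_pow_eq_zero hinj fun k => ?_)
    have h1 := hsum (fun i => coordFn q (.x i) ^ ((k : ℕ) + 1)) fun σ i => by
      rw [map_pow, permUp_coordFn]; rfl
    simp only [hpow, evalUp_coordFn, mul_assoc, ← Finset.mul_sum] at h1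
    have h2 := (mul_eq_zero.1 h1).resolve_left (Nat.cast_add_one_ne_zero _)
    rw [← h2]
    exact Finset.sum_congr rfl fun i _ => mul_comm _ _
  have hpow' : ∀ i k, D (coordFn q (.x i) ^ k) = 0 := fun i k => by
    cases k with
    | zero => rw [pow_zero, hD.map_one]
    | succ k => rw [hpow, hx, mul_zero]
  have hy : ∀ y : Fin n → Coord n d, (∀ σ i, (y i).perm σ = y (σ i)) →
      ∀ i, D (coordFn q (y i)) = 0 := by
    intro y hy
    refine congrFun (Matrix.eq_zero_of_forall_pow_sum_mul_pow_eq_zero hinj fun k => ?_)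
    have h1 := hsum (fun i => coordFn q (.x i) ^ (k : ℕ) * coordFn q (y i)) fun σ i => by
      rw [map_mul, map_pow, permUp_coordFn, permUp_coordFn, hy]; rfl
    rw [← h1]
    refine Finset.sum_congr rfl fun i _ => ?_
    rw [hD, hpow', zero_mul, add_zero, map_pow, evalUp_coordFn, mul_comm]
  refine LinearMap.ext fun F => hD.eq_zero coordFn_generates (fun u => ?_) F
  rcases u with i | ⟨i, α⟩ | ⟨i, α⟩
  · exact hx i
  · exact hy (fun i => .a i α) (fun _ _ => rfl) i
  · exact hy (fun i => .b i α) (fun _ _ => rfl) i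

variable (hd : 0 < d) (hq : q ≠ 1) (hne : (hReg n d q).Nonempty)

lemma pointDerivation_upBracket_right (c : ℂ) (z : SpinPair d → ℂ) (m : hReg n d q)
    (F : regUp n d q) : IsDerivationAlong (evalUp m)
      ((evalUp m).toLinearMap ∘ₗ upBracket hd hq hne c z F) := fun G H => by
  simp only [LinearMap.comp_apply, AlgHom.toLinearMap_apply, (upBracket_skew hd hq hne c z).2,
    map_add, map_mul]

lemma pointDerivation_upBracket_left (c : ℂ) (z : SpinPair d → ℂ) (m : hReg n d q)
    (G : regUp n d q) : IsDerivationAlong (evalUp m)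
      ((evalUp m).toLinearMap ∘ₗ (upBracket hd hq hne c z).flip G) := fun F H => by
  simp only [LinearMap.comp_apply, AlgHom.toLinearMap_apply, LinearMap.flip_apply,
    (upBracket_skew hd hq hne c z).mul_left, map_add, map_mul]

lemma evalUp_pullHom (m : hReg n d q) (F : reg n d q) : evalUp m (pullHom q F) = F.1 ⟦m⟧ := rfl

lemma bivectorAt_downBracket (c : ℂ) (z : SpinPair d → ℂ) (m : hReg n d q) (F G : reg n d q) :
    bivectorAt (downBracket hd hq hne c z) ⟦m⟧ F G
      = evalUp m (upBracket hd hq hne c z (pullHom q F) (pullHom q G)) := by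
  rw [← pullHom_downBracket]; rfl

/-- A bracket of the pencil that vanishes at a point of `h_reg / S_n` vanishes there in local
coordinates. -/
lemma table_eq_zero_of_bivectorAt {c : ℂ} {z : SpinPair d → ℂ} {m : hReg n d q}
    (h : bivectorAt (downBracket hd hq hne c z) ⟦m⟧ = 0) (u v : Coord n d) :
    c * aoTable q m.1 u v + psiTable z m.1 u v = 0 := by
  rw [← evalUp_upBracket_coordFn hd hq hne]
  have h1 : ∀ F G, evalUp m (upBracket hd hq hne c z (pullHom q F) G) = 0 := fun F G =>
    LinearMap.congr_fun (pointDerivation_eq_zero m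
      (pointDerivation_upBracket_right hd hq hne c z m (pullHom q F)) fun G => by
        have := LinearMap.congr_fun (LinearMap.congr_fun h F) G
        rwa [bivectorAt_downBracket] at this) G
  exact LinearMap.congr_fun (pointDerivation_eq_zero m
    (pointDerivation_upBracket_left hd hq hne c z m (coordFn q v)) fun F => h1 F _) (coordFn q u)

/-- A non-degenerate bracket of the pencil is not one of the `ψ_z`: the latter have the Casimir
function `∑_i x_i`. -/
lemma ne_zero_of_isNondegenerate (hn : 0 < n) {m : hReg n d q} {α : Fin d}
    (hm : m.1 (.b ⟨0, hn⟩ α) ≠ 0) {c : ℂ} {z : SpinPair d → ℂ}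
    (h : IsNondegenerate (downBracket (n := n) hd hq hne c z)) : c ≠ 0 := by
  rintro rfl
  obtain ⟨P, hP⟩ := exists_pullHom_sum (fun i : Fin n => (coordFn q (.x i) : regUp n d q))
    fun σ i => permUp_coordFn σ _
  have hcas : ∀ F, upBracket hd hq hne 0 z F (pullHom q P) = 0 := by
    intro F
    have hD : IsDerivationAlong (AlgHom.id ℂ (regUp n d q))
        ((upBracket hd hq hne 0 z).flip (pullHom q P)) :=
      (upBracket_skew hd hq hne 0 z).derivation_left _
    refine hD.eq_zero coordFn_generates (fun u => regUp_ext fun m => ?_) F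
    rw [LinearMap.flip_apply, hP]
    simp only [map_sum, map_zero]
    refine Finset.sum_eq_zero fun i _ => ?_
    rw [evalUp_upBracket_coordFn, zero_mul, zero_add]
    cases u <;> simp [psiTable, table]
  have hv : ∀ F₀, evalUp m (upBracket hd hq hne 1 0 (pullHom q F₀) (pullHom q P)) = 0 := by
    intro F₀
    obtain ⟨F, hF⟩ := h ⟦m⟧
      ((evalUp m).toLinearMap ∘ₗ upBracket hd hq hne 1 0 (pullHom q F₀)
        ∘ₗ (pullHom q).toLinearMap) fun G H => by
      simp only [LinearMap.comp_apply, AlgHom.toLinearMap_apply, map_mul,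
        (upBracket_skew hd hq hne 1 0).2, map_add]
      rfl
    refine (hF P).trans ?_
    rw [← evalUp_pullHom, pullHom_downBracket, hcas, map_zero]
  have h1 := LinearMap.congr_fun (pointDerivation_eq_zero m
    (pointDerivation_upBracket_left hd hq hne 1 0 m (pullHom q P)) hv) (coordFn q (.b ⟨0, hn⟩ α))
  have h2 : ∑ i, evalUp m (upBracket hd hq hne 1 0 (coordFn q (.b ⟨0, hn⟩ α)) (coordFn q (.x i)))
      = 0 := by
    rw [← map_sum, ← map_sum, ← hP]
    exact h1
  rw [Finset.sum_congr rfl fun i _ => evalUp_upBracket_coordFn hd hq hne 1 0 m _ _] at h2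
  simp [psiTable_zero, aoTable, table, m.2.1, hm] at h2

end Etale

/-! ### The order of the pencil -/

section Order

variable {n d : ℕ} {q : ℂ}

lemma card_spinPair (d : ℕ) : Fintype.card (SpinPair d) = d * (d - 1) / 2 := by
  let e : SpinPair d ≃ Σ β : Fin d, Fin β :=
    { toFun := fun p => ⟨p.1.2, ⟨p.1.1, p.2⟩⟩
      invFun := fun p => ⟨(⟨p.2, p.2.2.trans p.1.2⟩, p.1), p.2.2⟩
      left_inv := fun _ => rfl
      right_inv := fun _ => rfl }
  rw [Fintype.card_congr e, Fintype.card_sigma]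
  simp only [Fintype.card_fin]
  rw [Fin.sum_univ_eq_sum_range (fun i => i), Finset.sum_range_id]

lemma psi_eq_sum (hd : 0 < d) (hq : q ≠ 1) (hne : (hReg n d q).Nonempty) (z : SpinPair d → ℂ) :
    psi (n := n) hd hq hne z = ∑ p, z p • psi hd hq hne (Pi.single p 1) := by
  have h1 : z = ∑ p : SpinPair d, z p • Pi.single p (1 : ℂ) := by
    funext p
    simp [Finset.sum_apply, Pi.single_apply]
  conv_lhs => rw [h1]
  simp [map_sum]

/-- The bracket `∑_{α < l} ψ_{αl}` is zero, for the last spin index `l`. -/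
lemma psi_last_eq_zero {e : ℕ} (hd : 0 < e + 1) (hq : q ≠ 1) (hne : (hReg n (e + 1) q).Nonempty) :
    psi (n := n) hd hq hne (fun p => if p.1.2 = Fin.last e then 1 else 0) = 0 := by
  have hz : ∀ α β : Fin (e + 1), skewExt (fun p => if p.1.2 = Fin.last e then 1 else 0) α β
      = (if β = Fin.last e then 1 else 0) - if α = Fin.last e then 1 else 0 := fun α β => by
    unfold skewExt
    rcases lt_trichotomy α β with h | h | h
    · have : α ≠ Fin.last e := (h.trans_le (Fin.le_last β)).ne
      simp [h, this]
    · simp [h]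
    · have : β ≠ Fin.last e := (h.trans_le (Fin.le_last α)).ne
      simp [h, h.not_gt, this]
  have hG : ∀ m ∈ hReg n (e + 1) q, ∀ i j α β,
      gFun (fun p => if p.1.2 = Fin.last e then 1 else 0) m i j α β = 0 := by
    intro m hm i j α β
    have ha := hm.2.2.1
    simp only [gFun, hz, sub_mul, ite_mul, one_mul, zero_mul, Finset.sum_sub_distrib,
      Finset.sum_ite_eq', Finset.mem_univ, if_true, Finset.sum_ite_irrel, Finset.sum_const_zero,
      ← Finset.mul_sum, ← Finset.sum_mul, ha]
    split_ifs <;> ring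
  refine (psi_isGivenBy hd hq hne _).unique
    (((psi_isGivenBy hd hq hne 0).smul 0).congr fun m hm u v => ?_) |>.trans (zero_smul ℂ _)
  rw [zero_mul]
  cases u <;> cases v <;> simp [psiTable, table, hG m hm]

lemma bivectorAt_sum {M J : Type*} {A : Subalgebra ℂ (M → ℂ)} [Fintype J] (c : J → ℂ)
    (B : J → Bracket A) (x : M) :
    ∑ j, c j • bivectorAt (B j) x = bivectorAt (∑ j, c j • B j) x := by
  refine LinearMap.ext fun F => LinearMap.ext fun G => ?_
  simp [bivectorAt, LinearMap.sum_apply]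

/-- The order is at most `d(d-1)/2`: by `psi_last_eq_zero` the spanning family of the pencil, with
its `d(d-1)/2 + 1` members, is linearly dependent. -/
lemma card_le_of_linearIndependent {e : ℕ} (he : 0 < e) (hd : 0 < e + 1) (hq : q ≠ 1)
    (hne : (hReg n (e + 1) q).Nonempty) {k : ℕ} {j : Fin k → Option (SpinPair (e + 1))}
    {x : Phase n (e + 1) q} (h : LinearIndependent ℂ fun i =>
      bivectorAt (pencil (brZero (n := n) hd hq hne) (psi hd hq hne) (j i)) x) :
    k ≤ (e + 1) * (e + 1 - 1) / 2 := by
  have hj : Function.Injective j := Function.Injective.of_comp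
    (f := fun o => bivectorAt (pencil (brZero (n := n) hd hq hne) (psi hd hq hne) o) x) h.injective
  have hle := Fintype.card_le_of_injective j hj
  rw [Fintype.card_fin, Fintype.card_option, card_spinPair] at hle
  refine Nat.lt_succ_iff.1 (lt_of_le_of_ne hle fun hk => ?_)
  have hb : Function.Bijective j := (Fintype.bijective_iff_injective_and_card j).2
    ⟨hj, by rw [Fintype.card_fin, Fintype.card_option, card_spinPair, hk]⟩
  have h1 : LinearIndependent ℂ fun o =>
      bivectorAt (pencil (brZero (n := n) hd hq hne) (psi hd hq hne) o) x :=
    (linearIndependent_equiv (Equiv.ofBijective j hb)).1 h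
  have h2 := Fintype.linearIndependent_iff.1 (h1.comp some (Option.some_injective _))
    (fun p => if p.1.2 = Fin.last e then 1 else 0) (by
      change ∑ p : SpinPair (e + 1), (if p.1.2 = Fin.last e then (1 : ℂ) else 0) •
        bivectorAt (psi hd hq hne (Pi.single p 1)) x = 0
      rw [bivectorAt_sum, ← psi_eq_sum hd hq hne fun p => if p.1.2 = Fin.last e then 1 else 0,
        psi_last_eq_zero]
      rfl)
    ⟨(0, Fin.last e), Fin.lt_def.2 he⟩
  simp at h2

/-- If all vectors `a_i` are equal to the same constant vector, then a bracket `ψ_z` without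
components `z_{αl}`, `l` the last spin index, is non-zero unless `z` is. -/
lemma skewExt_eq_zero_of_gFun {e : ℕ} {z : SpinPair (e + 1) → ℂ} {m : Coord n (e + 1) → ℂ} {s : ℂ}
    {i : Fin n} (ha : ∀ α, m (.a i α) = s) (hz : ∀ α, skewExt z α (Fin.last e) = 0)
    (hG : ∀ α β, gFun z m i i α β = 0) (α β : Fin (e + 1)) : skewExt z α β = 0 := by
  have hself : ∀ α, skewExt z α α = 0 := fun α => by simp [skewExt]
  simp only [gFun, ha, Finset.sum_sub_distrib] at hG
  have h1 : ∑ μ, skewExt z μ (Fin.last e) * s = 0 := by simp [hz]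
  have h2 := hG β β
  have h3 := hG α (Fin.last e)
  have h4 := hG β (Fin.last e)
  have h5 := hG α β
  rw [hself] at h2
  rw [hz, h1] at h3 h4
  linear_combination h5 - h3 + h4 - h2

/-- The order is at least `(d-1)(d-2)/2 + 1`: `{-,-}_0` and the `ψ_{αβ}` for `α < β < d` are
linearly independent at a point with all `a_i` equal to the same constant vector. -/
lemma linearIndependent_pencil {e : ℕ} (hd : 0 < e + 1) (hq : q ≠ 1)
    (hne : (hReg n (e + 1) q).Nonempty) (i : Fin n) {m : hReg n (e + 1) q} {s : ℂ} (hs : s ≠ 0)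
    (ha : ∀ α, m.1 (.a i α) = s) {γ : Fin (e + 1)} (hb : m.1 (.b i γ) ≠ 0) :
    ∃ j : Fin (e * (e - 1) / 2 + 1) → Option (SpinPair (e + 1)), LinearIndependent ℂ fun i =>
      bivectorAt (pencil (brZero (n := n) hd hq hne) (psi hd hq hne) (j i)) ⟦m⟧ := by
  let emb : SpinPair e → SpinPair (e + 1) := fun p =>
    ⟨(p.1.1.castSucc, p.1.2.castSucc), Fin.castSucc_lt_castSucc_iff.2 p.2⟩
  have hemb : Function.Injective emb := fun p p' h => by
    have h1 := congrArg (fun t => t.1.1) h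
    have h2 := congrArg (fun t => t.1.2) h
    exact Subtype.ext (Prod.ext (Fin.castSucc_injective _ h1) (Fin.castSucc_injective _ h2))
  have hli : LinearIndependent ℂ fun o : Option (SpinPair e) =>
      bivectorAt (pencil (brZero (n := n) hd hq hne) (psi hd hq hne) (o.map emb)) ⟦m⟧ := by
    refine Fintype.linearIndependent_iff.2 fun g hg => ?_
    let z : SpinPair (e + 1) → ℂ := ∑ p, g (some p) • Pi.single (emb p) 1
    have hz : psi (n := n) hd hq hne z = ∑ p, g (some p) • psi hd hq hne (Pi.single (emb p) 1) := by
      simp [z, map_sum]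
    rw [bivectorAt_sum, Fintype.sum_option] at hg
    change bivectorAt (g none • brZero (n := n) hd hq hne
      + ∑ p, g (some p) • psi hd hq hne (Pi.single (emb p) 1)) ⟦m⟧ = 0 at hg
    rw [← hz, smul_brZero_add_psi] at hg
    have htab := table_eq_zero_of_bivectorAt hd hq hne hg
    have h0 : g none = 0 := by
      have h := htab (.x i) (.b i γ)
      simpa [aoTable, psiTable, table, m.2.1, hb] using h
    have hG : ∀ α β, gFun z m.1 i i α β = 0 := fun α β => by
      have h := htab (.a i α) (.a i β)
      simpa [h0, psiTable, table, ha, hs] using h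
    have hzemb : ∀ p, z (emb p) = g (some p) := fun p => by
      simp only [z, Finset.sum_apply, Pi.smul_apply, smul_eq_mul]
      rw [Finset.sum_eq_single p (fun p' _ hp => by simp [hemb.ne hp.symm]) (by simp)]
      simp
    have hzlast : ∀ α, skewExt z α (Fin.last e) = 0 := fun α => by
      unfold skewExt
      rw [dif_neg (Fin.le_last α).not_gt]
      split_ifs with h
      · simp only [z, Finset.sum_apply, Pi.smul_apply, smul_eq_mul]
        refine Finset.sum_eq_zero fun p _ => ?_
        have hp : (⟨(α, Fin.last e), h⟩ : SpinPair (e + 1)) ≠ emb p := fun h => by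
          have := congrArg (fun t => t.1.2) h
          exact (Fin.castSucc_lt_last p.1.2).ne this.symm
        simp [hp]
      · rfl
    rintro (_ | p)
    · exact h0
    · rw [← hzemb p]
      have h := skewExt_eq_zero_of_gFun ha hzlast hG (emb p).1.1 (emb p).1.2
      rwa [skewExt, dif_pos (emb p).2] at h
  have hcard : Fintype.card (Option (SpinPair e)) = e * (e - 1) / 2 + 1 := by
    rw [Fintype.card_option, card_spinPair]
  let E := (Fintype.equivFinOfCardEq hcard).symm
  exact ⟨fun i => (E i).map emb, hli.comp E E.injective⟩

lemma exists_hasOrder (hn : 1 ≤ n) (hd2 : 2 ≤ d) (hd : 0 < d) (hq0 : q ≠ 0) (hq : q ≠ 1)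
    (hne : (hReg n d q).Nonempty) :
    ∃ r : ℕ, HasOrder (pencil (brZero (n := n) hd hq hne) (psi hd hq hne)) r ∧
      (d - 1) * (d - 2) / 2 + 1 ≤ r ∧ r ≤ d * (d - 1) / 2 := by
  obtain ⟨e, rfl⟩ : ∃ e, d = e + 1 := ⟨d - 1, by omega⟩
  obtain ⟨m, hm, ha, hb⟩ := exists_mem_hReg (n := n) hd hq0 hq
  let S : Set ℕ := {k | ∃ (j : Fin k → Option (SpinPair (e + 1))) (x : Phase n (e + 1) q),
    LinearIndependent ℂ fun i =>
      bivectorAt (pencil (brZero (n := n) hd hq hne) (psi hd hq hne) (j i)) x}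
  have hle : ∀ k ∈ S, k ≤ (e + 1) * (e + 1 - 1) / 2 := fun k ⟨j, x, h⟩ =>
    card_le_of_linearIndependent (by omega) hd hq hne h
  have hmem : e * (e - 1) / 2 + 1 ∈ S := by
    obtain ⟨j, hj⟩ := linearIndependent_pencil (m := ⟨m, hm⟩) hd hq hne ⟨0, hn⟩
      (s := ((e + 1 : ℕ) : ℂ)⁻¹) (inv_ne_zero (Nat.cast_ne_zero.2 hd.ne')) (fun α => ha _ α)
      (γ := ⟨0, hd⟩) ((hb _).trans_ne one_ne_zero)
    exact ⟨j, _, hj⟩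
  have hbdd : BddAbove S := ⟨_, hle⟩
  exact ⟨sSup S, ⟨Nat.sSup_mem ⟨_, hmem⟩ hbdd, fun k hk => le_csSup hbdd hk⟩, le_csSup hbdd hmem,
    hle _ (Nat.sSup_mem ⟨_, hmem⟩ hbdd)⟩

end Order
end SpinRS

theorem theoremB (n d : ℕ) (hn : 1 ≤ n) (hd : 2 ≤ d) (q : ℂ) (hq0 : q ≠ 0)
    (hq : ∀ k : ℕ, 1 ≤ k → k ≤ n → q ^ k ≠ 1) :
    ∃ (br0 brMinus : SpinRS.Bracket (SpinRS.reg n d q))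
      (ψ : (SpinRS.SpinPair d → ℂ) →ₗ[ℂ] SpinRS.Bracket (SpinRS.reg n d q))
      (h : SpinRS.reg n d q),
      -- the brackets, and the Hamiltonian, are the ones given by the local formulas
      (∀ B, SpinRS.IsGivenBy (SpinRS.cfTable q) B ↔ B = br0) ∧
      (∀ B, SpinRS.IsGivenBy (SpinRS.aoTable q) B ↔ B = brMinus) ∧
      (∀ z B, SpinRS.IsGivenBy (SpinRS.psiTable z) B ↔ B = ψ z) ∧
      (∀ m : SpinRS.hReg n d q,
        h.1 ⟦m⟧ = 2 * (q⁻¹ - 1) * (SpinRS.Z q m.1).trace ∧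
        h.1 ⟦m⟧ = 2 * ∑ i, SpinRS.f m.1 i i) ∧
      -- the Poisson pencil and its order
      SpinRS.IsPoissonPencil (SpinRS.pencil br0 ψ) ∧
      (∃ r : ℕ, SpinRS.HasOrder (SpinRS.pencil br0 ψ) r ∧
        (d - 1) * (d - 2) / 2 + 1 ≤ r ∧ r ≤ d * (d - 1) / 2) ∧
      -- both brackets belong to the pencil, and they are compatible
      brMinus = br0 + ψ (fun _ => 1 / 2) ∧
      (∀ s t : ℂ, SpinRS.IsPoisson (s • br0 + t • brMinus)) ∧
      -- the Hamiltonian formulation of the spin RS system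
      (∀ (z₀ : ℂ) (z : SpinRS.SpinPair d → ℂ), z₀ ≠ 0 →
        SpinRS.GeneratesRS (z₀ • br0 + ψ z) (z₀⁻¹ • h)) ∧
      (∀ (z₀ : ℂ) (z : SpinRS.SpinPair d → ℂ), SpinRS.IsNondegenerate (z₀ • br0 + ψ z) →
        ∃ c : ℂ, c ≠ 0 ∧ SpinRS.GeneratesRS (z₀ • br0 + ψ z) (c • h)) := by
  have hd0 : 0 < d := by omega
  have hq1 : q ≠ 1 := by simpa using hq 1 le_rfl hn
  obtain ⟨m, hm, -, hb⟩ := SpinRS.exists_mem_hReg (n := n) hd0 hq0 hq1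
  have hne : (SpinRS.hReg n d q).Nonempty := ⟨m, hm⟩
  have hRS : ∀ (z₀ : ℂ) (z : SpinRS.SpinPair d → ℂ), z₀ ≠ 0 → SpinRS.GeneratesRS
      (z₀ • SpinRS.brZero (n := n) hd0 hq1 hne + SpinRS.psi hd0 hq1 hne z)
      (z₀⁻¹ • SpinRS.hamiltonian) := fun z₀ z hz => by
    rw [SpinRS.smul_brZero_add_psi]
    exact SpinRS.generatesRS_downBracket hd0 hq1 hne hz _
  refine ⟨SpinRS.brZero hd0 hq1 hne, SpinRS.brMinus hd0 hq1 hne, SpinRS.psi hd0 hq1 hne,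
    SpinRS.hamiltonian, (SpinRS.brZero_isGivenBy hd0 hq1 hne).iff_eq,
    (SpinRS.brMinus_isGivenBy hd0 hq1 hne).iff_eq,
    fun z => (SpinRS.psi_isGivenBy hd0 hq1 hne z).iff_eq, fun m => ⟨?_, SpinRS.hamiltonian_eq m⟩,
    SpinRS.pencil_isPoissonPencil hd0 hq1 hne, SpinRS.exists_hasOrder hn hd hd0 hq0 hq1 hne,
    SpinRS.brMinus_eq hd0 hq1 hne, SpinRS.smul_add_smul_isPoisson hd0 hq1 hne, hRS,
    fun z₀ z h => ?_⟩
  · rw [SpinRS.hamiltonian_eq, SpinRS.sum_f_eq_trace hq0 hq1]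
  · have hz : z₀ ≠ 0 := by
      rw [SpinRS.smul_brZero_add_psi] at h
      exact SpinRS.ne_zero_of_isNondegenerate (m := ⟨m, hm⟩) (α := ⟨0, hd0⟩) hd0 hq1 hne hn
        ((hb _).trans_ne one_ne_zero) h
    exact ⟨z₀⁻¹, inv_ne_zero hz, hRS z₀ z hz⟩
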